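/- Let $\mathbb H$ be a real Hilbert space with a Hilbert basis $(e_i)_{i\ge 1}$ indexed by the positive integers. Let $\mathcal H=\mathbb R\oplus\mathbb H$ carry the inner product $\langle (s,x),(t,y)\rangle=st+\langle x,y\rangle$, the Hilbert basis $(e_i)_{i\ge 0}$ with $e_0=(1,0)$ (and $e_i=(0,e_i)$ for $i\geq 1$), and the Lorentz product $\langle (s,x),(t,y)\rangle_L=\langle x,y\rangle-st$. Let $L_{HS}(\mathcal H)$ be the space of bounded operators $A$ on $\mathcal H$ with $|A|_{HS}^2=\sum_{i\ge0}|Ae_i|^2<\infty$, with the inner product $\langle A,B\rangle_{HS}=\sum_i\langle Ae_i,Be_i\rangle$ and the bracket $[A,B]=AB-BA$, and let $GL_{HS}(\mathcal H)$ be the group of invertible bounded operators $U$ with $U-\mathrm{Id}\in L_{HS}(\mathcal H)$; its manifold structure and topology are given by the global chart $U\mapsto U-\mathrm{Id}$ into $L_{HS}(\mathcal H)$. Let $e_{ij}$ be the operator $w\mapsto\langle e_j,w\rangle e_i$. Let $\mathfrak h_\infty$ and $\mathfrak s_\infty$ be the closed linear spans in $L_{HS}(\mathcal H)$ of the operators $e_{0i}+e_{i0}$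 ($i\ge1$) and $e_{ij}-e_{ji}$ ($0<i<j$), respectively, and put $\mathfrak g_\infty=\mathfrak h_\infty\oplus\mathfrak s_\infty$ (an orthogonal sum). Let $\mathcal H_n$ be the span of $e_0,\dots,e_n$. Let $\mathfrak{so}(n,1)\subset L_{HS}(\mathcal H)$ be the set of operators $\begin{pmatrix}0&[u]^*\\ [u]&B\end{pmatrix}$ (that is, $(s,x)\mapsto(\langle u,x\rangle,su+Bx)$) with $u\in\mathbb H$, $B^*=-B$, that vanish on $\mathcal H_n^\perp$ and take their values in $\mathcal H_n$. Let $O(\mathbb H,1)$ be the group of invertible bounded operators of $\mathcal H$ that preserve the Lorentz product, $SO(\mathbb H,1)$ the subgroup of those that map $\{u=(s,x):\langle u,u\rangle_L=0,\ s>0\}$ onto itself, $O(n,1)$ the group of those elements of $O(\mathbb H,1)$ that map $\mathcal H_n$ into itself and are the identity on $\mathcal H_n^\perp$, and $SO_0(n,1)$ the connected component of the identity in $O(n,1)$. For $A,B\in GL(\mathcal H)$ let $d(A,B)\in[0,\infty]$ be the infimum of $\int_0^1|\gamma^{-1}\dot\gamma|_{HS}\,ds$ over all piecewise $C^1$ paths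 $\gamma:[0,1]\to GL(\mathcal H)$ from $A$ to $B$ such that $\gamma^{-1}\dot\gamma$ takes its values in $\mathfrak g_\infty$ and is piecewise continuous for $|\cdot|_{HS}$ (and $d(A,B)=\infty$ if there is no such path). Let $G_\infty=\{A\in GL(\mathcal H): d(A,\mathrm{Id})<\infty\}$ (the Cameron–Martin group of the sequence $(SO_0(n,1))_n$). A boost is an operator $T$ of $\mathcal H$ such that, for some unit vector $u\in\mathbb H$ and some $\alpha\ge0$, $T(1,0)=(\cosh\alpha,\sinh\alpha\,u)$, $T(0,u)=(\sinh\alpha,\cosh\alpha\, u)$ and $T(0,x)=(0,x)$ for all $x\perp u$. For a bounded operator $Q$ of $\mathbb H$, $\det Q=\lim_{n\to\infty}\det(\langle e_i,Qe_j\rangle)_{1\le i,j\le n}$ when this limit exists. Then: 1. $\mathfrak g_\infty$ is the closure of $\bigcup_n\mathfrak{so}(n,1)$ in $L_{HS}(\mathcal H)$. It is complete, closed under the bracket, and there is a constant $C>0$ with $|[A,B]|_{HS}\le C|A|_{HS}|B|_{HS}$ for all $A,B\in\mathfrak g_\infty$. 2. $G_\infty$ is a Lie subgroup of $GL_{HS}(\mathcal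 H)$ (a subgroup that is an embedded smooth submanifold, modelled on $\mathfrak g_\infty$), and the topology of $d$ on $G_\infty$ is the one induced by $GL_{HS}(\mathcal H)$. The set $\bigcup_nSO_0(n,1)$ is contained in $G_\infty$ and dense in it. The Lie algebra of $G_\infty$ (its tangent space at the identity, with the bracket of $L_{HS}(\mathcal H)$) is $\mathfrak g_\infty$. 3. Each $A\in G_\infty$ can be written as $A=PT$, where $T$ is a boost and $P=\begin{pmatrix}1&0\\0&Q\end{pmatrix}$ with $Q^{-1}=Q^*$ and $\det Q=1$ (in particular the limit exists). Moreover $SO(\mathbb H,1)\cap GL_{HS}(\mathcal H)$ has exactly two connected components, and $G_\infty$ is the connected component of the identity. 4. The exponential map $\mathrm{Exp}$ maps $\mathfrak g_\infty$ onto $G_\infty$ and is a local diffeomorphism from $\mathfrak g_\infty$ to $G_\infty$ around $0$. -/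

import Mathlib

open Set Filter Topology
open scoped ContDiff ENNReal

noncomputable section

namespace HSLorentz

/-! ### The Hilbert space `ℝ ⊕ H`, its basis and its Lorentz form -/

/-- The Hilbert sum `ℝ ⊕ H` with inner product `⟪(s,x),(t,y)⟫ = s t + ⟪x,y⟫`. -/
def Sp (H : Type*) [NormedAddCommGroup H] [InnerProductSpace ℝ H] : Type _ :=
  WithLp 2 (ℝ × H)

instance (H : Type*) [NormedAddCommGroup H] [InnerProductSpace ℝ H] : NormedAddCommGroup (Sp H) :=
  inferInstanceAs (NormedAddCommGroup (WithLp 2 (ℝ × H)))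

instance (H : Type*) [NormedAddCommGroup H] [InnerProductSpace ℝ H] : InnerProductSpace ℝ (Sp H) :=
  inferInstanceAs (InnerProductSpace ℝ (WithLp 2 (ℝ × H)))

instance (H : Type*) [NormedAddCommGroup H] [InnerProductSpace ℝ H] [CompleteSpace H] :
    CompleteSpace (Sp H) :=
  inferInstanceAs (CompleteSpace (WithLp 2 (ℝ × H)))

/-- Bounded operators on `ℝ ⊕ H`. -/
abbrev Op (H : Type*) [NormedAddCommGroup H] [InnerProductSpace ℝ H] : Type _ :=
  Sp H →L[ℝ] Sp H

variable {H : Type*} [NormedAddCommGroup H] [InnerProductSpace ℝ H]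

/-- The identification of `ℝ ⊕ H` with the product space. -/
def toProd (H : Type*) [NormedAddCommGroup H] [InnerProductSpace ℝ H] : Sp H ≃L[ℝ] ℝ × H :=
  WithLp.prodContinuousLinearEquiv 2 ℝ ℝ H

/-- The vector `(s, x)` of `ℝ ⊕ H`. -/
def vec (s : ℝ) (x : H) : Sp H := (toProd H).symm (s, x)

/-- The component in `ℝ` of a vector of `ℝ ⊕ H`. -/
def Sp.fst (u : Sp H) : ℝ := (toProd H u).1

/-- The component in `H` of a vector of `ℝ ⊕ H`. -/
def Sp.snd (u : Sp H) : H := (toProd H u).2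

theorem vec_fst_snd (u : Sp H) : vec u.fst u.snd = u := (toProd H).symm_apply_apply u

theorem inner_vec (s t : ℝ) (x y : H) :
    (inner ℝ (vec s x) (vec t y) : ℝ) = s * t + inner ℝ x y := by
  have : (inner ℝ (vec s x) (vec t y) : ℝ) = inner ℝ s t + inner ℝ x y := rfl
  rw [this]
  simp [mul_comm]

/-- The basis of `ℝ ⊕ H`: `e 0 = (1, 0)` and `e (i + 1) = (0, b i)`, where `b` is the fixed
Hilbert basis of `H`. -/
def e (b : HilbertBasis ℕ ℝ H) : ℕ → Sp H
  | 0 => vec 1 0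
  | i + 1 => vec 0 (b i)

/-- The Lorentz product `⟪x,y⟫ - s t` of `(s,x)` and `(t,y)`. -/
def lorentz (u v : Sp H) : ℝ := inner ℝ u.snd v.snd - u.fst * v.fst

/-- The positive light cone. -/
def coneP : Set (Sp H) := {u | lorentz u u = 0 ∧ 0 < u.fst}

/-- `O(H,1)`: the invertible bounded operators that preserve the Lorentz product. -/
def lorentzO (H : Type*) [NormedAddCommGroup H] [InnerProductSpace ℝ H] : Set (Op H)ˣ :=
  {A | ∀ u v : Sp H, lorentz ((A : Op H) u) ((A : Op H) v) = lorentz u v}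

/-- `SO(H,1)`: the elements of `O(H,1)` that map the positive light cone onto itself. -/
def lorentzSO (H : Type*) [NormedAddCommGroup H] [InnerProductSpace ℝ H] : Set (Op H)ˣ :=
  {A | A ∈ lorentzO H ∧ (A : Op H) '' coneP = coneP}

/-- The operator with block matrix `(c, [v]^*; [u], B)`, that is
`(s, x) ↦ (c s + ⟪v, x⟫, s u + B x)`. -/
def blockOp (c : ℝ) (v u : H) (B : H →L[ℝ] H) : Op H :=
  (toProd H).symm.toContinuousLinearMap ∘L
    (((c • ContinuousLinearMap.fst ℝ ℝ H) + (innerSL ℝ v) ∘L ContinuousLinearMap.snd ℝ ℝ H).prod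
      ((ContinuousLinearMap.fst ℝ ℝ H).smulRight u + B ∘L ContinuousLinearMap.snd ℝ ℝ H)) ∘L
    (toProd H).toContinuousLinearMap

theorem blockOp_vec (c : ℝ) (v u : H) (B : H →L[ℝ] H) (s : ℝ) (x : H) :
    blockOp c v u B (vec s x) = vec (c * s + inner ℝ v x) (s • u + B x) := rfl

/-- Lorentz boosts: for some unit vector `u` and some `α ≥ 0`, the operator is the identity on
`{0} ⊕ u^⊥` and has matrix `(cosh α, sinh α; sinh α, cosh α)` in the basis `(1,0), (0,u)`. -/
def IsBoost (T : Op H) : Prop :=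
  ∃ (u : H) (α : ℝ), ‖u‖ = 1 ∧ 0 ≤ α ∧
    T (vec 1 0) = vec (Real.cosh α) (Real.sinh α • u) ∧
    T (vec 0 u) = vec (Real.sinh α) (Real.cosh α • u) ∧
    ∀ x : H, inner ℝ u x = 0 → T (vec 0 x) = vec 0 x

/-! ### Hilbert-Schmidt operators -/

variable (b : HilbertBasis ℕ ℝ H)

theorem orthonormal_e : Orthonormal ℝ (e b) := by
  rw [orthonormal_iff_ite]
  intro i j
  cases i <;> cases j <;> simp only [e, inner_vec, orthonormal_iff_ite.1 b.orthonormal] <;> simp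

theorem eq_zero_of_e {A : Op H} (h : ∀ i, A (e b i) = 0) : A = 0 := by
  have h2 : A ∘L ((toProd H).symm.toContinuousLinearMap ∘L
      ContinuousLinearMap.inr ℝ ℝ H) = 0 := by
    apply ContinuousLinearMap.ext_on (s := Set.range b)
    · exact Submodule.dense_iff_topologicalClosure_eq_top.2 b.dense_span
    · rintro _ ⟨i, rfl⟩
      exact h (i + 1)
  ext1 w
  have hw : w = w.fst • vec (1 : ℝ) (0 : H) + vec 0 w.snd := by
    conv_lhs => rw [← vec_fst_snd w]
    simp only [vec, ← map_smul, ← map_add]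
    simp
  have h0 : A (vec 1 0) = 0 := h 0
  have h3 : A (vec 0 w.snd) = 0 := DFunLike.congr_fun h2 w.snd
  rw [hw, map_add, map_smul, h0, h3]
  simp

/-- The operators `A` with `∑ ‖A e_i‖² < ∞`. -/
def hsSubmodule : Submodule ℝ (Op H) where
  carrier := {A | Summable fun i => ‖A (e b i)‖ ^ 2}
  zero_mem' := by simp [summable_zero]
  add_mem' := by
    intro A B hA hB
    refine Summable.of_nonneg_of_le (fun i => by positivity) (fun i => ?_)
      ((hA.mul_left 2).add (hB.mul_left 2))
    have h1 := norm_add_le (A (e b i)) (B (e b i))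
    have h2 : ‖(A + B) (e b i)‖ ^ 2 ≤ (‖A (e b i)‖ + ‖B (e b i)‖) ^ 2 := by
      gcongr
      simpa using h1
    nlinarith [sq_nonneg (‖A (e b i)‖ - ‖B (e b i)‖)]
  smul_mem' := by
    intro c A hA
    have := Summable.mul_left (‖c‖ ^ 2) hA
    simpa [norm_smul, mul_pow] using this

theorem mul_mem_hs (B : Op H) {A : Op H} (hA : A ∈ hsSubmodule b) : B * A ∈ hsSubmodule b := by
  refine Summable.of_nonneg_of_le (fun i => by positivity) (fun i => ?_)
    (Summable.mul_left (‖B‖ ^ 2) hA)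
  have := B.le_opNorm (A (e b i))
  calc ‖(B * A) (e b i)‖ ^ 2 ≤ (‖B‖ * ‖A (e b i)‖) ^ 2 := by
        gcongr
        exact this
    _ = _ := by ring

/-- The space of Hilbert-Schmidt operators. It is a type of its own because its topology is that
of the Hilbert-Schmidt norm and not that of the operator norm. -/
def LHS : Type _ := ↥(hsSubmodule b)

namespace LHS

instance : AddCommGroup (LHS b) := inferInstanceAs (AddCommGroup ↥(hsSubmodule b))
instance : Module ℝ (LHS b) := inferInstanceAs (Module ℝ ↥(hsSubmodule b))

variable {b}

/-- The underlying bounded operator. -/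
def op (A : LHS b) : Op H := A.1

theorem op_injective : Function.Injective (op : LHS b → Op H) := Subtype.val_injective
theorem op_add (A B : LHS b) : (A + B).op = A.op + B.op := rfl
theorem op_smul (c : ℝ) (A : LHS b) : (c • A).op = c • A.op := rfl

theorem summable_sq (A : LHS b) : Summable fun i => ‖A.op (e b i)‖ ^ 2 := A.2

theorem summable_inner (A B : LHS b) :
    Summable fun i => (inner ℝ (A.op (e b i)) (B.op (e b i)) : ℝ) := by
  refine Summable.of_norm_bounded (A.summable_sq.add B.summable_sq) fun i => ?_
  have := norm_inner_le_norm (𝕜 := ℝ) (A.op (e b i)) (B.op (e b i))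
  nlinarith [sq_nonneg (‖A.op (e b i)‖ - ‖B.op (e b i)‖),
    sq_nonneg (‖A.op (e b i)‖), sq_nonneg (‖B.op (e b i)‖)]

variable (b) in
/-- The Hilbert-Schmidt inner product `∑ ⟪A e_i, B e_i⟫`. -/
@[reducible] def core : InnerProductSpace.Core ℝ (LHS b) where
  inner A B := ∑' i, inner ℝ (A.op (e b i)) (B.op (e b i))
  conj_inner_symm A B := tsum_congr fun i => real_inner_comm _ _
  re_inner_nonneg A := by
    simpa using tsum_nonneg fun i => real_inner_self_nonneg (x := A.op (e b i))
  add_left A B C := by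
    simp only [op_add, add_apply, inner_add_left]
    exact (summable_inner A C).tsum_add (summable_inner B C)
  smul_left A B r := by
    simp only [op_smul, smul_apply, inner_smul_left]
    exact tsum_mul_left
  definite A h := by
    apply op_injective
    apply eq_zero_of_e b
    intro i
    have h1 := (summable_inner A A).hasSum
    have h2 := (hasSum_zero_iff_of_nonneg fun i => real_inner_self_nonneg).1 (h ▸ h1)
    exact inner_self_eq_zero.1 (congrFun h2 i)

instance : NormedAddCommGroup (LHS b) :=
  @InnerProductSpace.Core.toNormedAddCommGroup ℝ (LHS b) _ _ _ (core b)

instance : InnerProductSpace ℝ (LHS b) := InnerProductSpace.ofCore (core b).toCore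

theorem inner_def (A B : LHS b) :
    inner ℝ A B = ∑' i, inner ℝ (A.op (e b i)) (B.op (e b i)) := rfl

theorem norm_sq_eq (A : LHS b) : ‖A‖ ^ 2 = ∑' i, ‖A.op (e b i)‖ ^ 2 := by
  rw [← real_inner_self_eq_norm_sq, inner_def]
  simp

/-- The commutator bracket `[A,B] = AB - BA`. -/
instance : Bracket (LHS b) (LHS b) where
  bracket A B := ⟨A.op * B.op - B.op * A.op,
    Submodule.sub_mem _ (mul_mem_hs b A.op B.2) (mul_mem_hs b B.op A.2)⟩

theorem op_bracket (A B : LHS b) : ⁅A, B⁆.op = A.op * B.op - B.op * A.op := rfl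

end LHS

/-- The matrix unit `e_{ij}`: the operator `w ↦ ⟪e_j, w⟫ e_i`. -/
def matUnit (i j : ℕ) : LHS b :=
  ⟨(innerSL ℝ (e b j)).smulRight (e b i), by
    refine summable_of_ne_finset_zero (s := {j}) fun k hk => ?_
    have : inner ℝ (e b j) (e b k) = 0 :=
      (orthonormal_e b).2 (fun h => hk (by simp [h]))
    simp [this]⟩

/-! ### The Lie algebras -/

/-- The closed span of the operators `U_i = e_{0i} + e_{i0}`, `i ≥ 1`. -/
def hInf : Submodule ℝ (LHS b) :=
  (Submodule.span ℝ {X | ∃ i, 0 < i ∧ X = matUnit b 0 i + matUnit b i 0}).topologicalClosure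

/-- The closed span of the operators `Ω_{ij} = e_{ij} - e_{ji}`, `0 < i < j`. -/
def sInf : Submodule ℝ (LHS b) :=
  (Submodule.span ℝ
    {X | ∃ i j, 0 < i ∧ i < j ∧ X = matUnit b i j - matUnit b j i}).topologicalClosure

/-- `g_∞`, the sum of `hInf` and `sInf`. -/
def gInf : Submodule ℝ (LHS b) := hInf b ⊔ sInf b

/-- The span of `e_0, …, e_n`. -/
def Hn (n : ℕ) : Submodule ℝ (Sp H) := Submodule.span ℝ (e b '' {i | i ≤ n})

/-- `so(n,1)`: block matrices `(0, [u]^*; [u], B)` with `B^* = -B` that vanish on the orthogonal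
of the span of `e_0, …, e_n` and take their values in this span. -/
def so [CompleteSpace H] (n : ℕ) : Set (LHS b) :=
  {A | (∀ w ∈ (Hn b n)ᗮ, A.op w = 0) ∧ (∀ w, A.op w ∈ Hn b n) ∧
    ∃ (u : H) (B : H →L[ℝ] H), ContinuousLinearMap.adjoint B = -B ∧ A.op = blockOp 0 u u B}

/-- The completeness and bracket assumption on a subspace `𝔤` that contains a union `g` of
Lie algebras of finite dimensional groups, the inner product on both being the
Hilbert-Schmidt one. -/
structure CompletionAssumption (g : Set (LHS b)) (𝔤 : Submodule ℝ (LHS b)) : Prop where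
  subset : g ⊆ 𝔤
  complete : IsComplete (𝔤 : Set (LHS b))
  dense : (𝔤 : Set (LHS b)) ⊆ closure g
  bracket_mem : ∀ A ∈ 𝔤, ∀ B ∈ 𝔤, ⁅A, B⁆ ∈ 𝔤
  bracket_le : ∃ C : ℝ, 0 < C ∧ ∀ A ∈ 𝔤, ∀ B ∈ 𝔤, ‖⁅A, B⁆‖ ≤ C * ‖A‖ * ‖B‖

/-! ### The groups -/

/-- `O(n,1)` as a subgroup of the invertible operators: the Lorentz operators that map the span
of `e_0, …, e_n` into itself and are the identity on its orthogonal. -/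
def On (n : ℕ) : Set (Op H)ˣ :=
  {A | A ∈ lorentzO H ∧ (∀ w ∈ (Hn b n)ᗮ, (A : Op H) w = w) ∧
    ∀ w ∈ Hn b n, (A : Op H) w ∈ Hn b n}

/-- `SO_0(n,1)`: the connected component of the identity in `O(n,1)`. -/
def SO0 (n : ℕ) : Set (Op H)ˣ := connectedComponentIn (On b n) 1

/-- The general Hilbert-Schmidt group: the invertible operators `U` with `U - Id`
Hilbert-Schmidt. -/
def GLHS : Subgroup (Op H)ˣ where
  carrier := {U | (U : Op H) - 1 ∈ hsSubmodule b}
  one_mem' := by simp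
  mul_mem' := by
    intro U V hU hV
    have : ((U * V : (Op H)ˣ) : Op H) - 1 = U * ((V : Op H) - 1) + ((U : Op H) - 1) := by
      rw [Units.val_mul, mul_sub, mul_one]; abel
    change ((U * V : (Op H)ˣ) : Op H) - 1 ∈ hsSubmodule b
    rw [this]
    exact Submodule.add_mem _ (mul_mem_hs b _ hV) hU
  inv_mem' := by
    intro U hU
    have : ((U⁻¹ : (Op H)ˣ) : Op H) - 1 = -((U⁻¹ : (Op H)ˣ) * ((U : Op H) - 1)) := by
      rw [mul_sub, Units.inv_mul, mul_one]; abel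
    change ((U⁻¹ : (Op H)ˣ) : Op H) - 1 ∈ hsSubmodule b
    rw [this]
    exact Submodule.neg_mem _ (mul_mem_hs b _ hU)

/-- The global chart `U ↦ U - Id` of the general Hilbert-Schmidt group. It identifies this group
with an open subset of the Hilbert space of Hilbert-Schmidt operators, and the manifold
structure and the topology of the group are those transported by it. -/
def chart (U : GLHS b) : LHS b := ⟨((U : (Op H)ˣ) : Op H) - 1, U.2⟩

/-- The trace of a set of invertible operators on the general Hilbert-Schmidt group, read in the
global chart. -/
def inChart (G : Set (Op H)ˣ) : Set (LHS b) := chart b '' {U : GLHS b | (U : (Op H)ˣ) ∈ G}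

/-- Piecewise `C¹` paths `γ : [0,1] → GL` whose logarithmic derivative `v = γ⁻¹ γ̇` takes its
values in `𝔤` and is piecewise continuous for the Hilbert-Schmidt norm. On each closed
interval of a subdivision, `v` is given by a continuous function `w` (the values of `v` at the
right ends of these intervals do not matter). -/
def IsCMPath (𝔤 : Submodule ℝ (LHS b)) (γ : ℝ → (Op H)ˣ) (v : ℝ → LHS b) : Prop :=
  ∃ (N : ℕ) (t : ℕ → ℝ), t 0 = 0 ∧ t N = 1 ∧ (∀ i < N, t i < t (i + 1)) ∧
    ∀ i < N, ∃ w : ℝ → LHS b, ContinuousOn w (Icc (t i) (t (i + 1))) ∧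
      ∀ s ∈ Icc (t i) (t (i + 1)), w s ∈ 𝔤 ∧
        HasDerivWithinAt (fun r => (γ r : Op H)) ((γ s : Op H) * (w s).op)
          (Icc (t i) (t (i + 1))) s ∧
        (s < t (i + 1) → v s = w s)

/-- The distance: the infimum of the lengths `∫₀¹ ‖γ⁻¹ γ̇‖` of the paths from `A` to `B`; it
is `∞` if there is no path. -/
def cmDist (𝔤 : Submodule ℝ (LHS b)) (A B : (Op H)ˣ) : ℝ≥0∞ :=
  ⨅ (γ : ℝ → (Op H)ˣ) (v : ℝ → LHS b) (_ : IsCMPath b 𝔤 γ v) (_ : γ 0 = A ∧ γ 1 = B),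
    ∫⁻ s in Icc (0 : ℝ) 1, ‖v s‖ₑ

/-- The Cameron-Martin group: the operators at finite distance from the identity. -/
def cmGroup (𝔤 : Submodule ℝ (LHS b)) : Set (Op H)ˣ := {A | cmDist b 𝔤 A 1 < ⊤}

/-- The set `G` is a Lie subgroup of the general Hilbert-Schmidt group modelled on the closed
subspace `𝔤`: it is a subgroup and an embedded smooth submanifold, that is, around each of its
points there is a smooth diffeomorphism between open sets that straightens it to `𝔤`. -/
def IsLieSubgroup (G : Set (Op H)ˣ) (𝔤 : Submodule ℝ (LHS b)) : Prop :=
  (∃ K : Subgroup (Op H)ˣ, (K : Set (Op H)ˣ) = G ∧ K ≤ GLHS b) ∧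
  IsClosed (𝔤 : Set (LHS b)) ∧
  ∀ X ∈ inChart b G, ∃ φ : OpenPartialHomeomorph (LHS b) (LHS b), X ∈ φ.source ∧
    ContDiffOn ℝ ∞ φ φ.source ∧ ContDiffOn ℝ ∞ φ.symm φ.target ∧
    ∀ Y ∈ φ.source, Y ∈ inChart b G ↔ φ Y ∈ 𝔤

/-- The Lie algebra (tangent space at the identity): the velocities at `0` of the smooth curves
in `G` through the identity. -/
def lieAlg (G : Set (Op H)ˣ) : Set (LHS b) :=
  {X | ∃ c : ℝ → LHS b, ContDiff ℝ ∞ c ∧ (∀ r, c r ∈ inChart b G) ∧ c 0 = 0 ∧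
    HasDerivAt c X 0}

/-- The number `d` is the determinant of the operator `Q` of `H`: the limit of the determinants
of its truncations to the spans of the first `n` basis vectors. -/
def HasDet (Q : H →L[ℝ] H) (d : ℝ) : Prop :=
  Tendsto (fun n : ℕ => (Matrix.of fun i j : Fin n => (inner ℝ (b i) (Q (b j)) : ℝ)).det)
    atTop (𝓝 d)

/-! ### The exponential map -/

variable [CompleteSpace H]

theorem exp_sub_one_mem {A : Op H} (hA : A ∈ hsSubmodule b) :
    NormedSpace.exp A - 1 ∈ hsSubmodule b := by
  have h1 : Summable fun n : ℕ => ((n.factorial : ℝ)⁻¹) • A ^ n :=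
    NormedSpace.expSeries_summable' (𝕂 := ℝ) A
  have h2 : Summable fun n : ℕ => (((n + 1).factorial : ℝ)⁻¹) • A ^ n := by
    refine Summable.of_norm_bounded (NormedSpace.norm_expSeries_summable' (𝕂 := ℝ) A)
      fun n => ?_
    rw [norm_smul, norm_smul]
    gcongr
    rw [norm_inv, norm_inv]
    simp only [Real.norm_natCast]
    gcongr
    omega
  have h3 : NormedSpace.exp A - 1
      = (∑' n : ℕ, (((n + 1).factorial : ℝ)⁻¹) • A ^ n) * A := by
    simp only [NormedSpace.exp_eq_tsum ℝ]
    rw [h1.tsum_eq_zero_add, ← h2.tsum_mul_right]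
    simp [pow_succ]
  rw [h3]
  exact mul_mem_hs b _ hA

/-- The exponential of a bounded operator, as an invertible operator. -/
def expU (A : Op H) : (Op H)ˣ where
  val := NormedSpace.exp A
  inv := NormedSpace.exp (-A)
  val_inv := by
    let _ : NormedAlgebra ℚ (Op H) := NormedAlgebra.restrictScalars ℚ ℝ (Op H)
    rw [← NormedSpace.exp_add_of_commute (Commute.neg_right (Commute.refl A))]; simp
  inv_val := by
    let _ : NormedAlgebra ℚ (Op H) := NormedAlgebra.restrictScalars ℚ ℝ (Op H)
    rw [← NormedSpace.exp_add_of_commute (Commute.neg_left (Commute.refl A))]; simp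

/-- The exponential map, from the Hilbert-Schmidt operators to the general Hilbert-Schmidt
group. -/
def Exp (X : LHS b) : GLHS b := ⟨expU X.op, exp_sub_one_mem b X.2⟩

/-- The map `f : 𝔤 → G ⊆ GL_HS` is a local diffeomorphism around `0`: it maps an open
neighbourhood `U` of `0` in `𝔤` diffeomorphically onto a (relatively open) neighbourhood of
`f 0` in `G`. The inverse is smooth on the submanifold `G`, that is, it is the restriction of a
map that is smooth on an open set `W`. -/
def IsLocalDiffeoAtZero (𝔤 : Submodule ℝ (LHS b)) (G : Set (Op H)ˣ) (f : 𝔤 → GLHS b) : Prop :=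
  ∃ (U : Set 𝔤) (W : Set (LHS b)) (g : LHS b → 𝔤), IsOpen U ∧ IsOpen W ∧ 0 ∈ U ∧
    ContDiffOn ℝ ∞ (fun X => chart b (f X)) U ∧ ContDiffOn ℝ ∞ g W ∧
    (fun X => chart b (f X)) '' U = inChart b G ∩ W ∧
    ∀ X ∈ U, g (chart b (f X)) = X

end HSLorentz

end

/-!
The theorem rests on two identifications. First, `g_∞` is the space `skewHS` of all
Hilbert-Schmidt operators `X` that are skew for the Lorentz form, that is `X^† = -X` for the
Lorentz adjoint `X^†` (`gInf_eq`): a skew operator orthogonal to all the generators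
`e_{0i} + e_{i0}` and `e_{ij} - e_{ji}` has all its matrix entries equal to zero. Second, the
Cameron-Martin group is the set `expGroup` of the exponentials of these operators
(`mem_cmGroup_iff`), and this set consists of the elements of `SO(H,1) ∩ GL_HS` with positive
determinant (`mem_expGroup_iff`).

*Surjectivity of the exponential* (`exists_Exp_or_reflU`). Let `U = 1 + K` be in
`SO(H,1) ∩ GL_HS`. Since `K` is compact, `1 + tK` with `0 < t ≤ 1` fails to be invertible only if
`U` has the eigenvalue `1 - t⁻¹ ≤ 0`; causality forces a negative eigenvalue to be `-1`, with
spacelike eigenvectors (`spacelike_of_neg_eigenvector`). If `-1` is not an eigenvalue, then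
`∫₀¹ (1 + tK)⁻¹ K dt` is a logarithm of `U` (`exp_logFactor`); it is Hilbert-Schmidt, and it is
Lorentz skew because the Lorentz adjoint exchanges the resolvents at `t` and at `1 - t`
(`exists_log`). Otherwise the finite dimensional eigenspace for `-1` is split off one vector at a
time, and each pair of the resulting reflections is a rotation of angle `π`. So `U` is either an
exponential or a reflection times an exponential.

*The sign of the determinant* separates these two cases. For invertible `1 + K` the truncated
determinants are nonzero from some index on, locally uniformly in `K`, so that their sign
`PosDet` is locally constant for the Hilbert-Schmidt norm (`posDet_of_isPreconnected`); it is
negative for reflections. Consequently every family of Lorentz operators that is connected for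
the Hilbert-Schmidt norm and contains the identity consists of exponentials
(`exists_Exp_of_isPreconnected`). This applies to the paths in the definition of the distance,
which are continuous for the Hilbert-Schmidt norm and along which `γ γ^†` is constant
(`IsCMPath.exists_curve`), to the groups `SO_0(n,1)`, and to the components of
`SO(H,1) ∩ GL_HS`.

*The Lie group structure* comes from the inverse function theorem for the exponential map, which
is smooth for the Hilbert-Schmidt norm as a restriction of the exponential of the unitization of
the Banach algebra of Hilbert-Schmidt operators. If `exp X` is a Lorentz operator with `X` small,
then `-X` and `X^†` are both small logarithms of its inverse, so that `X` is skew
(`exists_local_log`); left translations carry this chart to all the points of the group. The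
distance from `A` to `A exp X` is at most `‖X‖`, and conversely a path of length `ℓ` moves its end
by at most `2 ‖A‖ ℓ` (`norm_chart_sub_le`), so that both topologies agree.

*The decomposition* `A = P T` takes for `T` the boost that maps `A⁻¹ e_0` to `e_0`. The rotation
`P` is again an exponential, so its truncated determinants are eventually positive. Their squares
tend to `1`: the truncations are contractions whose rows have squared lengths summing to their
size up to the tail of `P - 1` (`det_sq_bounds`, `truncDet_sq_bounds`).
-/

set_option linter.unusedSectionVars false

noncomputable section

namespace HSLorentz

variable {H : Type*} [NormedAddCommGroup H] [InnerProductSpace ℝ H] [CompleteSpace H]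
variable {b : HilbertBasis ℕ ℝ H}

/-! ### Hilbert-Schmidt operators: norms, completeness and products -/

theorem exists_op_eq {A : Op H} (hA : A ∈ hsSubmodule b) : ∃ X : LHS b, X.op = A := ⟨⟨A, hA⟩, rfl⟩

variable (b) in
/-- The family `e b` as a Hilbert basis of `ℝ ⊕ H`. -/
def eBasis : HilbertBasis ℕ ℝ (Sp H) :=
  HilbertBasis.mkOfOrthogonalEqBot (orthonormal_e b) (by
    rw [Submodule.eq_bot_iff]
    intro w hw
    have h : (innerSL ℝ w).smulRight w = (0 : Op H) := by
      refine eq_zero_of_e b fun i => ?_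
      have := (Submodule.mem_orthogonal' _ _).1 hw (e b i) (Submodule.subset_span ⟨i, rfl⟩)
      simp [this]
    have h2 : ((innerSL ℝ w).smulRight w : Op H) w = 0 := by rw [h]; rfl
    simpa using h2)

@[simp] theorem coe_eBasis : ⇑(eBasis b) = e b := by
  simp [eBasis]

theorem hasSum_inner_sq (w : Sp H) : HasSum (fun i => (inner ℝ (e b i) w : ℝ) ^ 2) (‖w‖ ^ 2) := by
  have h := (eBasis b).hasSum_inner_mul_inner w w
  rw [real_inner_self_eq_norm_sq] at h
  simpa [real_inner_comm, sq] using h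

theorem sum_inner_sq_le (s : Finset ℕ) (w : Sp H) :
    ∑ i ∈ s, (inner ℝ (e b i) w : ℝ) ^ 2 ≤ ‖w‖ ^ 2 :=
  sum_le_hasSum s (fun _ _ => sq_nonneg _) (hasSum_inner_sq w)

theorem eq_zero_of_inner_e {w : Sp H} (h : ∀ i, (inner ℝ (e b i) w : ℝ) = 0) : w = 0 := by
  have := (hasSum_inner_sq (b := b) w).tsum_eq
  simpa [h] using this.symm

theorem ext_e {A B : Op H} (h : ∀ i, A (e b i) = B (e b i)) : A = B :=
  sub_eq_zero.1 (eq_zero_of_e b fun i => by simp [h i])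

namespace LHS

@[ext] theorem ext' {A B : LHS b} (h : A.op = B.op) : A = B := op_injective h

theorem op_sub (A B : LHS b) : (A - B).op = A.op - B.op := rfl
theorem op_neg (A : LHS b) : (-A).op = -A.op := rfl
theorem op_zero : (0 : LHS b).op = 0 := rfl

theorem sum_sq_le (s : Finset ℕ) (A : LHS b) : ∑ i ∈ s, ‖A.op (e b i)‖ ^ 2 ≤ ‖A‖ ^ 2 := by
  rw [norm_sq_eq]
  exact A.summable_sq.sum_le_tsum s (fun _ _ => sq_nonneg _)

/-- An operator whose partial Hilbert-Schmidt sums are bounded is Hilbert-Schmidt. -/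
theorem exists_of_sum_le {A : Op H} {C : ℝ} (hC : 0 ≤ C)
    (h : ∀ s : Finset ℕ, ∑ i ∈ s, ‖A (e b i)‖ ^ 2 ≤ C ^ 2) : ∃ X : LHS b, X.op = A ∧ ‖X‖ ≤ C := by
  have hs : Summable fun i => ‖A (e b i)‖ ^ 2 :=
    summable_of_sum_le (fun _ => sq_nonneg _) h
  obtain ⟨X, rfl⟩ := exists_op_eq hs
  refine ⟨X, rfl, (abs_le_of_sq_le_sq' ?_ hC).2⟩
  rw [norm_sq_eq]
  exact hs.tsum_le_of_sum_le h

theorem norm_le_of_sum_le {A : LHS b} {C : ℝ} (hC : 0 ≤ C)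
    (h : ∀ s : Finset ℕ, ∑ i ∈ s, ‖A.op (e b i)‖ ^ 2 ≤ C ^ 2) : ‖A‖ ≤ C := by
  obtain ⟨X, hX, hXC⟩ := exists_of_sum_le hC h
  rwa [op_injective hX] at hXC

theorem norm_op_apply_le (A : LHS b) (w : Sp H) : ‖A.op w‖ ≤ ‖A‖ * ‖w‖ := by
  have h1 : HasSum (fun i => (inner ℝ (e b i) w : ℝ) • A.op (e b i)) (A.op w) := by
    have := ((eBasis b).hasSum_repr w).mapL A.op
    simpa [HilbertBasis.repr_apply_apply] using this
  refine le_of_tendsto h1.norm (Eventually.of_forall fun s => ?_)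
  have h2 : ‖∑ i ∈ s, (inner ℝ (e b i) w : ℝ) • A.op (e b i)‖
      ≤ ∑ i ∈ s, |(inner ℝ (e b i) w : ℝ)| * ‖A.op (e b i)‖ := by
    refine (norm_sum_le _ _).trans (Finset.sum_le_sum fun i _ => ?_)
    rw [norm_smul, Real.norm_eq_abs]
  refine h2.trans (abs_le_of_sq_le_sq' ?_ (by positivity)).2
  have h3 := Finset.sum_mul_sq_le_sq_mul_sq s (fun i => |(inner ℝ (e b i) w : ℝ)|)
    (fun i => ‖A.op (e b i)‖)
  refine h3.trans ?_
  simp only [sq_abs]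
  rw [mul_pow, mul_comm]
  exact mul_le_mul (sum_sq_le s A) (sum_inner_sq_le s w) (by positivity) (by positivity)

theorem norm_op_le (A : LHS b) : ‖A.op‖ ≤ ‖A‖ :=
  A.op.opNorm_le_bound (norm_nonneg _) A.norm_op_apply_le

variable (b) in
/-- The inclusion of the Hilbert-Schmidt operators into the bounded operators. -/
def opL : LHS b →L[ℝ] Op H :=
  LinearMap.mkContinuous { toFun := op, map_add' := op_add, map_smul' := op_smul } 1
    fun A => by simpa using A.norm_op_le

@[simp] theorem opL_apply (A : LHS b) : opL b A = A.op := rfl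

instance : CompleteSpace (LHS b) := by
  refine Metric.complete_of_cauchySeq_tendsto fun u hu => ?_
  have h1 : CauchySeq fun n => (u n).op := hu.map (opL b).uniformContinuous
  obtain ⟨A, hA⟩ := cauchySeq_tendsto_of_complete h1
  have key : ∀ ε > 0, ∃ N, ∀ n ≥ N, ∃ X : LHS b, X.op = (u n).op - A ∧ ‖X‖ ≤ ε := by
    intro ε hε
    obtain ⟨N, hN⟩ := Metric.cauchySeq_iff.1 hu ε hε
    refine ⟨N, fun n hn => exists_of_sum_le hε.le fun s => ?_⟩
    have h2 : Tendsto (fun m => ∑ i ∈ s, ‖((u n).op - (u m).op) (e b i)‖ ^ 2) atTop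
        (𝓝 (∑ i ∈ s, ‖((u n).op - A) (e b i)‖ ^ 2)) := by
      refine tendsto_finsetSum _ fun i _ => ?_
      have : Continuous fun B : Op H => ‖((u n).op - B) (e b i)‖ ^ 2 := by fun_prop
      exact (this.tendsto A).comp hA
    refine le_of_tendsto h2 (eventually_atTop.2 ⟨N, fun m hm => ?_⟩)
    have h3 := sum_sq_le s (u n - u m)
    refine h3.trans ?_
    have := hN n hn m hm
    rw [dist_eq_norm] at this
    gcongr
  obtain ⟨N, hN⟩ := key 1 one_pos
  obtain ⟨X, hX, -⟩ := hN N le_rfl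
  refine ⟨u N - X, Metric.tendsto_atTop.2 fun ε hε => ?_⟩
  obtain ⟨M, hM⟩ := key (ε / 2) (half_pos hε)
  refine ⟨M, fun n hn => ?_⟩
  obtain ⟨Y, hY, hYε⟩ := hM n hn
  have : u n - (u N - X) = Y := by
    ext1
    rw [op_sub, op_sub, hX, hY]; abel
  rw [dist_eq_norm, this]
  linarith

/-- The product `B A` of a bounded operator `B` and a Hilbert-Schmidt operator `A`. -/
def mulLeft (B : Op H) (A : LHS b) : LHS b := ⟨B * A.op, mul_mem_hs b B A.2⟩

@[simp] theorem op_mulLeft (B : Op H) (A : LHS b) : (mulLeft B A).op = B * A.op := rfl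

theorem norm_mulLeft_le (B : Op H) (A : LHS b) : ‖mulLeft B A‖ ≤ ‖B‖ * ‖A‖ := by
  refine norm_le_of_sum_le (by positivity) fun s => ?_
  rw [mul_pow]
  refine le_trans ?_ (mul_le_mul_of_nonneg_left (sum_sq_le s A) (sq_nonneg _))
  rw [Finset.mul_sum]
  refine Finset.sum_le_sum fun i _ => ?_
  rw [← mul_pow]
  gcongr
  exact B.le_opNorm _

variable (b) in
/-- The product `B A` as a bounded bilinear map. -/
def lmul : Op H →L[ℝ] LHS b →L[ℝ] LHS b :=
  LinearMap.mkContinuous₂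
    (LinearMap.mk₂ ℝ mulLeft
      (fun _ _ _ => op_injective (add_mul _ _ _)) (fun _ _ _ => op_injective (smul_mul_assoc _ _ _))
      (fun _ _ _ => op_injective (mul_add _ _ _)) (fun _ _ _ => op_injective (mul_smul_comm _ _ _)))
    1 fun B A => by
      rw [one_mul]
      exact norm_mulLeft_le B A

/-- With the operator product, the Hilbert-Schmidt operators form a normed ring. This structure is
only a local instance, so that `LHS b` keeps a single path to its norm. -/
@[reducible] def normedRing : NonUnitalNormedRing (LHS b) :=
  { (inferInstance : NormedAddCommGroup (LHS b)) with
    mul := fun A B => mulLeft A.op B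
    left_distrib := fun _ _ _ => op_injective (mul_add _ _ _)
    right_distrib := fun _ _ _ => op_injective (add_mul _ _ _)
    zero_mul := fun _ => op_injective (zero_mul _)
    mul_zero := fun _ => op_injective (mul_zero _)
    mul_assoc := fun _ _ _ => op_injective (mul_assoc _ _ _)
    norm_mul_le := fun A B => (norm_mulLeft_le A.op B).trans
      (mul_le_mul_of_nonneg_right A.norm_op_le (norm_nonneg _)) }

attribute [local instance] normedRing

theorem op_mul (A B : LHS b) : (A * B).op = A.op * B.op := rfl

theorem isScalarTower : IsScalarTower ℝ (LHS b) (LHS b) :=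
  ⟨fun _ _ _ => op_injective (smul_mul_assoc _ _ _)⟩

theorem smulCommClass : SMulCommClass ℝ (LHS b) (LHS b) :=
  ⟨fun _ _ _ => op_injective (mul_smul_comm _ _ _).symm⟩

theorem norm_bracket_le (A B : LHS b) : ‖⁅A, B⁆‖ ≤ 2 * ‖A‖ * ‖B‖ := by
  have : ⁅A, B⁆ = A * B - B * A := rfl
  rw [this]
  refine (norm_sub_le _ _).trans ?_
  have h1 := norm_mul_le A B
  have h2 := norm_mul_le B A
  nlinarith

end LHS

theorem rankOne_mem (u v : Sp H) : ((innerSL ℝ u).smulRight v : Op H) ∈ hsSubmodule b := by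
  refine ((hasSum_inner_sq (b := b) u).summable.mul_right (‖v‖ ^ 2)).congr fun i => ?_
  simp [norm_smul, mul_pow, real_inner_comm]

variable (b) in
/-- The rank one operator `x ↦ ⟨u, x⟩ v`. -/
def rankOneHS (u v : Sp H) : LHS b := ⟨(innerSL ℝ u).smulRight v, rankOne_mem u v⟩

theorem op_rankOneHS (u v x : Sp H) : (rankOneHS b u v).op x = (inner ℝ u x : ℝ) • v := rfl

/-! ### The Lorentz form and the Lorentz adjoint -/

@[simp] theorem fst_vec (s : ℝ) (x : H) : (vec s x).fst = s := rfl
@[simp] theorem snd_vec (s : ℝ) (x : H) : (vec s x).snd = x := rfl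
@[simp] theorem Sp.fst_add (u v : Sp H) : (u + v).fst = u.fst + v.fst := rfl
@[simp] theorem Sp.snd_add (u v : Sp H) : (u + v).snd = u.snd + v.snd := rfl
@[simp] theorem Sp.fst_sub (u v : Sp H) : (u - v).fst = u.fst - v.fst := rfl
@[simp] theorem Sp.snd_sub (u v : Sp H) : (u - v).snd = u.snd - v.snd := rfl
@[simp] theorem Sp.fst_neg (u : Sp H) : (-u).fst = -u.fst := rfl
@[simp] theorem Sp.snd_neg (u : Sp H) : (-u).snd = -u.snd := rfl
@[simp] theorem Sp.fst_zero : (0 : Sp H).fst = 0 := rfl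
@[simp] theorem Sp.snd_zero : (0 : Sp H).snd = 0 := rfl
@[simp] theorem Sp.fst_smul (c : ℝ) (u : Sp H) : (c • u).fst = c * u.fst := rfl
@[simp] theorem Sp.snd_smul (c : ℝ) (u : Sp H) : (c • u).snd = c • u.snd := rfl

theorem Sp.ext {u v : Sp H} (h1 : u.fst = v.fst) (h2 : u.snd = v.snd) : u = v := by
  rw [← vec_fst_snd u, ← vec_fst_snd v, h1, h2]

theorem inner_eq (u v : Sp H) : (inner ℝ u v : ℝ) = u.fst * v.fst + inner ℝ u.snd v.snd := by
  rw [← inner_vec, vec_fst_snd, vec_fst_snd]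

@[fun_prop] theorem continuous_fst : Continuous (Sp.fst : Sp H → ℝ) :=
  _root_.continuous_fst.comp (toProd H).continuous

@[simp] theorem fst_blockOp (c : ℝ) (v u : H) (B : H →L[ℝ] H) (w : Sp H) :
    (blockOp c v u B w).fst = c * w.fst + inner ℝ v w.snd := rfl
@[simp] theorem snd_blockOp (c : ℝ) (v u : H) (B : H →L[ℝ] H) (w : Sp H) :
    (blockOp c v u B w).snd = w.fst • u + B w.snd := rfl

theorem lorentz_comm (u v : Sp H) : lorentz u v = lorentz v u := by
  simp [lorentz, real_inner_comm, mul_comm]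

theorem lorentz_add_left (u v w : Sp H) : lorentz (u + v) w = lorentz u w + lorentz v w := by
  simp [lorentz, inner_add_left]; ring
theorem lorentz_sub_left (u v w : Sp H) : lorentz (u - v) w = lorentz u w - lorentz v w := by
  simp [lorentz, inner_sub_left]; ring
theorem lorentz_sub_right (u v w : Sp H) : lorentz u (v - w) = lorentz u v - lorentz u w := by
  simp [lorentz, inner_sub_right]; ring
theorem lorentz_neg_left (u v : Sp H) : lorentz (-u) v = -lorentz u v := by
  simp [lorentz]; ring
theorem lorentz_neg_right (u v : Sp H) : lorentz u (-v) = -lorentz u v := by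
  simp [lorentz]; ring
theorem lorentz_smul_left (c : ℝ) (u v : Sp H) : lorentz (c • u) v = c * lorentz u v := by
  simp [lorentz, inner_smul_left]; ring
theorem lorentz_smul_right (c : ℝ) (u v : Sp H) : lorentz u (c • v) = c * lorentz u v := by
  simp [lorentz, inner_smul_right]; ring
theorem lorentz_zero_left (v : Sp H) : lorentz 0 v = 0 := by simp [lorentz]

variable (H) in
/-- The operator `J = diag(-1, 1)`, for which the Lorentz product is `⟪u, J v⟫`. -/
def opJ : Op H := blockOp (-1) 0 0 1

theorem opJ_vec (s : ℝ) (x : H) : opJ H (vec s x) = vec (-s) x := by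
  simp [opJ, blockOp_vec]

theorem inner_opJ (u v : Sp H) : (inner ℝ u (opJ H v) : ℝ) = lorentz u v := by
  simp [inner_eq, lorentz, opJ]; ring

@[simp] theorem opJ_opJ (u : Sp H) : opJ H (opJ H u) = u :=
  Sp.ext (by simp [opJ]) (by simp [opJ])

theorem opJ_mul_opJ : opJ H * opJ H = 1 := by
  ext1 u; simp

theorem lorentz_opJ_right (u v : Sp H) : lorentz u (opJ H v) = inner ℝ u v := by
  rw [← inner_opJ, opJ_opJ]

/-- The Lorentz form is nondegenerate. -/
theorem eq_of_lorentz {u v : Sp H} (h : ∀ w, lorentz u w = lorentz v w) : u = v := by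
  refine ext_inner_right ℝ fun w => ?_
  rw [← lorentz_opJ_right, ← lorentz_opJ_right, h]

/-- The adjoint of an operator for the Lorentz form. -/
def dag (A : Op H) : Op H := opJ H * ContinuousLinearMap.adjoint A * opJ H

theorem lorentz_dag_right (A : Op H) (u v : Sp H) : lorentz u (dag A v) = lorentz (A u) v := by
  rw [← inner_opJ, ← inner_opJ]
  simp [dag, ContinuousLinearMap.adjoint_inner_right]

theorem lorentz_dag_left (A : Op H) (u v : Sp H) : lorentz (dag A u) v = lorentz u (A v) := by
  rw [lorentz_comm, lorentz_dag_right, lorentz_comm]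

theorem eq_dag_iff (A B : Op H) : A = dag B ↔ ∀ u v, lorentz (A u) v = lorentz u (B v) := by
  constructor
  · rintro rfl u v
    exact lorentz_dag_left _ _ _
  · intro h
    ext1 u
    exact eq_of_lorentz fun v => by rw [h, lorentz_dag_left]

theorem dag_mul (A B : Op H) : dag (A * B) = dag B * dag A :=
  ((eq_dag_iff _ _).2 fun u v => by simp [lorentz_dag_left]).symm

@[simp] theorem dag_one : dag (1 : Op H) = 1 := ((eq_dag_iff _ _).2 fun u v => by simp).symm

theorem dag_add (A B : Op H) : dag (A + B) = dag A + dag B := by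
  simp [dag, mul_add, add_mul]

theorem dag_smul (c : ℝ) (A : Op H) : dag (c • A) = c • dag A := by
  simp [dag]

theorem dag_neg (A : Op H) : dag (-A) = -dag A := by simp [dag]

theorem dag_sub (A B : Op H) : dag (A - B) = dag A - dag B := by
  rw [sub_eq_add_neg, dag_add, dag_neg, sub_eq_add_neg]

variable (H) in
/-- The Lorentz adjoint as a bounded linear map. -/
def dagL : Op H →L[ℝ] Op H :=
  LinearMap.mkContinuous { toFun := dag, map_add' := dag_add, map_smul' := dag_smul }
    (‖opJ H‖ * ‖opJ H‖) fun A => by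
      refine (norm_mul_le _ _).trans ?_
      refine (mul_le_mul_of_nonneg_right (norm_mul_le _ _) (norm_nonneg _)).trans (le_of_eq ?_)
      rw [LinearIsometryEquiv.norm_map]
      ring

@[simp] theorem dagL_apply (A : Op H) : dagL H A = dag A := rfl

@[fun_prop] theorem continuous_dag : Continuous (dag : Op H → Op H) := (dagL H).continuous

variable (H) in
/-- `J` as an invertible operator. -/
def unitJ : (Op H)ˣ := ⟨opJ H, opJ H, opJ_mul_opJ, opJ_mul_opJ⟩

theorem dag_exp (A : Op H) : dag (NormedSpace.exp A) = NormedSpace.exp (dag A) := by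
  let _ : NormedAlgebra ℚ (Op H) := NormedAlgebra.restrictScalars ℚ ℝ (Op H)
  have h1 := NormedSpace.star_exp A
  have h2 := NormedSpace.exp_units_conj (unitJ H) (star A)
  have h3 : dag A = (unitJ H : Op H) * star A * ((unitJ H)⁻¹ : (Op H)ˣ) := rfl
  rw [h3, h2, ← h1]
  rfl

theorem mem_lorentzO_iff (A : (Op H)ˣ) : A ∈ lorentzO H ↔ dag (A : Op H) * (A : Op H) = 1 := by
  constructor
  · intro h
    ext1 u
    refine eq_of_lorentz fun v => ?_
    simpa [lorentz_dag_left] using h u v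
  · intro h u v
    rw [← lorentz_dag_left]
    change lorentz ((dag (A : Op H) * (A : Op H)) u) v = _
    rw [h]
    rfl

theorem dag_eq_inv {A : (Op H)ˣ} (h : A ∈ lorentzO H) :
    dag (A : Op H) = ((A⁻¹ : (Op H)ˣ) : Op H) := by
  rw [mem_lorentzO_iff] at h
  exact (Units.inv_eq_of_mul_eq_one_left h).symm

theorem apply_inv (A : (Op H)ˣ) (w : Sp H) :
    (A : Op H) (((A⁻¹ : (Op H)ˣ) : Op H) w) = w := DFunLike.congr_fun A.mul_inv w

theorem inv_apply (A : (Op H)ˣ) (w : Sp H) :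
    ((A⁻¹ : (Op H)ˣ) : Op H) ((A : Op H) w) = w := DFunLike.congr_fun A.inv_mul w

variable (H) in
/-- `O(H,1)` as a subgroup. -/
def lorentzOGroup : Subgroup (Op H)ˣ where
  carrier := lorentzO H
  one_mem' := fun _ _ => rfl
  mul_mem' := fun {A B} hA hB u v => by
    change lorentz ((A : Op H) ((B : Op H) u)) ((A : Op H) ((B : Op H) v)) = _
    rw [hA, hB]
  inv_mem' := fun {A} hA u v => by
    rw [← hA, apply_inv, apply_inv]

theorem mul_mem_lorentzO {A B : (Op H)ˣ} (hA : A ∈ lorentzO H) (hB : B ∈ lorentzO H) :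
    A * B ∈ lorentzO H := (lorentzOGroup H).mul_mem hA hB

theorem inv_mem_lorentzO {A : (Op H)ˣ} (hA : A ∈ lorentzO H) : A⁻¹ ∈ lorentzO H :=
  (lorentzOGroup H).inv_mem hA

/-- The lower right block of an operator of `ℝ ⊕ H`. -/
def lowerRight (A : Op H) : H →L[ℝ] H :=
  ContinuousLinearMap.snd ℝ ℝ H ∘L (toProd H).toContinuousLinearMap ∘L A ∘L
    (toProd H).symm.toContinuousLinearMap ∘L ContinuousLinearMap.inr ℝ ℝ H

@[simp] theorem lowerRight_apply (A : Op H) (x : H) : lowerRight A x = (A (vec 0 x)).snd := rfl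

theorem vec_eq (s : ℝ) (x : H) : vec s x = s • vec (1 : ℝ) (0 : H) + vec 0 x :=
  Sp.ext (by simp) (by simp)

theorem eq_blockOp {A : Op H} {c : ℝ} {v u : H} (h0 : A (vec 1 0) = vec c u)
    (h1 : ∀ x, (A (vec 0 x)).fst = inner ℝ v x) : A = blockOp c v u (lowerRight A) := by
  ext1 w
  have : A w = w.fst • vec c u + A (vec 0 w.snd) := by
    conv_lhs => rw [← vec_fst_snd w, vec_eq]
    simp [h0]
  refine Sp.ext ?_ ?_
  · simp [this, h1, mul_comm]
  · simp [this]

/-! ### The Lie algebra `g_∞` -/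

theorem dag_eq_neg_iff (X : Op H) :
    dag X = -X ↔ ∀ u v, lorentz (X u) v + lorentz u (X v) = 0 := by
  rw [eq_comm, eq_dag_iff]
  refine forall₂_congr fun u v => ?_
  simp only [neg_apply, lorentz_neg_left]
  constructor <;> intro h <;> linarith

/-- The block form in the definition of `so(n,1)` means skewness for the Lorentz form. -/
theorem exists_blockOp_iff (X : Op H) :
    (∃ (u : H) (B : H →L[ℝ] H), ContinuousLinearMap.adjoint B = -B ∧ X = blockOp 0 u u B) ↔
      dag X = -X := by
  constructor
  · rintro ⟨u, B, hB, rfl⟩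
    have hB' : ∀ x y, (inner ℝ (B x) y : ℝ) = -inner ℝ x (B y) := fun x y => by
      rw [← ContinuousLinearMap.adjoint_inner_right, hB]; simp
    rw [dag_eq_neg_iff]
    intro w z
    simp only [lorentz, fst_blockOp, snd_blockOp, inner_add_left, inner_add_right,
      inner_smul_left, inner_smul_right, hB']
    simp only [real_inner_comm u]
    simp
    ring
  · intro h
    rw [dag_eq_neg_iff] at h
    have h0 : (X (vec 1 0)).fst = 0 := by
      have := h (vec 1 0) (vec 1 0)
      simp [lorentz] at this
      linarith
    refine ⟨(X (vec 1 0)).snd, lowerRight X, ?_, eq_blockOp ?_ fun x => ?_⟩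
    · symm
      rw [ContinuousLinearMap.eq_adjoint_iff]
      intro x y
      have := h (vec 0 x) (vec 0 y)
      simp [lorentz] at this
      simp
      linarith
    · rw [← h0, vec_fst_snd]
    · have := h (vec 0 x) (vec 1 0)
      simp [lorentz] at this
      rw [real_inner_comm]
      linarith

variable (b) in
/-- The Hilbert-Schmidt operators that are skew for the Lorentz form. -/
def skewHS : Submodule ℝ (LHS b) where
  carrier := {X | dag X.op = -X.op}
  zero_mem' := by simp [LHS.op_zero, dag]
  add_mem' := fun {X Y} hX hY => by
    simp only [mem_ofPred_eq] at hX hY ⊢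
    rw [LHS.op_add, dag_add, hX, hY, neg_add]
  smul_mem' := fun c X hX => by
    simp only [mem_ofPred_eq] at hX ⊢
    rw [LHS.op_smul, dag_smul, hX, smul_neg]

theorem mem_skewHS {X : LHS b} : X ∈ skewHS b ↔ dag X.op = -X.op := Iff.rfl

theorem mem_skewHS' {X : LHS b} :
    X ∈ skewHS b ↔ ∀ u v, lorentz (X.op u) v + lorentz u (X.op v) = 0 := dag_eq_neg_iff _

theorem isClosed_skewHS : IsClosed (skewHS b : Set (LHS b)) :=
  isClosed_eq (continuous_dag.comp (LHS.opL b).continuous) (LHS.opL b).continuous.neg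

/-- The signs of the Lorentz form in the basis `e b`. -/
def sgn (i : ℕ) : ℝ := if i = 0 then -1 else 1

theorem opJ_e (i : ℕ) : opJ H (e b i) = sgn i • e b i := by
  cases i with
  | zero => simp only [e, opJ_vec, sgn]; exact Sp.ext (by simp) (by simp)
  | succ i => simp only [e, opJ_vec, sgn]; exact Sp.ext (by simp) (by simp)

theorem lorentz_e_left (i : ℕ) (v : Sp H) : lorentz (e b i) v = sgn i * inner ℝ (e b i) v := by
  rw [lorentz_comm, ← inner_opJ, opJ_e, inner_smul_right, real_inner_comm]

theorem op_matUnit (i j : ℕ) (w : Sp H) :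
    (matUnit b i j).op w = (inner ℝ (e b j) w : ℝ) • e b i := rfl

theorem inner_e (i j : ℕ) : (inner ℝ (e b i) (e b j) : ℝ) = if i = j then 1 else 0 :=
  orthonormal_iff_ite.1 (orthonormal_e b) i j

theorem inner_matUnit (i j : ℕ) (A : LHS b) :
    (inner ℝ (matUnit b i j) A : ℝ) = inner ℝ (e b i) (A.op (e b j)) := by
  rw [LHS.inner_def, tsum_eq_single j]
  · rw [op_matUnit, inner_e, if_pos rfl, one_smul]
  · intro k hk
    simp [op_matUnit, inner_e, hk.symm]

theorem matUnit_add_mem_skewHS {i : ℕ} (hi : 0 < i) :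
    matUnit b 0 i + matUnit b i 0 ∈ skewHS b := by
  rw [mem_skewHS']
  intro u v
  rw [lorentz_comm u]
  simp only [LHS.op_add, add_apply, op_matUnit, lorentz_add_left, lorentz_smul_left,
    lorentz_e_left]
  simp only [sgn, hi.ne', if_true, if_false]
  ring

theorem matUnit_sub_mem_skewHS {i j : ℕ} (hi : 0 < i) (hij : i < j) :
    matUnit b i j - matUnit b j i ∈ skewHS b := by
  rw [mem_skewHS']
  intro u v
  rw [lorentz_comm u]
  simp only [LHS.op_sub, sub_apply, op_matUnit, lorentz_sub_left, lorentz_smul_left,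
    lorentz_e_left]
  simp only [sgn, hi.ne', (hi.trans hij).ne', if_false]
  ring

theorem hInf_le_skewHS : hInf b ≤ skewHS b := by
  refine Submodule.topologicalClosure_minimal _ (Submodule.span_le.2 ?_) isClosed_skewHS
  rintro _ ⟨i, hi, rfl⟩
  exact matUnit_add_mem_skewHS hi

theorem sInf_le_skewHS : sInf b ≤ skewHS b := by
  refine Submodule.topologicalClosure_minimal _ (Submodule.span_le.2 ?_) isClosed_skewHS
  rintro _ ⟨i, j, hi, hij, rfl⟩
  exact matUnit_sub_mem_skewHS hi hij

theorem isOrtho_hInf_sInf : hInf b ⟂ sInf b := by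
  rw [Submodule.isOrtho_iff_le]
  refine Submodule.topologicalClosure_minimal _ (Submodule.span_le.2 ?_)
    (Submodule.isClosed_orthogonal _)
  rintro _ ⟨i, hi, rfl⟩
  rw [sInf, Submodule.orthogonal_closure, SetLike.mem_coe, Submodule.mem_orthogonal']
  intro Y hY
  induction hY using Submodule.span_induction with
  | mem Y hY =>
    obtain ⟨k, l, hk, hkl, rfl⟩ := hY
    rw [inner_add_left, inner_matUnit, inner_matUnit]
    simp only [LHS.op_sub, sub_apply, op_matUnit, inner_sub_right, inner_smul_right, inner_e,
      hk.ne', (hk.trans hkl).ne', hk.ne, (hk.trans hkl).ne, if_false]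
    simp
  | zero => simp
  | add X Y _ _ hX hY => rw [inner_add_right, hX, hY, add_zero]
  | smul c X _ hX => rw [inner_smul_right, hX, mul_zero]

/-- `g_∞` consists of all the Hilbert-Schmidt operators that are skew for the Lorentz form. -/
theorem gInf_eq : gInf b = skewHS b := by
  refine le_antisymm (sup_le hInf_le_skewHS sInf_le_skewHS) fun A hA => ?_
  have : CompleteSpace (hInf b) := (Submodule.isClosed_topologicalClosure _).completeSpace_coe
  have : CompleteSpace (sInf b) := (Submodule.isClosed_topologicalClosure _).completeSpace_coe
  obtain ⟨X, hX, A', hA', rfl⟩ := (hInf b).exists_add_mem_mem_orthogonal A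
  obtain ⟨Y, hY, Z, hZ, rfl⟩ := (sInf b).exists_add_mem_mem_orthogonal A'
  -- the remainder `Z` is skew and orthogonal to all the generators, hence zero
  have hZs : Z ∈ skewHS b := by
    have h1 := (skewHS b).sub_mem hA (hInf_le_skewHS hX)
    have h2 := (skewHS b).sub_mem h1 (sInf_le_skewHS hY)
    simpa using h2
  have hZh : Z ∈ (hInf b)ᗮ := by
    have h1 := (hInf b)ᗮ.sub_mem hA' (isOrtho_hInf_sInf.symm hY)
    simpa using h1
  have c1 : ∀ i, 0 < i → (inner ℝ (e b 0) (Z.op (e b i)) : ℝ)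
      + inner ℝ (e b i) (Z.op (e b 0)) = 0 := fun i hi => by
    rw [← inner_matUnit, ← inner_matUnit, ← inner_add_left]
    exact (Submodule.mem_orthogonal _ _).1 hZh _
      (Submodule.le_topologicalClosure _ (Submodule.subset_span ⟨i, hi, rfl⟩))
  have c2 : ∀ i j, 0 < i → i < j → (inner ℝ (e b i) (Z.op (e b j)) : ℝ)
      - inner ℝ (e b j) (Z.op (e b i)) = 0 := fun i j hi hij => by
    rw [← inner_matUnit, ← inner_matUnit, ← inner_sub_left]
    exact (Submodule.mem_orthogonal _ _).1 hZ _
      (Submodule.le_topologicalClosure _ (Submodule.subset_span ⟨i, j, hi, hij, rfl⟩))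
  have c3 : ∀ i j, sgn j * (inner ℝ (e b j) (Z.op (e b i)) : ℝ)
      + sgn i * inner ℝ (e b i) (Z.op (e b j)) = 0 := fun i j => by
    have := mem_skewHS'.1 hZs (e b i) (e b j)
    rwa [lorentz_comm, lorentz_e_left, lorentz_e_left] at this
  have hZ0 : Z = 0 := by
    refine LHS.ext' (eq_zero_of_e b fun j => eq_zero_of_inner_e (b := b) fun i => ?_)
    have h3 := c3 i j
    rcases Nat.eq_zero_or_pos i with rfl | hi <;> rcases Nat.eq_zero_or_pos j with rfl | hj
    · simp [sgn] at h3; linarith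
    · have h1 := c1 j hj
      simp [sgn, hj.ne'] at h3; linarith
    · have h1 := c1 i hi
      simp [sgn, hi.ne'] at h3; linarith
    · simp [sgn, hi.ne', hj.ne'] at h3
      rcases lt_trichotomy i j with h | rfl | h
      · have := c2 i j hi h; linarith
      · linarith
      · have := c2 j i hj h; linarith
  rw [hZ0, add_zero]
  exact Submodule.add_mem_sup hX hY

theorem isClosed_gInf : IsClosed (gInf b : Set (LHS b)) := by
  rw [gInf_eq]; exact isClosed_skewHS

theorem mem_so_iff {n : ℕ} {A : LHS b} : A ∈ so b n ↔
    A ∈ skewHS b ∧ (∀ w ∈ (Hn b n)ᗮ, A.op w = 0) ∧ ∀ w, A.op w ∈ Hn b n := by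
  change (_ ∧ _ ∧ _) ↔ _
  rw [exists_blockOp_iff, mem_skewHS]
  tauto

theorem Hn_mono {m n : ℕ} (h : m ≤ n) : Hn b m ≤ Hn b n :=
  Submodule.span_mono (image_mono fun _ hi => le_trans hi h)

theorem e_mem_Hn {i n : ℕ} (h : i ≤ n) : e b i ∈ Hn b n :=
  Submodule.subset_span ⟨i, h, rfl⟩

variable (b) in
/-- `so(n,1)` as a linear subspace. -/
def soSub (n : ℕ) : Submodule ℝ (LHS b) where
  carrier := so b n
  zero_mem' := mem_so_iff.2 ⟨zero_mem _, fun _ _ => rfl, fun _ => zero_mem _⟩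
  add_mem' := fun {X Y} hX hY => by
    rw [mem_so_iff] at *
    refine ⟨add_mem hX.1 hY.1, fun w hw => ?_, fun w => ?_⟩
    · simp [LHS.op_add, hX.2.1 w hw, hY.2.1 w hw]
    · exact add_mem (hX.2.2 w) (hY.2.2 w)
  smul_mem' := fun c X hX => by
    rw [mem_so_iff] at *
    refine ⟨Submodule.smul_mem _ _ hX.1, fun w hw => ?_, fun w => ?_⟩
    · simp [LHS.op_smul, hX.2.1 w hw]
    · exact Submodule.smul_mem _ _ (hX.2.2 w)

theorem so_mono {m n : ℕ} (h : m ≤ n) : soSub b m ≤ soSub b n := by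
  intro X hX
  have hX := mem_so_iff.1 hX
  exact mem_so_iff.2 ⟨hX.1, fun w hw => hX.2.1 w (Submodule.orthogonal_le (Hn_mono h) hw),
    fun w => Hn_mono h (hX.2.2 w)⟩

theorem coe_iSup_soSub : ((⨆ n, soSub b n : Submodule ℝ (LHS b)) : Set (LHS b)) = ⋃ n, so b n :=
  Submodule.coe_iSup_of_directed _ (directed_of_isDirected_le fun _ _ => so_mono)

theorem closure_iUnion_so : closure (⋃ n : ℕ, so b n) = (gInf b : Set (LHS b)) := by
  rw [← coe_iSup_soSub, ← Submodule.topologicalClosure_coe]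
  congr 1
  have ortho : ∀ {i n : ℕ} {w : Sp H}, i ≤ n → w ∈ (Hn b n)ᗮ → (inner ℝ (e b i) w : ℝ) = 0 :=
    fun h hw => (Submodule.mem_orthogonal _ _).1 hw _ (e_mem_Hn h)
  refine le_antisymm ?_ (sup_le ?_ ?_)
  · refine Submodule.topologicalClosure_minimal _ (iSup_le fun n X hX => ?_) isClosed_gInf
    rw [gInf_eq]
    exact (mem_so_iff.1 hX).1
  · refine Submodule.topologicalClosure_mono (Submodule.span_le.2 ?_)
    rintro _ ⟨i, hi, rfl⟩
    refine Submodule.mem_iSup_of_mem i (mem_so_iff.2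
      ⟨matUnit_add_mem_skewHS hi, fun w hw => ?_, fun w => ?_⟩)
    · simp [LHS.op_add, op_matUnit, ortho le_rfl hw, ortho hi.le hw]
    · exact add_mem (Submodule.smul_mem _ _ (e_mem_Hn hi.le))
        (Submodule.smul_mem _ _ (e_mem_Hn le_rfl))
  · refine Submodule.topologicalClosure_mono (Submodule.span_le.2 ?_)
    rintro _ ⟨i, j, hi, hij, rfl⟩
    refine Submodule.mem_iSup_of_mem j (mem_so_iff.2
      ⟨matUnit_sub_mem_skewHS hi hij, fun w hw => ?_, fun w => ?_⟩)
    · simp [LHS.op_sub, op_matUnit, ortho le_rfl hw, ortho hij.le hw]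
    · exact sub_mem (Submodule.smul_mem _ _ (e_mem_Hn hij.le))
        (Submodule.smul_mem _ _ (e_mem_Hn le_rfl))

theorem bracket_mem_skewHS {A B : LHS b} (hA : A ∈ skewHS b) (hB : B ∈ skewHS b) :
    ⁅A, B⁆ ∈ skewHS b := by
  rw [mem_skewHS] at *
  rw [LHS.op_bracket, dag_sub, dag_mul, dag_mul, hA, hB]
  noncomm_ring

variable (b) in
theorem completionAssumption_gInf : CompletionAssumption b (⋃ n : ℕ, so b n) (gInf b) where
  subset := by rw [← closure_iUnion_so]; exact subset_closure
  complete := isClosed_gInf.isComplete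
  dense := by rw [← closure_iUnion_so]
  bracket_mem := by rw [gInf_eq]; exact fun A hA B hB => bracket_mem_skewHS hA hB
  bracket_le := ⟨2, two_pos, fun A _ B _ => LHS.norm_bracket_le A B⟩

/-! ### Exponential and logarithm in a Banach algebra -/

section BanachAlgebra

variable {𝔸 : Type*} [NormedRing 𝔸] [NormedAlgebra ℝ 𝔸] [CompleteSpace 𝔸]

theorem exp_add_of_commute' {x y : 𝔸} (h : Commute x y) :
    NormedSpace.exp (x + y) = NormedSpace.exp x * NormedSpace.exp y := by
  let _ : NormedAlgebra ℚ 𝔸 := NormedAlgebra.restrictScalars ℚ ℝ 𝔸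
  exact NormedSpace.exp_add_of_commute h

theorem exp_mul_exp_neg (x : 𝔸) : NormedSpace.exp x * NormedSpace.exp (-x) = 1 := by
  rw [← exp_add_of_commute' (Commute.neg_right (Commute.refl x))]; simp

theorem exp_neg_mul_exp (x : 𝔸) : NormedSpace.exp (-x) * NormedSpace.exp x = 1 := by
  rw [← exp_add_of_commute' (Commute.neg_left (Commute.refl x))]; simp

/-- The derivative of `exp ∘ L` for a curve `L` of commuting elements. -/
theorem hasDerivAt_exp_comp_of_commute {L : ℝ → 𝔸} {L' : 𝔸} {s : ℝ}
    (hc : ∀ t, Commute (L t) (L s)) (h : HasDerivAt L L' s) :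
    HasDerivAt (fun t => NormedSpace.exp (L t)) (NormedSpace.exp (L s) * L') s := by
  have h1 : (fun t => NormedSpace.exp (L t))
      = fun t => NormedSpace.exp (L s) * NormedSpace.exp (L t - L s) := by
    ext t
    rw [← exp_add_of_commute' ((hc t).symm.sub_right (Commute.refl _))]
    congr 1; abel
  rw [h1]
  have h2 : HasDerivAt (fun t => L t - L s) L' s := h.sub_const _
  have h3 : HasFDerivAt (NormedSpace.exp : 𝔸 → 𝔸) (1 : 𝔸 →L[ℝ] 𝔸) (L s - L s) := by
    rw [sub_self]; exact hasFDerivAt_exp_zero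
  exact (h3.comp_hasDerivAt s h2).const_mul _

theorem commute_intervalIntegral {f : ℝ → 𝔸} (hf : Continuous f) {Z : 𝔸} (h : ∀ t, Commute Z (f t))
    (a c : ℝ) : Commute Z (∫ t in a..c, f t) := by
  have h1 := (ContinuousLinearMap.mul ℝ 𝔸 Z).intervalIntegral_comp_comm
    (hf.intervalIntegrable (μ := MeasureTheory.volume) a c)
  have h2 := ((ContinuousLinearMap.mul ℝ 𝔸).flip Z).intervalIntegral_comp_comm
    (hf.intervalIntegrable (μ := MeasureTheory.volume) a c)
  simp only [ContinuousLinearMap.mul_apply', ContinuousLinearMap.flip_apply] at h1 h2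
  rw [commute_iff_eq, ← h1, ← h2]
  exact intervalIntegral.integral_congr fun t _ => h t

/-- The projection of the real line to `[0,1]`. -/
def clamp (t : ℝ) : ℝ := max 0 (min 1 t)

theorem clamp_mem (t : ℝ) : clamp t ∈ Icc (0 : ℝ) 1 := by
  simp [clamp]

theorem clamp_of_mem {t : ℝ} (ht : t ∈ Icc (0 : ℝ) 1) : clamp t = t := by
  simp [clamp, ht.1, ht.2]

theorem continuous_clamp : Continuous clamp := by unfold clamp; fun_prop

/-- The function `t ↦ (1 + tK)⁻¹` on `[0,1]`, extended by constants to the real line. -/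
def resolv (K : 𝔸) (t : ℝ) : 𝔸 := Ring.inverse (1 + clamp t • K)

variable {K : 𝔸}

theorem commute_resolv_left (h : ∀ t ∈ Icc (0 : ℝ) 1, IsUnit (1 + t • K)) {Z : 𝔸}
    (hZ : Commute Z K) (t : ℝ) : Commute Z (resolv K t) := by
  obtain ⟨u, hu⟩ := h _ (clamp_mem t)
  rw [resolv, ← hu, Ring.inverse_unit]
  refine Commute.units_inv_right ?_
  rw [hu]
  exact (Commute.one_right Z).add_right (hZ.smul_right _)

theorem continuous_resolv (h : ∀ t ∈ Icc (0 : ℝ) 1, IsUnit (1 + t • K)) :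
    Continuous (resolv K) := by
  rw [continuous_iff_continuousAt]
  intro t
  obtain ⟨u, hu⟩ := h _ (clamp_mem t)
  have h1 : ContinuousAt (Ring.inverse : 𝔸 → 𝔸) (1 + clamp t • K) := by
    rw [← hu]; exact NormedRing.inverse_continuousAt u
  have h2 : ContinuousAt (fun t => 1 + clamp t • K) t :=
    (continuous_const.add (continuous_clamp.smul continuous_const)).continuousAt
  exact ContinuousAt.comp h1 h2

/-- The integral of the resolvent; the logarithm of `1 + K` is its product with `K`. -/
def logFactor (K : 𝔸) (s : ℝ) : 𝔸 := ∫ t in (0 : ℝ)..s, resolv K t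

theorem commute_logFactor (h : ∀ t ∈ Icc (0 : ℝ) 1, IsUnit (1 + t • K)) {Z : 𝔸}
    (hZ : Commute Z K) (s : ℝ) : Commute Z (logFactor K s) :=
  commute_intervalIntegral (continuous_resolv h) (commute_resolv_left h hZ) 0 s

/-- If `1 + tK` is invertible for all `t ∈ [0,1]`, then `∫₀¹ (1 + tK)⁻¹ K dt` is a logarithm of
`1 + K`. -/
theorem exp_logFactor (h : ∀ t ∈ Icc (0 : ℝ) 1, IsUnit (1 + t • K)) :
    NormedSpace.exp (logFactor K 1 * K) = 1 + K := by
  have hK : ∀ s, Commute K (logFactor K s) := commute_logFactor h (Commute.refl K)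
  have hL : ∀ s, HasDerivAt (fun s => -(logFactor K s * K)) (-(resolv K s * K)) s := fun s =>
    (((continuous_resolv h).integral_hasStrictDerivAt 0 s).hasDerivAt.mul_const K).neg
  have hc : ∀ s t, Commute (-(logFactor K t * K)) (-(logFactor K s * K)) := fun s t => by
    refine Commute.neg_left (Commute.neg_right ?_)
    have h1 : Commute (logFactor K t) (logFactor K s) := commute_logFactor h (hK t).symm s
    exact (h1.mul_right (hK t).symm).mul_left ((hK s).mul_right (Commute.refl K))
  -- the derivative of `exp (-L s) (1 + s K)` vanishes, where `L` is the logarithm of `1 + s K`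
  have hF : ∀ s ∈ Icc (0 : ℝ) 1, HasDerivAt
      (fun s => NormedSpace.exp (-(logFactor K s * K)) * (1 + s • K)) 0 s := fun s hs => by
    have h1 := hasDerivAt_exp_comp_of_commute (hc s) (hL s)
    have h2 : HasDerivAt (fun s : ℝ => 1 + s • K) K s := by
      simpa using ((hasDerivAt_id s).smul_const K).const_add 1
    convert! h1.mul h2 using 1
    have h3 : resolv K s * (1 + s • K) = 1 := by
      rw [resolv, clamp_of_mem hs]
      exact Ring.inverse_mul_cancel _ (h s hs)
    have h4 : Commute K (1 + s • K) :=
      (Commute.one_right K).add_right ((Commute.refl K).smul_right s)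
    rw [mul_assoc, ← mul_add, neg_mul, mul_assoc, h4.eq, ← mul_assoc, h3]
    simp
  have h1 := constant_of_derivWithin_zero (a := 0) (b := 1)
    (fun s hs => (hF s hs).differentiableAt.differentiableWithinAt)
    (fun s hs => (hF s ⟨hs.1, hs.2.le⟩).hasDerivWithinAt.derivWithin
      (uniqueDiffOn_Icc zero_lt_one s ⟨hs.1, hs.2.le⟩)) 1 (right_mem_Icc.2 zero_le_one)
  simp only [one_smul] at h1
  have h2 : logFactor K 0 = 0 := intervalIntegral.integral_same
  simp only [h2, zero_mul, neg_zero, NormedSpace.exp_zero, zero_smul, add_zero, mul_one] at h1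
  calc NormedSpace.exp (logFactor K 1 * K)
      = NormedSpace.exp (logFactor K 1 * K)
        * (NormedSpace.exp (-(logFactor K 1 * K)) * (1 + K)) := by rw [h1, mul_one]
    _ = 1 + K := by rw [← mul_assoc, exp_mul_exp_neg, one_mul]

/-- A solution of the linear differential equation of `exp (tM)` is equal to it. -/
theorem eq_exp_of_hasDerivAt {E : ℝ → 𝔸} {M : 𝔸} (h0 : E 0 = 1)
    (h : ∀ t, HasDerivAt E (M * E t) t) (t : ℝ) : E t = NormedSpace.exp (t • M) := by
  have hF : ∀ t, HasDerivAt (fun t : ℝ => NormedSpace.exp (t • -M) * E t) 0 t := fun t => by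
    convert! (hasDerivAt_exp_smul_const (-M) t).mul (h t) using 1
    noncomm_ring
  have h1 := is_const_of_deriv_eq_zero (fun t => (hF t).differentiableAt)
    (fun t => (hF t).deriv) t 0
  simp only [h0, zero_smul, neg_zero, NormedSpace.exp_zero, mul_one, smul_neg] at h1
  calc E t = NormedSpace.exp (t • M) * (NormedSpace.exp (-(t • M)) * E t) := by
        rw [← mul_assoc, exp_mul_exp_neg, one_mul]
    _ = _ := by rw [h1, mul_one]

theorem exp_smul_of_cube_eq {M : 𝔸} (h : M * M * M = M) (t : ℝ) :
    NormedSpace.exp (t • M) = 1 + Real.sinh t • M + (Real.cosh t - 1) • (M * M) := by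
  symm
  refine eq_exp_of_hasDerivAt (E := fun t => 1 + Real.sinh t • M + (Real.cosh t - 1) • (M * M))
    (by simp) (fun t => ?_) t
  convert! ((((Real.hasDerivAt_sinh t).smul_const M).const_add 1).add
    (((Real.hasDerivAt_cosh t).sub_const 1).smul_const (M * M))) using 1
  rw [mul_add, mul_add, mul_smul_comm, mul_smul_comm, ← mul_assoc, h, sub_smul]
  simp
  abel

theorem exp_smul_of_cube_eq_neg {M : 𝔸} (h : M * M * M = -M) (t : ℝ) :
    NormedSpace.exp (t • M) = 1 + Real.sin t • M + (1 - Real.cos t) • (M * M) := by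
  symm
  refine eq_exp_of_hasDerivAt (E := fun t => 1 + Real.sin t • M + (1 - Real.cos t) • (M * M))
    (by simp) (fun t => ?_) t
  convert! ((((Real.hasDerivAt_sin t).smul_const M).const_add 1).add
    (((Real.hasDerivAt_cos t).const_sub 1).smul_const (M * M))) using 1
  rw [mul_add, mul_add, mul_smul_comm, mul_smul_comm, ← mul_assoc, h, sub_smul]
  simp
  abel

/-- The exponential is injective near `0`. -/
theorem exists_injOn_exp : ∃ V : Set 𝔸, IsOpen V ∧ 0 ∈ V ∧ InjOn NormedSpace.exp V := by
  have h : HasStrictFDerivAt (NormedSpace.exp : 𝔸 → 𝔸)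
      ((ContinuousLinearEquiv.refl ℝ 𝔸 : 𝔸 ≃L[ℝ] 𝔸) : 𝔸 →L[ℝ] 𝔸) 0 := hasStrictFDerivAt_exp_zero
  exact ⟨(h.toOpenPartialHomeomorph _).source, (h.toOpenPartialHomeomorph _).open_source,
    h.mem_toOpenPartialHomeomorph_source, (h.toOpenPartialHomeomorph _).injOn⟩

end BanachAlgebra

/-! ### The exponential map of the Hilbert-Schmidt group -/

section Unitization

attribute [local instance] LHS.normedRing LHS.isScalarTower LHS.smulCommClass

variable (b) in
/-- The unital Banach algebra `ℝ ⊕ L_HS`, in which exponentials of Hilbert-Schmidt operators are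
computed for the Hilbert-Schmidt norm. -/
abbrev UA : Type _ := WithLp 1 (Unitization ℝ (LHS b))

variable (b) in
/-- The inclusion of the Hilbert-Schmidt operators in their unitization. -/
def uaInr : LHS b →L[ℝ] UA b :=
  LinearMap.mkContinuous
    ((WithLp.linearEquiv 1 ℝ (Unitization ℝ (LHS b))).symm.toLinearMap.comp
      (Unitization.inrHom ℝ ℝ (LHS b))) 1
    fun X => by
      rw [one_mul]
      exact (WithLp.unitization_norm_inr X).le

variable (b) in
/-- The projection of the unitization to the Hilbert-Schmidt operators. -/
def uaSnd : UA b →L[ℝ] LHS b :=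
  LinearMap.mkContinuous
    ((Unitization.sndHom ℝ ℝ (LHS b)).comp
      (WithLp.linearEquiv 1 ℝ (Unitization ℝ (LHS b))).toLinearMap) 1
    fun X => by
      rw [one_mul, WithLp.unitization_norm_def]
      exact le_add_of_nonneg_left (norm_nonneg _)

variable (b) in
/-- The operator as a homomorphism of algebras without unit. -/
def opHom : LHS b →ₙₐ[ℝ] Op H where
  toFun := LHS.op
  map_smul' := LHS.op_smul
  map_zero' := rfl
  map_add' := LHS.op_add
  map_mul' := LHS.op_mul

variable (b) in
/-- The unitization as an algebra of bounded operators. -/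
def uaOp : UA b →ₐ[ℝ] Op H :=
  (Unitization.lift (opHom b)).comp (WithLp.unitizationAlgEquiv (𝕜 := ℝ) (A := LHS b) ℝ).toAlgHom

theorem uaOp_apply (x : UA b) : uaOp b x = (WithLp.ofLp x).fst • 1 + (uaSnd b x).op := by
  rw [← Algebra.algebraMap_eq_smul_one]
  rfl

theorem continuous_uaOp : Continuous (uaOp b) := by
  refine AddMonoidHomClass.continuous_of_bound (uaOp b) (‖(1 : Op H)‖ + 1) fun x => ?_
  rw [uaOp_apply, WithLp.unitization_norm_def]
  have h1 := norm_add_le ((WithLp.ofLp x).fst • (1 : Op H)) (uaSnd b x).op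
  have h2 := (uaSnd b x).norm_op_le
  have h3 : ‖uaSnd b x‖ = ‖(WithLp.ofLp x).snd‖ := rfl
  rw [norm_smul] at h1
  have := norm_nonneg (WithLp.ofLp x).fst
  have := norm_nonneg (WithLp.ofLp x).snd
  have := norm_nonneg (1 : Op H)
  nlinarith

variable (b) in
/-- The scalar part of an element of the unitization. -/
def uaFst : UA b →ₐ[ℝ] ℝ :=
  (Unitization.fstHom ℝ (LHS b)).comp
    (WithLp.unitizationAlgEquiv (𝕜 := ℝ) (A := LHS b) ℝ).toAlgHom

theorem continuous_uaFst : Continuous (uaFst b) := by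
  refine AddMonoidHomClass.continuous_of_bound (uaFst b) 1 fun x => ?_
  rw [one_mul, WithLp.unitization_norm_def]
  exact le_add_of_nonneg_right (norm_nonneg _)

theorem op_chart (U : GLHS b) : (chart b U).op = ((U : (Op H)ˣ) : Op H) - 1 := rfl

theorem coe_eq_one_add (U : GLHS b) : ((U : (Op H)ˣ) : Op H) = 1 + (chart b U).op := by
  rw [op_chart]; abel

theorem chart_injective : Function.Injective (chart b) := fun U V h => by
  refine Subtype.ext (Units.ext ?_)
  rw [coe_eq_one_add, coe_eq_one_add, h]

theorem coe_Exp (X : LHS b) : (((Exp b X : GLHS b) : (Op H)ˣ) : Op H) = NormedSpace.exp X.op := rfl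

theorem chart_Exp_eq (X : LHS b) :
    chart b (Exp b X) = uaSnd b (NormedSpace.exp (uaInr b X)) := by
  let _ : NormedAlgebra ℚ (UA b) := NormedAlgebra.restrictScalars ℚ ℝ (UA b)
  let _ : NormedAlgebra ℚ (Op H) := NormedAlgebra.restrictScalars ℚ ℝ (Op H)
  have h1 := NormedSpace.map_exp (uaOp b) continuous_uaOp (uaInr b X)
  have h2 := NormedSpace.map_exp (uaFst b) continuous_uaFst (uaInr b X)
  have h3 : uaOp b (uaInr b X) = X.op := by
    rw [uaOp_apply]
    change (0 : ℝ) • 1 + X.op = X.op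
    simp
  have h4 : uaFst b (uaInr b X) = 0 := rfl
  rw [h4, NormedSpace.exp_zero] at h2
  rw [h3, uaOp_apply] at h1
  change (WithLp.ofLp (NormedSpace.exp (uaInr b X))).fst = 1 at h2
  ext1
  rw [op_chart, coe_Exp, ← h1, h2, one_smul]
  abel

theorem contDiff_chart_Exp : ContDiff ℝ ∞ fun X : LHS b => chart b (Exp b X) := by
  simp only [chart_Exp_eq]
  have h : ContDiff ℝ ∞ (NormedSpace.exp : UA b → UA b) :=
    contDiff_iff_contDiffAt.2 fun x => (NormedSpace.exp_analytic (𝕂 := ℝ) x).contDiffAt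
  exact (uaSnd b).contDiff.comp (h.comp (uaInr b).contDiff)

theorem hasFDerivAt_chart_Exp_zero :
    HasFDerivAt (fun X : LHS b => chart b (Exp b X)) (ContinuousLinearMap.id ℝ (LHS b)) 0 := by
  simp only [chart_Exp_eq]
  have h : HasFDerivAt (NormedSpace.exp : UA b → UA b) (1 : UA b →L[ℝ] UA b) (uaInr b 0) := by
    rw [map_zero]; exact hasFDerivAt_exp_zero
  have h2 : HasFDerivAt (uaInr b) (uaInr b) (0 : LHS b) := (uaInr b).hasFDerivAt
  have h3 : HasFDerivAt (fun X => NormedSpace.exp (uaInr b X)) (uaInr b) (0 : LHS b) :=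
    HasFDerivAt.comp (𝕜 := ℝ) (E := LHS b) (F := UA b) (G := UA b) (0 : LHS b) h h2
  exact HasFDerivAt.comp (𝕜 := ℝ) (E := LHS b) (F := UA b) (G := LHS b) (0 : LHS b)
    (uaSnd b).hasFDerivAt h3

theorem continuous_chart_Exp : Continuous fun X : LHS b => chart b (Exp b X) :=
  contDiff_chart_Exp.continuous

end Unitization

theorem chart_one : chart b 1 = 0 := by
  ext1
  simp [op_chart, LHS.op_zero]

theorem Exp_zero : Exp b 0 = 1 := by
  refine Subtype.ext (Units.ext ?_)
  simp [coe_Exp, LHS.op_zero]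

theorem Exp_add_of_commute {X Y : LHS b} (h : Commute X.op Y.op) :
    Exp b (X + Y) = Exp b X * Exp b Y := by
  refine Subtype.ext (Units.ext ?_)
  simp [coe_Exp, LHS.op_add, exp_add_of_commute' h]

theorem Exp_neg (X : LHS b) : Exp b (-X) = (Exp b X)⁻¹ := by
  rw [eq_inv_iff_mul_eq_one, ← Exp_add_of_commute, neg_add_cancel, Exp_zero]
  exact Commute.neg_left (Commute.refl _)

theorem Exp_mem_lorentzO {X : LHS b} (hX : X ∈ skewHS b) : (Exp b X : (Op H)ˣ) ∈ lorentzO H := by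
  rw [mem_lorentzO_iff, coe_Exp, dag_exp, mem_skewHS.1 hX, exp_neg_mul_exp]

theorem chart_mul (U V : GLHS b) :
    chart b (U * V) = LHS.mulLeft ((U : (Op H)ˣ) : Op H) (chart b V) + chart b U := by
  ext1
  simp [op_chart, LHS.op_add, mul_sub]

theorem continuous_mulLeft (B : Op H) : Continuous (LHS.mulLeft B : LHS b → LHS b) :=
  (LHS.lmul b B).continuous

/-- The exponential map is a diffeomorphism between open sets around `0` and the identity, and
near the identity it maps only Lorentz skew operators to Lorentz operators. -/
theorem exists_local_log : ∃ φ : OpenPartialHomeomorph (LHS b) (LHS b), 0 ∈ φ.source ∧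
    (∀ X, φ X = chart b (Exp b X)) ∧ ContDiffOn ℝ ∞ φ.symm φ.target ∧
    ∀ X ∈ φ.source, (Exp b X : (Op H)ˣ) ∈ lorentzO H → X ∈ skewHS b := by
  let f : LHS b → LHS b := fun X => chart b (Exp b X)
  have hf : ContDiff ℝ ∞ f := contDiff_chart_Exp
  have hd : HasFDerivAt f ((ContinuousLinearEquiv.refl ℝ (LHS b) : LHS b ≃L[ℝ] LHS b) :
      LHS b →L[ℝ] LHS b) 0 := hasFDerivAt_chart_Exp_zero
  let φ₀ := hf.contDiffAt.toOpenPartialHomeomorph f hd (by simp)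
  obtain ⟨V, hV, hV0, hVinj⟩ := exists_injOn_exp (𝔸 := Op H)
  let s : Set (LHS b) := {X | fderiv ℝ f X ∈ range
    (ContinuousLinearEquiv.toContinuousLinearMap : (LHS b ≃L[ℝ] LHS b) → LHS b →L[ℝ] LHS b)} ∩
    {X | -X.op ∈ V} ∩ {X | dag X.op ∈ V}
  have hs : IsOpen s := by
    refine (IsOpen.inter ?_ ?_).inter ?_
    · exact ContinuousLinearEquiv.isOpen.preimage (hf.continuous_fderiv (by simp))
    · exact hV.preimage (LHS.opL b).continuous.neg
    · exact hV.preimage (continuous_dag.comp (LHS.opL b).continuous)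
  have h0s : (0 : LHS b) ∈ s :=
    ⟨⟨⟨_, hd.fderiv.symm⟩, by simpa [LHS.op_zero] using hV0⟩,
      by simpa [LHS.op_zero, dag] using hV0⟩
  have hsrc : ∀ X ∈ (φ₀.restrOpen s hs).source, X ∈ s := fun X hX => hX.2
  refine ⟨φ₀.restrOpen s hs, ⟨hf.contDiffAt.mem_toOpenPartialHomeomorph_source hd (by simp), h0s⟩,
    fun X => rfl, fun Y hY => ?_, fun X hX hU => ?_⟩
  · have hX := hsrc _ ((φ₀.restrOpen s hs).map_target hY)
    obtain ⟨f', hf'⟩ := hX.1.1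
    refine ((φ₀.restrOpen s hs).contDiffAt_symm hY (f₀' := f') ?_ hf.contDiffAt).contDiffWithinAt
    rw [hf']
    exact (hf.differentiable (by simp) _).hasFDerivAt
  · -- both `-X` and `dag X` are small logarithms of the inverse of `exp X`
    have hX := hsrc X hX
    refine mem_skewHS.2 (hVinj hX.2 hX.1.2 ?_)
    rw [← dag_exp, ← coe_Exp, dag_eq_inv hU]
    exact Units.inv_eq_of_mul_eq_one_left (exp_neg_mul_exp _)

/-- The logarithm integral of a Lorentz operator is Hilbert-Schmidt and Lorentz skew. -/
theorem exists_log {U : GLHS b} (hU : (U : (Op H)ˣ) ∈ lorentzO H)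
    (h : ∀ t ∈ Icc (0 : ℝ) 1, IsUnit (1 + t • (chart b U).op)) :
    ∃ X ∈ skewHS b, Exp b X = U ∧ ∀ v, ((U : (Op H)ˣ) : Op H) v = v → X.op v = 0 := by
  set K := (chart b U).op with hK
  have hUK : ((U : (Op H)ˣ) : Op H) = 1 + K := coe_eq_one_add U
  refine ⟨LHS.mulLeft (logFactor K 1) (chart b U), ?_, Subtype.ext (Units.ext ?_), fun v hv => ?_⟩
  · rw [mem_skewHS, LHS.op_mulLeft, ← hK, dag_mul]
    set A : Op H := ((U : (Op H)ˣ) : Op H) with hA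
    set A' : Op H := (((U : (Op H)ˣ)⁻¹ : (Op H)ˣ) : Op H) with hA'
    have hAA' : A * A' = 1 := (U : (Op H)ˣ).mul_inv
    have hA'A : A' * A = 1 := (U : (Op H)ˣ).inv_mul
    have hdA : dag A = A' := dag_eq_inv hU
    have hKA : Commute K A := by rw [hUK]; exact (Commute.one_right K).add_right (Commute.refl K)
    have hdK : dag K = -(A' * K) := by
      have : K = A - 1 := by rw [hUK]; abel
      rw [this, dag_sub, hdA, dag_one, mul_sub, hA'A, mul_one]; abel
    -- the Lorentz adjoint of the resolvent at `t` is `A` times the resolvent at `1 - t`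
    have hR : ∀ t ∈ Icc (0 : ℝ) 1, dag (resolv K t) = resolv K (1 - t) * A := fun t ht => by
      have ht' : 1 - t ∈ Icc (0 : ℝ) 1 := ⟨by linarith [ht.2], by linarith [ht.1]⟩
      have e1 : dag (resolv K t) * dag (1 + t • K) = 1 := by
        rw [← dag_mul, resolv, clamp_of_mem ht, Ring.mul_inverse_cancel _ (h t ht), dag_one]
      have e2 : dag (1 + t • K) = A' * (1 + (1 - t) • K) := by
        have : (1 + (1 - t) • K : Op H) = A - t • K := by rw [hUK, sub_smul, one_smul]; abel
        rw [dag_add, dag_one, dag_smul, hdK, this, mul_sub, hA'A, mul_smul_comm, smul_neg]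
        abel
      have e3 : (1 + (1 - t) • K) * resolv K (1 - t) = 1 := by
        rw [resolv, clamp_of_mem ht', Ring.mul_inverse_cancel _ (h _ ht')]
      have e4 : dag (1 + t • K) * (resolv K (1 - t) * A) = 1 := by
        rw [e2, mul_assoc, ← mul_assoc _ _ A, e3, one_mul, hA'A]
      exact left_inv_eq_right_inv e1 e4
    have hcont := continuous_resolv h
    have hI : dag (logFactor K 1) = logFactor K 1 * A := by
      have h1 := (dagL H).intervalIntegral_comp_comm
        (hcont.intervalIntegrable (μ := MeasureTheory.volume) 0 1)
      have h2 := ((ContinuousLinearMap.mul ℝ (Op H)).flip A).intervalIntegral_comp_comm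
        (hcont.intervalIntegrable (μ := MeasureTheory.volume) 0 1)
      simp only [dagL_apply, ContinuousLinearMap.mul_apply', ContinuousLinearMap.flip_apply]
        at h1 h2
      rw [logFactor, ← h1, ← h2]
      have h3 := intervalIntegral.integral_comp_sub_left (a := 0) (b := 1)
        (fun t => resolv K t * A) 1
      rw [sub_self, sub_zero] at h3
      rw [← h3]
      refine intervalIntegral.integral_congr fun t ht => ?_
      rw [uIcc_of_le zero_le_one] at ht
      exact hR t ht
    have hcL : Commute K (logFactor K 1) := commute_logFactor h (Commute.refl K) 1
    have hcA : Commute A (logFactor K 1) := commute_logFactor h hKA.symm 1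
    rw [hI, hdK, ← hcA.eq, neg_mul, mul_assoc, ← mul_assoc K, hKA.eq, mul_assoc, ← mul_assoc A',
      hA'A, one_mul, hcL.eq]
  · rw [coe_Exp, LHS.op_mulLeft, ← hK, exp_logFactor h, hUK]
  · have : K v = 0 := by
      rw [hUK] at hv
      simpa using hv
    rw [LHS.op_mulLeft, ← hK]
    change logFactor K 1 (K v) = 0
    rw [this, map_zero]

/-! ### The sign of the truncated determinants -/

variable (b) in
/-- The determinant of the truncation of an operator to the span of `e_0, …, e_{n-1}`. -/
def truncDet (n : ℕ) (A : Op H) : ℝ :=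
  (Matrix.of fun i j : Fin n => (inner ℝ (e b i) (A (e b j)) : ℝ)).det

theorem continuous_truncDet (n : ℕ) : Continuous (truncDet b n) := by
  unfold truncDet
  refine Continuous.matrix_det (continuous_matrix fun i j => ?_)
  simp only [Matrix.of_apply]
  fun_prop

theorem truncDet_one (n : ℕ) : truncDet b n 1 = 1 := by
  rw [truncDet, ← Matrix.det_one (n := Fin n)]
  congr 1
  ext i j
  simp [inner_e, Matrix.one_apply, Fin.ext_iff]

/-- The squared Hilbert-Schmidt norm of the restriction of an operator to the closed span of
`e_n, e_{n+1}, …`. -/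
def tailSq (n : ℕ) (K : LHS b) : ℝ := ∑' j, ‖K.op (e b (j + n))‖ ^ 2

theorem tendsto_tailSq (K : LHS b) : Tendsto (fun n => tailSq n K) atTop (𝓝 0) :=
  tendsto_sum_nat_add fun j => ‖K.op (e b j)‖ ^ 2

theorem summable_tail (n : ℕ) (K : LHS b) : Summable fun j => ‖K.op (e b (j + n))‖ ^ 2 :=
  (summable_nat_add_iff n).2 K.summable_sq

theorem tailSq_nonneg (n : ℕ) (K : LHS b) : 0 ≤ tailSq n K := tsum_nonneg fun _ => sq_nonneg _

theorem tailSq_le (n : ℕ) (K : LHS b) : tailSq n K ≤ ‖K‖ ^ 2 := by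
  rw [LHS.norm_sq_eq, ← K.summable_sq.sum_add_tsum_nat_add n]
  exact le_add_of_nonneg_left (Finset.sum_nonneg fun _ _ => sq_nonneg _)

theorem tailSq_add_le (n : ℕ) (K L : LHS b) :
    tailSq n (K + L) ≤ 2 * tailSq n K + 2 * tailSq n L := by
  rw [tailSq, tailSq, tailSq, ← tsum_mul_left, ← tsum_mul_left,
    ← ((summable_tail n K).mul_left 2).tsum_add ((summable_tail n L).mul_left 2)]
  refine (summable_tail n (K + L)).tsum_le_tsum (fun j => ?_)
    (((summable_tail n K).mul_left 2).add ((summable_tail n L).mul_left 2))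
  have h1 := norm_add_le (K.op (e b (j + n))) (L.op (e b (j + n)))
  have h2 : ‖(K + L).op (e b (j + n))‖ ^ 2
      ≤ (‖K.op (e b (j + n))‖ + ‖L.op (e b (j + n))‖) ^ 2 := by
    gcongr
    simpa [LHS.op_add] using h1
  nlinarith [sq_nonneg (‖K.op (e b (j + n))‖ - ‖L.op (e b (j + n))‖)]

/-- A truncation of the invertible operator `1 + K` is invertible once the tail of `K` is small
compared to the inverse. -/
theorem truncDet_ne_zero {A : (Op H)ˣ} {K : LHS b} (hA : (A : Op H) = 1 + K.op) {n : ℕ}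
    (h : tailSq n K * ‖((A⁻¹ : (Op H)ˣ) : Op H)‖ ^ 2 < 1) : truncDet b n A ≠ 0 := by
  intro h0
  obtain ⟨v, hv, hvM⟩ := Matrix.exists_vecMul_eq_zero_iff.2 h0
  set x : Sp H := ∑ i : Fin n, v i • e b i with hx
  have hxe : ∀ i : Fin n, (inner ℝ (e b i) x : ℝ) = v i := fun i => by
    simp [hx, inner_sum, inner_smul_right, inner_e, ← Fin.ext_iff]
  have hxn : ∀ j, n ≤ j → (inner ℝ (e b j) x : ℝ) = 0 := fun j hj => by
    rw [hx, inner_sum]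
    refine Finset.sum_eq_zero fun i _ => ?_
    rw [inner_smul_right, inner_e, if_neg (by omega), mul_zero]
  have hx0 : x ≠ 0 := fun h => hv (funext fun i => by rw [← hxe i, h]; simp)
  set y := ContinuousLinearMap.adjoint (A : Op H) x with hy
  have hye : ∀ j, (inner ℝ (e b j) y : ℝ) = inner ℝ ((A : Op H) (e b j)) x := fun j => by
    rw [hy, ContinuousLinearMap.adjoint_inner_right]
  -- `x` lies in the span of the first basis vectors, and its image by the adjoint is orthogonal
  -- to this span
  have hy0 : ∀ j < n, (inner ℝ (e b j) y : ℝ) = 0 := fun j hj => by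
    have := congrFun hvM ⟨j, hj⟩
    simp only [Matrix.vecMul, dotProduct, Matrix.of_apply, Pi.zero_apply] at this
    rw [hye, real_inner_comm, hx, sum_inner, ← this]
    simp [inner_smul_left]
  have hy1 : ‖y‖ ^ 2 ≤ tailSq n K * ‖x‖ ^ 2 := by
    have hs := hasSum_inner_sq (b := b) y
    rw [← hs.tsum_eq, ← hs.summable.sum_add_tsum_nat_add n, Finset.sum_eq_zero, zero_add, tailSq,
      ← tsum_mul_right]
    · refine ((summable_nat_add_iff n).2 hs.summable).tsum_le_tsum (fun j => ?_)
        ((summable_tail n K).mul_right _)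
      rw [hye, hA, add_apply, inner_add_left]
      change ((inner ℝ (e b (j + n)) x : ℝ) + _) ^ 2 ≤ _
      rw [hxn _ (by omega), zero_add, ← mul_pow]
      exact sq_le_sq' (neg_le_of_abs_le (abs_real_inner_le_norm _ _)) (real_inner_le_norm _ _)
    · intro j hj
      rw [hy0 j (Finset.mem_range.1 hj)]; simp
  have hxy : ContinuousLinearMap.adjoint ((A⁻¹ : (Op H)ˣ) : Op H) y = x := by
    refine ext_inner_right ℝ fun w => ?_
    rw [ContinuousLinearMap.adjoint_inner_left, hy, ContinuousLinearMap.adjoint_inner_left,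
      apply_inv]
  have hx1 : ‖x‖ ≤ ‖((A⁻¹ : (Op H)ˣ) : Op H)‖ * ‖y‖ := by
    rw [← LinearIsometryEquiv.norm_map ContinuousLinearMap.adjoint ((A⁻¹ : (Op H)ˣ) : Op H)]
    conv_lhs => rw [← hxy]
    exact ContinuousLinearMap.le_opNorm _ _
  have hx2 : ‖x‖ ^ 2 ≤ ‖((A⁻¹ : (Op H)ˣ) : Op H)‖ ^ 2 * ‖y‖ ^ 2 := by
    rw [← mul_pow]; gcongr
  have hx3 : 0 < ‖x‖ ^ 2 := by positivity
  have := mul_le_mul_of_nonneg_left hy1 (sq_nonneg ‖((A⁻¹ : (Op H)ˣ) : Op H)‖)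
  nlinarith

theorem continuous_one_add_op : Continuous fun K : LHS b => 1 + K.op :=
  continuous_const.add (LHS.opL b).continuous

/-- Near an invertible `1 + K₀`, the truncated determinants do not vanish from some rank on. -/
theorem exists_ball_truncDet_ne_zero {K₀ : LHS b} (h₀ : IsUnit (1 + K₀.op)) :
    ∃ δ > 0, ∃ N, ∀ K ∈ Metric.ball K₀ δ, IsUnit (1 + K.op) ∧
      ∀ n ≥ N, truncDet b n (1 + K.op) ≠ 0 := by
  obtain ⟨A₀, hA₀⟩ := h₀
  set C := ‖((A₀⁻¹ : (Op H)ˣ) : Op H)‖ + 1 with hC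
  have hC0 : 0 < C := by positivity
  have h1 : ∀ᶠ K in 𝓝 K₀, IsUnit (1 + K.op) :=
    continuous_one_add_op.continuousAt.eventually (by
      have := Units.isOpen.mem_nhds A₀.isUnit
      rwa [hA₀] at this)
  have h2 : ∀ᶠ K in 𝓝 K₀, ‖Ring.inverse (1 + K.op)‖ < C := by
    have hc : ContinuousAt (fun K : LHS b => ‖Ring.inverse (1 + K.op)‖) K₀ := by
      refine ContinuousAt.norm (ContinuousAt.comp (g := Ring.inverse)
        (f := fun K : LHS b => 1 + K.op) ?_ continuous_one_add_op.continuousAt)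
      rw [← hA₀]
      exact NormedRing.inverse_continuousAt A₀
    refine hc.eventually_lt_const ?_
    change ‖Ring.inverse (1 + K₀.op)‖ < C
    rw [← hA₀, Ring.inverse_unit, hC]
    linarith
  have h3 : ∀ᶠ K in 𝓝 K₀, 2 * ‖K - K₀‖ ^ 2 * C ^ 2 < 1 / 2 := by
    have hc : ContinuousAt (fun K : LHS b => 2 * ‖K - K₀‖ ^ 2 * C ^ 2) K₀ := by fun_prop
    exact hc.eventually_lt_const (by simp)
  have h4 : ∀ᶠ n in atTop, 2 * tailSq n K₀ * C ^ 2 < 1 / 2 := by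
    have := ((tendsto_tailSq K₀).const_mul 2).mul_const (C ^ 2)
    exact this.eventually_lt_const (by simp)
  obtain ⟨δ, hδ, hball⟩ := Metric.eventually_nhds_iff_ball.1 (h1.and (h2.and h3))
  obtain ⟨N, hN⟩ := eventually_atTop.1 h4
  refine ⟨δ, hδ, N, fun K hK => ?_⟩
  obtain ⟨hu, hinv, hsmall⟩ := hball K hK
  refine ⟨hu, fun n hn => ?_⟩
  obtain ⟨A, hA⟩ := hu
  rw [← hA]
  refine truncDet_ne_zero hA ?_
  rw [← hA, Ring.inverse_unit] at hinv
  have h5 := tailSq_add_le n K₀ (K - K₀)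
  have h6 := tailSq_le n (K - K₀)
  rw [add_sub_cancel] at h5
  have h7 := hN n hn
  have h8 : ‖((A⁻¹ : (Op H)ˣ) : Op H)‖ ^ 2 ≤ C ^ 2 := by gcongr
  have h9 := tailSq_nonneg n K
  have hCsq : 0 < C ^ 2 := by positivity
  calc tailSq n K * ‖((A⁻¹ : (Op H)ˣ) : Op H)‖ ^ 2 ≤ tailSq n K * C ^ 2 := by gcongr
    _ ≤ (2 * tailSq n K₀ + 2 * ‖K - K₀‖ ^ 2) * C ^ 2 := by
        gcongr
        linarith
    _ < 1 := by linarith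

theorem pos_of_isPreconnected {X : Type*} [TopologicalSpace X] {s : Set X} (hs : IsPreconnected s)
    {f : X → ℝ} (hf : ContinuousOn f s) (h0 : ∀ x ∈ s, f x ≠ 0) {x y : X} (hx : x ∈ s)
    (hy : y ∈ s) (hpos : 0 < f x) : 0 < f y := by
  by_contra hneg
  obtain ⟨z, hz, hz0⟩ := hs.intermediate_value hy hx hf ⟨not_lt.1 hneg, hpos.le⟩
  exact h0 z hz hz0

/-- The operator `1 + K` has positive determinant: its truncated determinants are positive from
some rank on. -/
def PosDet (K : LHS b) : Prop := ∀ᶠ n in atTop, 0 < truncDet b n (1 + K.op)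

theorem exists_ball_posDet_iff {K₀ : LHS b} (h₀ : IsUnit (1 + K₀.op)) :
    ∃ δ > 0, ∀ K ∈ Metric.ball K₀ δ, IsUnit (1 + K.op) ∧ (PosDet K ↔ PosDet K₀) := by
  obtain ⟨δ, hδ, N, h⟩ := exists_ball_truncDet_ne_zero h₀
  refine ⟨δ, hδ, fun K hK => ⟨(h K hK).1, ?_⟩⟩
  have hpre : IsPreconnected (Metric.ball K₀ δ) := (convex_ball K₀ δ).isPreconnected
  have key : ∀ n ≥ N, ∀ K₁ ∈ Metric.ball K₀ δ, ∀ K₂ ∈ Metric.ball K₀ δ,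
      0 < truncDet b n (1 + K₁.op) → 0 < truncDet b n (1 + K₂.op) :=
    fun n hn K₁ h₁ K₂ h₂ => pos_of_isPreconnected hpre
      (f := fun K : LHS b => truncDet b n (1 + K.op))
      ((continuous_truncDet n).comp continuous_one_add_op).continuousOn
      (fun K hK => (h K hK).2 n hn) h₁ h₂
  have h0 := Metric.mem_ball_self (x := K₀) hδ
  constructor <;> intro hp <;> filter_upwards [hp, eventually_ge_atTop N] with n hn1 hn2
  · exact key n hn2 _ hK _ h0 hn1
  · exact key n hn2 _ h0 _ hK hn1

theorem isOpen_posDet : IsOpen {K : LHS b | IsUnit (1 + K.op) ∧ PosDet K} := by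
  rw [Metric.isOpen_iff]
  rintro K₀ ⟨h₀, hp⟩
  obtain ⟨δ, hδ, h⟩ := exists_ball_posDet_iff h₀
  exact ⟨δ, hδ, fun K hK => ⟨(h K hK).1, (h K hK).2.2 hp⟩⟩

theorem isOpen_not_posDet : IsOpen {K : LHS b | IsUnit (1 + K.op) ∧ ¬ PosDet K} := by
  rw [Metric.isOpen_iff]
  rintro K₀ ⟨h₀, hp⟩
  obtain ⟨δ, hδ, h⟩ := exists_ball_posDet_iff h₀
  exact ⟨δ, hδ, fun K hK => ⟨(h K hK).1, fun h' => hp ((h K hK).2.1 h')⟩⟩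

/-- The sign of the determinant is constant on connected sets of invertible operators. -/
theorem posDet_of_isPreconnected {C : Set (LHS b)} (hC : IsPreconnected C)
    (hu : ∀ K ∈ C, IsUnit (1 + K.op)) {K L : LHS b} (hK : K ∈ C) (hL : L ∈ C) (h : PosDet K) :
    PosDet L := by
  have := hC.subset_left_of_subset_union isOpen_posDet isOpen_not_posDet
    (Set.disjoint_left.2 fun x hx hx' => hx'.2 hx.2)
    (fun x hx => (em (PosDet x)).imp (fun h => ⟨hu x hx, h⟩) fun h => ⟨hu x hx, h⟩)
    ⟨K, hK, hu K hK, h⟩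
  exact (this hL).2

theorem isUnit_one_add_chart (U : GLHS b) : IsUnit (1 + (chart b U).op) := by
  rw [← coe_eq_one_add]
  exact (U : (Op H)ˣ).isUnit

theorem posDet_mul_Exp_iff (U : GLHS b) (X : LHS b) :
    PosDet (chart b (U * Exp b X)) ↔ PosDet (chart b U) := by
  have hc : Continuous fun t : ℝ => chart b (U * Exp b (t • X)) := by
    simp only [chart_mul]
    refine ((continuous_mulLeft _).comp ?_).add continuous_const
    exact continuous_chart_Exp.comp (continuous_id.smul continuous_const)
  have hpre := isPreconnected_range hc
  have hu : ∀ K ∈ range fun t : ℝ => chart b (U * Exp b (t • X)), IsUnit (1 + K.op) := by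
    rintro _ ⟨t, rfl⟩
    exact isUnit_one_add_chart _
  have h0 : chart b U ∈ range fun t : ℝ => chart b (U * Exp b (t • X)) :=
    ⟨0, by simp [Exp_zero]⟩
  have h1 : chart b (U * Exp b X) ∈ range fun t : ℝ => chart b (U * Exp b (t • X)) :=
    ⟨1, by simp⟩
  exact ⟨posDet_of_isPreconnected hpre hu h1 h0, posDet_of_isPreconnected hpre hu h0 h1⟩

theorem posDet_zero : PosDet (0 : LHS b) :=
  Eventually.of_forall fun n => by simp [LHS.op_zero, truncDet_one]

/-! ### Causality and the group `SO(H,1)` -/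

theorem norm_snd_sq (w : Sp H) : ‖w.snd‖ ^ 2 = lorentz w w + w.fst ^ 2 := by
  rw [lorentz, real_inner_self_eq_norm_sq]; ring

theorem fst_ne_zero_of_lorentz_nonpos {w : Sp H} (h : lorentz w w ≤ 0) (hw : w ≠ 0) :
    w.fst ≠ 0 := by
  intro h0
  have h1 := norm_snd_sq w
  rw [h0] at h1
  have h2 : ‖w.snd‖ = 0 := by nlinarith [sq_nonneg ‖w.snd‖]
  exact hw (Sp.ext (by simpa using h0) (by simpa using h2))

/-- Two future directed causal vectors have nonpositive Lorentz product. -/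
theorem lorentz_nonpos_of_future {u v : Sp H} (hu : lorentz u u ≤ 0) (hv : lorentz v v ≤ 0)
    (hu0 : 0 ≤ u.fst) (hv0 : 0 ≤ v.fst) : lorentz u v ≤ 0 := by
  have h1 : ‖u.snd‖ ≤ u.fst := (abs_le_of_sq_le_sq' (by linarith [norm_snd_sq u]) hu0).2
  have h2 : ‖v.snd‖ ≤ v.fst := (abs_le_of_sq_le_sq' (by linarith [norm_snd_sq v]) hv0).2
  have h3 := real_inner_le_norm u.snd v.snd
  have h4 : ‖u.snd‖ * ‖v.snd‖ ≤ u.fst * v.fst := by gcongr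
  unfold lorentz
  linarith

theorem map_ne_zero_of_unit (A : (Op H)ˣ) {w : Sp H} (hw : w ≠ 0) : (A : Op H) w ≠ 0 := by
  intro h
  apply hw
  rw [← inv_apply A w, h, map_zero]

theorem ne_zero_of_mem_coneP {z : Sp H} (hz : z ∈ coneP) : z ≠ 0 := by
  rintro rfl
  exact lt_irrefl _ hz.2

/-- A Lorentz operator that maps the positive light cone into itself maps it onto itself, as it
maps the negative light cone into itself too. -/
theorem mem_lorentzSO_of_fst_pos {A : (Op H)ˣ} (hA : A ∈ lorentzO H)
    (h : ∀ z ∈ (coneP : Set (Sp H)), 0 < ((A : Op H) z).fst) : A ∈ lorentzSO H := by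
  refine ⟨hA, Subset.antisymm ?_ fun z hz => ?_⟩
  · rintro _ ⟨z, hz, rfl⟩
    exact ⟨by rw [hA, hz.1], h z hz⟩
  · set w := ((A⁻¹ : (Op H)ˣ) : Op H) z with hw
    have hAw : (A : Op H) w = z := apply_inv A z
    have hw0 : lorentz w w = 0 := by rw [hw, inv_mem_lorentzO hA, hz.1]
    have hwne : w ≠ 0 := fun h => by
      rw [h, map_zero] at hAw
      exact ne_zero_of_mem_coneP hz hAw.symm
    rcases lt_or_gt_of_ne (fst_ne_zero_of_lorentz_nonpos hw0.le hwne) with hneg | hpos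
    · have h1 := h (-w) ⟨by rw [lorentz_neg_left, lorentz_neg_right, hw0]; simp, by simpa⟩
      rw [map_neg, hAw] at h1
      have := hz.2
      simp at h1
      linarith
    · exact ⟨w, ⟨hw0, hpos⟩, hAw⟩

theorem mem_coneP_of_mem_lorentzSO {A : (Op H)ˣ} (hA : A ∈ lorentzSO H) {z : Sp H}
    (hz : z ∈ (coneP : Set (Sp H))) : (A : Op H) z ∈ (coneP : Set (Sp H)) := by
  rw [← hA.2]
  exact ⟨z, hz, rfl⟩

variable (H) in
/-- `SO(H,1)` as a subgroup. -/
def lorentzSOGroup : Subgroup (Op H)ˣ where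
  carrier := lorentzSO H
  one_mem' := ⟨fun _ _ => rfl, by simp⟩
  mul_mem' := fun {A B} hA hB => mem_lorentzSO_of_fst_pos (mul_mem_lorentzO hA.1 hB.1)
    fun z hz => (mem_coneP_of_mem_lorentzSO hA (mem_coneP_of_mem_lorentzSO hB hz)).2
  inv_mem' := fun {A} hA => mem_lorentzSO_of_fst_pos (inv_mem_lorentzO hA.1) fun z hz => by
    rw [← hA.2] at hz
    obtain ⟨w, hw, rfl⟩ := hz
    rw [inv_apply]
    exact hw.2

theorem mul_mem_lorentzSO {A B : (Op H)ˣ} (hA : A ∈ lorentzSO H) (hB : B ∈ lorentzSO H) :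
    A * B ∈ lorentzSO H := (lorentzSOGroup H).mul_mem hA hB

theorem inv_mem_lorentzSO {A : (Op H)ˣ} (hA : A ∈ lorentzSO H) : A⁻¹ ∈ lorentzSO H :=
  (lorentzSOGroup H).inv_mem hA

theorem vec_mem_coneP {u : H} (hu : ‖u‖ = 1) : vec 1 u ∈ (coneP : Set (Sp H)) :=
  ⟨by simp [lorentz, hu], by simp⟩

/-- The elements of `SO(H,1)` map future directed causal vectors to future directed ones. -/
theorem fst_pos_of_causal (b : HilbertBasis ℕ ℝ H) {A : (Op H)ˣ} (hA : A ∈ lorentzSO H)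
    {v : Sp H} (hv : lorentz v v ≤ 0) (hv0 : 0 < v.fst) : 0 < ((A : Op H) v).fst := by
  have hne : v ≠ 0 := by rintro rfl; exact lt_irrefl _ hv0
  have hAv : lorentz ((A : Op H) v) ((A : Op H) v) ≤ 0 := by rw [hA.1]; exact hv
  refine (lt_or_gt_of_ne (fst_ne_zero_of_lorentz_nonpos hAv
    (map_ne_zero_of_unit A hne))).resolve_left fun hneg => ?_
  -- a null vector `z` of the future cone that is not proportional to `v`
  obtain ⟨z, hz, hvz⟩ : ∃ z ∈ (coneP : Set (Sp H)), lorentz v z < 0 := by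
    have hb : ‖b 0‖ = 1 := b.orthonormal.1 0
    rcases le_total (inner ℝ v.snd (b 0) : ℝ) 0 with h | h
    · refine ⟨vec 1 (b 0), vec_mem_coneP hb, ?_⟩
      simp [lorentz]; linarith
    · refine ⟨vec 1 (-b 0), vec_mem_coneP (by simpa), ?_⟩
      simp [lorentz]; linarith
  have hz' := mem_coneP_of_mem_lorentzSO hA hz
  have h1 := lorentz_nonpos_of_future (u := -((A : Op H) v)) (v := (A : Op H) z)
    (by rw [lorentz_neg_left, lorentz_neg_right, neg_neg]; exact hAv) hz'.1.le
    (by simpa using hneg.le) hz'.2.le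
  rw [lorentz_neg_left, hA.1] at h1
  linarith

/-- A negative eigenvalue of an element of `SO(H,1)` is `-1`, with spacelike eigenvectors. -/
theorem spacelike_of_neg_eigenvector (b : HilbertBasis ℕ ℝ H) {A : (Op H)ˣ}
    (hA : A ∈ lorentzSO H) {v : Sp H} (hv : v ≠ 0) {μ : ℝ} (hμ : 0 < μ)
    (h : (A : Op H) v = -(μ • v)) : 0 < lorentz v v ∧ μ = 1 := by
  have h1 : 0 < lorentz v v := by
    by_contra hle
    rw [not_lt] at hle
    rcases lt_or_gt_of_ne (fst_ne_zero_of_lorentz_nonpos hle hv) with hneg | hpos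
    · have := fst_pos_of_causal b hA (v := -v)
        (by rw [lorentz_neg_left, lorentz_neg_right, neg_neg]; exact hle) (by simpa)
      rw [map_neg, h] at this
      simp at this
      nlinarith
    · have := fst_pos_of_causal b hA hle hpos
      rw [h] at this
      simp at this
      nlinarith
  refine ⟨h1, ?_⟩
  have h2 := hA.1 v v
  rw [h, lorentz_neg_left, lorentz_neg_right, lorentz_smul_left, lorentz_smul_right] at h2
  have h3 : (μ - 1) * (μ + 1) * lorentz v v = 0 := by linarith
  rcases mul_eq_zero.1 h3 with h4 | h4
  · rcases mul_eq_zero.1 h4 with h5 | h5 <;> linarith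
  · exact absurd h4 h1.ne'

/-! ### Lorentz reflections and rotations -/

variable (b) in
/-- The operator `x ↦ ⟨u, x⟩_L v`. -/
def lrank (u v : Sp H) : LHS b := rankOneHS b (opJ H u) v

theorem op_lrank (u v x : Sp H) : (lrank b u v).op x = lorentz u x • v := by
  change (inner ℝ (opJ H u) x : ℝ) • v = _
  rw [real_inner_comm, inner_opJ, lorentz_comm]

/-- The reflection `x ↦ x - 2 ⟨v, x⟩_L v`. -/
def reflOp (b : HilbertBasis ℕ ℝ H) (v : Sp H) : Op H := 1 - (2 : ℝ) • (lrank b v v).op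

theorem reflOp_apply (v x : Sp H) : reflOp b v x = x - (2 * lorentz v x) • v := by
  simp [reflOp, op_lrank, smul_smul]

theorem reflOp_mul_self {v : Sp H} (hv : lorentz v v = 1) : reflOp b v * reflOp b v = 1 := by
  ext1 x
  change reflOp b v (reflOp b v x) = x
  simp only [reflOp_apply, lorentz_sub_right, lorentz_smul_right, hv]
  module

variable (b) in
/-- The reflection in a vector `v` with `⟨v, v⟩_L = 1`, in the Hilbert-Schmidt group. -/
def reflU (v : Sp H) (hv : lorentz v v = 1) : GLHS b :=
  ⟨⟨reflOp b v, reflOp b v, reflOp_mul_self hv, reflOp_mul_self hv⟩, by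
    change reflOp b v - 1 ∈ hsSubmodule b
    have : reflOp b v - 1 = ((-2 : ℝ) • lrank b v v).op := by
      rw [reflOp, LHS.op_smul, neg_smul]; abel
    rw [this]
    exact LHS.summable_sq _⟩

variable {v w : Sp H}

theorem coe_reflU (hv : lorentz v v = 1) :
    (((reflU b v hv : GLHS b) : (Op H)ˣ) : Op H) = reflOp b v := rfl

theorem reflU_mul_self (hv : lorentz v v = 1) : reflU b v hv * reflU b v hv = 1 :=
  Subtype.ext (Units.ext (reflOp_mul_self hv))

theorem reflU_mul_reflU_mul (hv : lorentz v v = 1) (U : GLHS b) :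
    reflU b v hv * (reflU b v hv * U) = U := by
  rw [← mul_assoc, reflU_mul_self, one_mul]

theorem reflU_mem_lorentzSO (hv : lorentz v v = 1) :
    ((reflU b v hv : GLHS b) : (Op H)ˣ) ∈ lorentzSO H := by
  refine mem_lorentzSO_of_fst_pos (fun x y => ?_) fun z hz => ?_
  · simp only [coe_reflU, reflOp_apply, lorentz_sub_left, lorentz_sub_right, lorentz_smul_left,
      lorentz_smul_right, hv, lorentz_comm x v]
    ring
  · simp only [coe_reflU, reflOp_apply, Sp.fst_sub, Sp.fst_smul]
    have h1 := norm_snd_sq v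
    have h2 := norm_snd_sq z
    rw [hv] at h1
    rw [hz.1, zero_add, sq_eq_sq₀ (norm_nonneg _) hz.2.le] at h2
    have h3 := abs_real_inner_le_norm v.snd z.snd
    rw [h2] at h3
    have hz0 := hz.2
    -- `2 |s| ‖x‖ < 1 + 2 s ^ 2` for `v = (s, x)`, since `‖x‖ ^ 2 = 1 + s ^ 2`
    have h4 : 2 * |v.fst| * ‖v.snd‖ < 1 + 2 * v.fst ^ 2 := by
      refine (abs_lt_of_sq_lt_sq' ?_ (by positivity)).2
      rw [mul_pow, mul_pow, sq_abs, h1]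
      nlinarith [sq_nonneg v.fst]
    have h5 : 2 * v.fst * (inner ℝ v.snd z.snd : ℝ) ≤ 2 * |v.fst| * (‖v.snd‖ * z.fst) := by
      refine (le_abs_self _).trans ?_
      rw [abs_mul, abs_mul, abs_two]
      gcongr
    have h6 : 2 * |v.fst| * ‖v.snd‖ * z.fst < (1 + 2 * v.fst ^ 2) * z.fst := by gcongr
    unfold lorentz
    nlinarith

variable (b) in
/-- The infinitesimal rotation in the plane spanned by `v` and `w`. -/
def rotGen (v w : Sp H) : LHS b := lrank b v w - lrank b w v

theorem op_rotGen (v w x : Sp H) :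
    (rotGen b v w).op x = lorentz v x • w - lorentz w x • v := by
  simp [rotGen, LHS.op_sub, op_lrank]

theorem rotGen_mem_skewHS (v w : Sp H) : rotGen b v w ∈ skewHS b := by
  rw [mem_skewHS']
  intro x y
  simp only [op_rotGen, lorentz_sub_left, lorentz_smul_left, lorentz_comm x]
  ring

/-- The product of two orthogonal reflections is the rotation of angle `π`. -/
theorem Exp_rotGen (hv : lorentz v v = 1) (hw : lorentz w w = 1) (hvw : lorentz v w = 0) :
    Exp b (Real.pi • rotGen b v w) = reflU b v hv * reflU b w hw := by
  have hwv : lorentz w v = 0 := by rw [lorentz_comm, hvw]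
  have hcube : (rotGen b v w).op * (rotGen b v w).op * (rotGen b v w).op
      = -(rotGen b v w).op := by
    ext1 x
    change (rotGen b v w).op ((rotGen b v w).op ((rotGen b v w).op x)) = -((rotGen b v w).op x)
    simp only [op_rotGen, lorentz_sub_right, lorentz_smul_right, hv, hw, hvw, hwv]
    module
  refine Subtype.ext (Units.ext ?_)
  rw [coe_Exp, LHS.op_smul, exp_smul_of_cube_eq_neg hcube]
  ext1 x
  change x + Real.sin Real.pi • (rotGen b v w).op x
    + (1 - Real.cos Real.pi) • (rotGen b v w).op ((rotGen b v w).op x)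
    = reflOp b v (reflOp b w x)
  simp only [op_rotGen, lorentz_sub_right, lorentz_smul_right, hv, hw, hvw, hwv, Real.sin_pi,
    Real.cos_pi, reflOp_apply]
  module

/-! ### Logarithms in `SO(H,1)` -/

theorem isCompactOperator_rankOneHS (u v : Sp H) : IsCompactOperator (rankOneHS b u v).op := by
  have h1 : IsCompactOperator (ContinuousLinearMap.toSpanSingleton ℝ v : ℝ →L[ℝ] Sp H) :=
    isCompactOperator_of_locallyCompactSpace_rng _
  exact h1.comp_clm (innerSL ℝ u)

/-- The restriction of a Hilbert-Schmidt operator to the span of the first basis vectors. -/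
def headOp (n : ℕ) (K : LHS b) : LHS b :=
  ∑ i ∈ Finset.range n, rankOneHS b (e b i) (K.op (e b i))

theorem op_headOp (n : ℕ) (K : LHS b) : (headOp n K).op
    = ∑ i ∈ Finset.range n, (rankOneHS b (e b i) (K.op (e b i))).op := by
  rw [headOp, ← LHS.opL_apply, map_sum]
  rfl

theorem headOp_apply_e (n : ℕ) (K : LHS b) (j : ℕ) :
    (headOp n K).op (e b j) = if j < n then K.op (e b j) else 0 := by
  rw [op_headOp]
  simp [op_rankOneHS, inner_e]

theorem norm_sub_headOp (n : ℕ) (K : LHS b) : ‖K - headOp n K‖ ^ 2 = tailSq n K := by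
  rw [LHS.norm_sq_eq, ← (K - headOp n K).summable_sq.sum_add_tsum_nat_add n, Finset.sum_eq_zero,
    zero_add]
  · refine tsum_congr fun j => ?_
    rw [LHS.op_sub, sub_apply, headOp_apply_e, if_neg (by omega), sub_zero]
  · intro j hj
    rw [LHS.op_sub, sub_apply, headOp_apply_e, if_pos (Finset.mem_range.1 hj), sub_self]
    simp

theorem tendsto_headOp (K : LHS b) : Tendsto (fun n => headOp n K) atTop (𝓝 K) := by
  rw [tendsto_iff_norm_sub_tendsto_zero]
  have h := (tendsto_tailSq K).sqrt
  rw [Real.sqrt_zero] at h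
  refine h.congr fun n => ?_
  rw [← norm_sub_headOp, Real.sqrt_sq (norm_nonneg _), norm_sub_rev]

theorem isCompactOperator_op (K : LHS b) : IsCompactOperator K.op := by
  refine isCompactOperator_of_tendsto
    (((LHS.opL b).continuous.tendsto K).comp (tendsto_headOp K)) (Eventually.of_forall fun n => ?_)
  simp only [Function.comp_apply, LHS.opL_apply, op_headOp]
  induction Finset.range n using Finset.induction_on with
  | empty => simpa using isCompactOperator_zero
  | insert i s hi ih =>
    rw [Finset.sum_insert hi]
    exact (isCompactOperator_rankOneHS _ _).add ih

/-- The eigenspace of an element of the Hilbert-Schmidt group for the eigenvalue `-1`. -/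
def negEigen (U : GLHS b) : Submodule ℝ (Sp H) :=
  LinearMap.ker ((((U : (Op H)ˣ) : Op H) + 1 : Op H) : Sp H →ₗ[ℝ] Sp H)

theorem mem_negEigen {U : GLHS b} {x : Sp H} :
    x ∈ negEigen U ↔ ((U : (Op H)ˣ) : Op H) x = -x := by
  rw [negEigen, LinearMap.mem_ker, eq_neg_iff_add_eq_zero]
  rfl

instance finiteDimensional_negEigen (U : GLHS b) : FiniteDimensional ℝ (negEigen U) := by
  have hcl : IsClosed (negEigen U : Set (Sp H)) :=
    ContinuousLinearMap.isClosed_ker (((U : (Op H)ˣ) : Op H) + 1)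
  have : CompleteSpace (negEigen U) := hcl.completeSpace_coe
  -- on this eigenspace the compact operator `U - 1` is `-2`
  have h1 : IsCompactOperator fun x : negEigen U => (-(1 / 2) : ℝ) • (chart b U).op x :=
    ((isCompactOperator_op (chart b U)).smul (-(1 / 2) : ℝ)).comp_clm (negEigen U).subtypeL
  have h2 : ∀ x : negEigen U, (-(1 / 2) : ℝ) • (chart b U).op x = x := fun x => by
    have hx := mem_negEigen.1 x.2
    rw [coe_eq_one_add] at hx
    have hx' : (chart b U).op x = (-2 : ℝ) • (x : Sp H) := by
      have : (x : Sp H) + (chart b U).op x = -x := hx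
      rw [eq_neg_iff_add_eq_zero] at this
      rw [neg_smul, two_smul, eq_neg_iff_add_eq_zero, ← this]
      abel
    rw [hx', smul_smul]
    norm_num
  have h3 : IsCompactOperator (id : negEigen U → negEigen U) := by
    have := h1.codRestrict (V := negEigen U) (fun x => by rw [h2]; exact x.2) hcl
    convert! this using 1
    ext x
    exact (h2 x).symm
  exact FiniteDimensional.of_isCompactOperator_id (𝕜 := ℝ) h3

theorem isUnit_of_negEigen_eq_bot {U : GLHS b} (hU : (U : (Op H)ˣ) ∈ lorentzSO H)
    (hE : negEigen U = ⊥) {t : ℝ} (ht : t ∈ Icc (0 : ℝ) 1) : IsUnit (1 + t • (chart b U).op) := by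
  rcases ht.1.eq_or_lt with rfl | ht0
  · simp
  have hμ : -t⁻¹ ≠ 0 := by simpa using ht0.ne'
  rcases (isCompactOperator_op (chart b U)).hasEigenvalue_or_mem_resolventSet hμ with h | h
  · exfalso
    obtain ⟨v, hv⟩ := h.exists_hasEigenvector
    have hv0 := hv.2
    have h1 : (chart b U).op v = (-t⁻¹) • v := hv.apply_eq_smul
    have h2 : ((U : (Op H)ˣ) : Op H) v = -((t⁻¹ - 1) • v) := by
      rw [coe_eq_one_add]
      change v + (chart b U).op v = _
      rw [h1]
      module
    rcases ht.2.eq_or_lt with rfl | ht1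
    · exact map_ne_zero_of_unit _ hv0 (by rw [h2]; simp)
    · have h3 := (spacelike_of_neg_eigenvector b hU hv0
        (sub_pos.2 ((one_lt_inv₀ ht0).2 ht1)) h2).2
      rw [h3, one_smul] at h2
      have h4 := mem_negEigen.2 h2
      rw [hE] at h4
      exact hv0 h4
  · rw [resolventSet, mem_ofPred_eq] at h
    have h1 : (1 + t • (chart b U).op : Op H)
        = algebraMap ℝ (Op H) (-t) * (algebraMap ℝ (Op H) (-t⁻¹) - (chart b U).op) := by
      rw [mul_sub, ← map_mul, neg_mul_neg, mul_inv_cancel₀ ht0.ne', map_one, map_neg,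
        neg_mul, sub_neg_eq_add, Algebra.smul_def]
    rw [h1]
    exact ((IsUnit.mk0 (-t) (by simpa using ht0.ne')).map (algebraMap ℝ (Op H))).mul h

theorem lorentz_eq_zero_of_eigen {A : (Op H)ˣ} (hA : A ∈ lorentzO H) {x y : Sp H}
    (hx : (A : Op H) x = x) (hy : (A : Op H) y = -y) : lorentz x y = 0 := by
  have := hA x y
  rw [hx, hy, lorentz_neg_right] at this
  linarith

theorem coe_mul_apply (U V : GLHS b) (x : Sp H) :
    (((U * V : GLHS b) : (Op H)ˣ) : Op H) x
      = ((U : (Op H)ˣ) : Op H) (((V : (Op H)ˣ) : Op H) x) := rfl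

/-- An operator that is skew for the Lorentz form and kills `v`, `w` commutes with the
infinitesimal rotation in their plane. -/
theorem commute_rotGen {X : LHS b} (hX : X ∈ skewHS b) {v w : Sp H} (hv : X.op v = 0)
    (hw : X.op w = 0) : Commute (rotGen b v w).op X.op := by
  rw [mem_skewHS'] at hX
  have h1 : ∀ x, lorentz v (X.op x) = 0 := fun x => by
    have := hX v x
    rw [hv, lorentz_zero_left] at this
    linarith
  have h2 : ∀ x, lorentz w (X.op x) = 0 := fun x => by
    have := hX w x
    rw [hw, lorentz_zero_left] at this
    linarith
  ext1 x
  change (rotGen b v w).op (X.op x) = X.op ((rotGen b v w).op x)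
  simp [op_rotGen, h1, h2, hv, hw]

/-- Every element of `SO(H,1) ∩ GL_HS` is the exponential of a Lorentz skew operator, up to one
reflection. The logarithm integral applies when `-1` is not an eigenvalue; otherwise
eigenvectors for `-1` are split off, two reflections at a time combining to a rotation. -/
theorem exists_Exp_or_reflU {U : GLHS b} (hU : (U : (Op H)ˣ) ∈ lorentzSO H) :
    (∃ X ∈ skewHS b, Exp b X = U ∧ ∀ x, ((U : (Op H)ˣ) : Op H) x = x → X.op x = 0) ∨
    (∃ (v : Sp H) (hv : lorentz v v = 1), ∃ X ∈ skewHS b, U = reflU b v hv * Exp b X ∧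
      ((U : (Op H)ˣ) : Op H) v = -v ∧ X.op v = 0 ∧
      ∀ x, ((U : (Op H)ˣ) : Op H) x = x → X.op x = 0) := by
  induction hn : Module.finrank ℝ (negEigen U) using Nat.strong_induction_on generalizing U with
  | _ n ih =>
  by_cases hE : negEigen U = ⊥
  · exact Or.inl (exists_log hU.1 fun t ht => isUnit_of_negEigen_eq_bot hU hE ht)
  obtain ⟨v₀, hv₀, hv₀0⟩ := Submodule.exists_mem_ne_zero_of_ne_bot hE
  have hpos := (spacelike_of_neg_eigenvector b hU hv₀0 one_pos
    (by rw [one_smul]; exact mem_negEigen.1 hv₀)).1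
  obtain ⟨v, hvE, hv⟩ : ∃ v ∈ negEigen U, lorentz v v = 1 := by
    refine ⟨(Real.sqrt (lorentz v₀ v₀))⁻¹ • v₀, Submodule.smul_mem _ _ hv₀, ?_⟩
    rw [lorentz_smul_left, lorentz_smul_right, ← mul_assoc, ← mul_inv, Real.mul_self_sqrt hpos.le,
      inv_mul_cancel₀ hpos.ne']
  have hUv := mem_negEigen.1 hvE
  have hreflv : reflOp b v v = -v := by rw [reflOp_apply, hv]; module
  -- splitting off the reflection in `v`
  set U₁ : GLHS b := reflU b v hv * U with hU₁
  have hU₁SO : (U₁ : (Op H)ˣ) ∈ lorentzSO H := mul_mem_lorentzSO (reflU_mem_lorentzSO hv) hU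
  have hUU₁ : U = reflU b v hv * U₁ := (reflU_mul_reflU_mul hv U).symm
  have hU₁app : ∀ x, ((U₁ : (Op H)ˣ) : Op H) x = reflOp b v (((U : (Op H)ˣ) : Op H) x) :=
    fun x => rfl
  have hUapp : ∀ x, ((U : (Op H)ˣ) : Op H) x = reflOp b v (((U₁ : (Op H)ˣ) : Op H) x) :=
    fun x => by
      conv_lhs => rw [hUU₁]
      rfl
  have hU₁v : ((U₁ : (Op H)ˣ) : Op H) v = v := by rw [hU₁app, hUv, map_neg, hreflv, neg_neg]
  have hperp : ∀ x, lorentz v x = 0 → reflOp b v x = x := fun x hx => by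
    rw [reflOp_apply, hx]; simp
  have hle : ∀ x ∈ negEigen U₁, lorentz v x = 0 ∧ x ∈ negEigen U := fun x hx => by
    have hx' := mem_negEigen.1 hx
    have h0 := lorentz_eq_zero_of_eigen hU₁SO.1 hU₁v hx'
    exact ⟨h0, mem_negEigen.2 (by rw [hUapp, hx', map_neg, hperp x h0])⟩
  have hlt : Module.finrank ℝ (negEigen U₁) < n := by
    rw [← hn]
    refine Submodule.finrank_lt_finrank_of_lt (lt_of_le_of_ne (fun x hx => (hle x hx).2) ?_)
    intro heq
    rw [← heq] at hvE
    have := (hle v hvE).1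
    rw [hv] at this
    exact one_ne_zero this
  have hfix : ∀ x, ((U : (Op H)ˣ) : Op H) x = x →
      lorentz v x = 0 ∧ ((U₁ : (Op H)ˣ) : Op H) x = x := fun x hx => by
    have h0 : lorentz v x = 0 := by
      rw [lorentz_comm]
      exact lorentz_eq_zero_of_eigen hU.1 hx hUv
    exact ⟨h0, by rw [hU₁app, hx, hperp x h0]⟩
  rcases ih _ hlt hU₁SO rfl with ⟨X, hX, hXU, hX0⟩ | ⟨w, hw, X, hX, hXU, hUw, hXw, hX0⟩
  · right
    exact ⟨v, hv, X, hX, by rw [hXU]; exact hUU₁, hUv, hX0 v hU₁v, fun x hx => hX0 x (hfix x hx).2⟩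
  · left
    have hvw : lorentz v w = 0 := lorentz_eq_zero_of_eigen hU₁SO.1 hU₁v hUw
    have hXv := hX0 v hU₁v
    refine ⟨Real.pi • rotGen b v w + X, add_mem (Submodule.smul_mem _ _ (rotGen_mem_skewHS v w)) hX,
      ?_, fun x hx => ?_⟩
    · have hcomm : Commute (Real.pi • rotGen b v w).op X.op := by
        rw [LHS.op_smul]
        exact (commute_rotGen hX hXv hXw).smul_left _
      rw [Exp_add_of_commute hcomm, Exp_rotGen hv hw hvw, mul_assoc, ← hXU, ← hUU₁]
    · obtain ⟨h0, h1⟩ := hfix x hx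
      have h2 : lorentz w x = 0 := by
        rw [lorentz_comm]
        exact lorentz_eq_zero_of_eigen hU₁SO.1 h1 hUw
      rw [LHS.op_add, LHS.op_smul, add_apply, smul_apply, op_rotGen, h0, h2, hX0 x h1]
      simp

/-! ### The exponential image as a group -/

theorem lorentz_e_one_left (v : Sp H) : lorentz (e b 1) v = inner ℝ (e b 1) v := by
  rw [lorentz_e_left]; simp [sgn]

theorem lorentz_e_one : lorentz (e b 1) (e b 1) = 1 := by
  rw [lorentz_e_one_left, inner_e, if_pos rfl]

theorem truncDet_reflOp_e_one {n : ℕ} (hn : 2 ≤ n) : truncDet b n (reflOp b (e b 1)) = -1 := by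
  have h : (Matrix.of fun i j : Fin n => (inner ℝ (e b i) (reflOp b (e b 1) (e b j)) : ℝ))
      = Matrix.diagonal fun i : Fin n => if i = ⟨1, by omega⟩ then (-1 : ℝ) else 1 := by
    ext i j
    simp only [Matrix.of_apply, Matrix.diagonal_apply, reflOp_apply, lorentz_e_one_left,
      inner_sub_right, inner_smul_right, inner_e, Fin.ext_iff]
    split_ifs <;> first | omega | norm_num
  rw [truncDet, h, Matrix.det_diagonal, Finset.prod_ite_eq']
  simp

variable (b) in
/-- The reflection in the basis vector `e_1`. -/
def refl₀ : GLHS b := reflU b (e b 1) lorentz_e_one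

theorem not_posDet_refl₀ : ¬ PosDet (chart b (refl₀ b)) := by
  intro h
  obtain ⟨n, hn, hn2⟩ := (h.and (eventually_ge_atTop 2)).exists
  rw [← coe_eq_one_add] at hn
  have h2 : truncDet b n (((refl₀ b : GLHS b) : (Op H)ˣ) : Op H) = -1 := truncDet_reflOp_e_one hn2
  rw [h2] at hn
  linarith

theorem exists_orthogonal_spacelike (b : HilbertBasis ℕ ℝ H) (v : Sp H) :
    ∃ w, lorentz w w = 1 ∧ lorentz (e b 1) w = 0 ∧ lorentz w v = 0 := by
  have hb := orthonormal_iff_ite.1 b.orthonormal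
  set p : ℝ := inner ℝ (b 1) v.snd with hp
  set q : ℝ := inner ℝ (b 2) v.snd with hq
  obtain ⟨c, d, hcd, hpq⟩ : ∃ c d : ℝ, c ^ 2 + d ^ 2 = 1 ∧ c * p + d * q = 0 := by
    by_cases h : p ^ 2 + q ^ 2 = 0
    · exact ⟨1, 0, by norm_num, by nlinarith⟩
    · have h0 : 0 < p ^ 2 + q ^ 2 := lt_of_le_of_ne (by positivity) (Ne.symm h)
      refine ⟨q / √(p ^ 2 + q ^ 2), -p / √(p ^ 2 + q ^ 2), ?_, by ring⟩
      rw [div_pow, div_pow, Real.sq_sqrt h0.le]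
      field_simp
      ring
  refine ⟨vec 0 (c • b 1 + d • b 2), ?_, ?_, ?_⟩
  · simp only [lorentz, snd_vec, fst_vec, inner_add_left, inner_add_right, real_inner_smul_left,
      real_inner_smul_right, hb]
    norm_num
    linarith
  · simp [lorentz, e, inner_add_right, inner_smul_right, hb]
  · simp [lorentz, inner_add_left, inner_smul_left, ← hp, ← hq]
    exact hpq

/-- Any reflection is the product of a fixed one and of two exponentials. -/
theorem reflU_eq {v : Sp H} (hv : lorentz v v = 1) : ∃ X ∈ skewHS b, ∃ Y ∈ skewHS b,
    reflU b v hv = refl₀ b * Exp b X * Exp b Y := by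
  obtain ⟨w, hw, h1, h2⟩ := exists_orthogonal_spacelike b v
  refine ⟨Real.pi • rotGen b (e b 1) w, Submodule.smul_mem _ _ (rotGen_mem_skewHS _ _),
    Real.pi • rotGen b w v, Submodule.smul_mem _ _ (rotGen_mem_skewHS _ _), ?_⟩
  rw [Exp_rotGen lorentz_e_one hw h1, Exp_rotGen hw hv h2, refl₀, reflU_mul_reflU_mul, ← mul_assoc,
    reflU_mul_self, one_mul]

theorem not_posDet_reflU_mul_Exp {v : Sp H} (hv : lorentz v v = 1) (X : LHS b) :
    ¬ PosDet (chart b (reflU b v hv * Exp b X)) := by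
  obtain ⟨Y, -, Z, -, h⟩ := reflU_eq (b := b) hv
  rw [h, posDet_mul_Exp_iff, posDet_mul_Exp_iff, posDet_mul_Exp_iff]
  exact not_posDet_refl₀

/-- A connected family of Lorentz operators that contains the identity lies in `SO(H,1)`. -/
theorem mem_lorentzSO_of_isPreconnected {T : Type*} [TopologicalSpace T] {s : Set T}
    (hs : IsPreconnected s) {γ : T → (Op H)ˣ} (hγ : ContinuousOn (fun t => (γ t : Op H)) s)
    (hO : ∀ t ∈ s, γ t ∈ lorentzO H) {t₀ : T} (ht₀ : t₀ ∈ s) (h₀ : γ t₀ = 1) {t : T}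
    (ht : t ∈ s) : γ t ∈ lorentzSO H := by
  refine mem_lorentzSO_of_fst_pos (hO t ht) fun z hz => ?_
  refine pos_of_isPreconnected hs (f := fun t => ((γ t : Op H) z).fst) ?_ (fun r hr => ?_) ht₀ ht ?_
  · exact continuous_fst.comp_continuousOn (hγ.clm_apply continuousOn_const)
  · refine fst_ne_zero_of_lorentz_nonpos (by rw [hO r hr, hz.1])
      (map_ne_zero_of_unit _ (ne_zero_of_mem_coneP hz))
  · rw [h₀]; exact hz.2

/-- A family of Lorentz operators that contains the identity and is connected for the
Hilbert-Schmidt norm consists of exponentials. -/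
theorem exists_Exp_of_isPreconnected {T : Type*} [TopologicalSpace T] {s : Set T}
    (hs : IsPreconnected s) {γ : T → (Op H)ˣ} {c : T → LHS b} (hc : ContinuousOn c s)
    (hcγ : ∀ t ∈ s, (γ t : Op H) = 1 + (c t).op) (hO : ∀ t ∈ s, γ t ∈ lorentzO H) {t₀ : T}
    (ht₀ : t₀ ∈ s) (h₀ : γ t₀ = 1) {t : T} (ht : t ∈ s) :
    ∃ X ∈ skewHS b, ((Exp b X : GLHS b) : (Op H)ˣ) = γ t := by
  have hSO : γ t ∈ lorentzSO H := mem_lorentzSO_of_isPreconnected hs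
    ((continuous_one_add_op.comp_continuousOn hc).congr hcγ) hO ht₀ h₀ ht
  have hG : γ t ∈ GLHS b := by
    change (γ t : Op H) - 1 ∈ hsSubmodule b
    rw [hcγ t ht, add_sub_cancel_left]
    exact LHS.summable_sq _
  have hchart : chart b ⟨γ t, hG⟩ = c t := by
    ext1
    rw [op_chart, hcγ t ht, add_sub_cancel_left]
  have hc0 : c t₀ = 0 := by
    ext1
    have := hcγ t₀ ht₀
    rw [h₀, Units.val_one] at this
    exact left_eq_add.1 this
  have hpos : PosDet (c t) := by
    refine posDet_of_isPreconnected (hs.image c hc) ?_ (mem_image_of_mem c ht₀)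
      (mem_image_of_mem c ht) (by rw [hc0]; exact posDet_zero)
    rintro _ ⟨r, hr, rfl⟩
    rw [← hcγ r hr]
    exact (γ r).isUnit
  rcases exists_Exp_or_reflU (U := (⟨γ t, hG⟩ : GLHS b)) hSO with
    ⟨X, hX, hXU, -⟩ | ⟨v, hv, X, -, hXU, -⟩
  · exact ⟨X, hX, by rw [hXU]⟩
  · rw [← hchart, hXU] at hpos
    exact absurd hpos (not_posDet_reflU_mul_Exp hv X)

theorem Exp_mem_lorentzSO {X : LHS b} (hX : X ∈ skewHS b) :
    ((Exp b X : GLHS b) : (Op H)ˣ) ∈ lorentzSO H := by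
  have hc : Continuous fun t : ℝ => chart b (Exp b (t • X)) :=
    continuous_chart_Exp.comp (continuous_id.smul continuous_const)
  have := mem_lorentzSO_of_isPreconnected (γ := fun t : ℝ => ((Exp b (t • X) : GLHS b) : (Op H)ˣ))
    isPreconnected_univ ((continuous_one_add_op.comp hc).continuousOn.congr
      fun t _ => coe_eq_one_add _)
    (fun t _ => Exp_mem_lorentzO (Submodule.smul_mem _ t hX)) (mem_univ 0)
    (by simp [Exp_zero]) (mem_univ 1)
  simpa using this

/-- The exponentials are the elements of `SO(H,1) ∩ GL_HS` with positive determinant. -/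
theorem exists_Exp_iff (U : GLHS b) : (∃ X ∈ skewHS b, Exp b X = U) ↔
    (U : (Op H)ˣ) ∈ lorentzSO H ∧ PosDet (chart b U) := by
  constructor
  · rintro ⟨X, hX, rfl⟩
    refine ⟨Exp_mem_lorentzSO hX, ?_⟩
    rw [← one_mul (Exp b X), posDet_mul_Exp_iff, chart_one]
    exact posDet_zero
  · rintro ⟨hSO, hpos⟩
    rcases exists_Exp_or_reflU hSO with ⟨X, hX, hXU, -⟩ | ⟨v, hv, X, -, hXU, -⟩
    · exact ⟨X, hX, hXU⟩
    · rw [hXU] at hpos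
      exact absurd hpos (not_posDet_reflU_mul_Exp hv X)

variable (b) in
/-- The exponentials of the Lorentz skew Hilbert-Schmidt operators form a group. -/
def expGroup : Subgroup (GLHS b) where
  carrier := {U | ∃ X ∈ skewHS b, Exp b X = U}
  one_mem' := ⟨0, zero_mem _, Exp_zero⟩
  mul_mem' := fun {U V} hU hV => by
    obtain ⟨Y, hY, rfl⟩ := hV
    have hU' := (exists_Exp_iff U).1 hU
    exact (exists_Exp_iff _).2 ⟨mul_mem_lorentzSO hU'.1 (Exp_mem_lorentzSO hY),
      (posDet_mul_Exp_iff _ _).2 hU'.2⟩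
  inv_mem' := fun {U} hU => by
    obtain ⟨X, hX, rfl⟩ := hU
    exact ⟨-X, neg_mem hX, Exp_neg X⟩

theorem mem_expGroup {U : GLHS b} : U ∈ expGroup b ↔ ∃ X ∈ skewHS b, Exp b X = U := Iff.rfl

theorem mem_expGroup_iff {U : GLHS b} :
    U ∈ expGroup b ↔ (U : (Op H)ˣ) ∈ lorentzSO H ∧ PosDet (chart b U) := exists_Exp_iff U

theorem Exp_mem_expGroup {X : LHS b} (hX : X ∈ skewHS b) : Exp b X ∈ expGroup b := ⟨X, hX, rfl⟩

/-- The elements of `SO(H,1) ∩ GL_HS` that are not exponentials form the other coset. -/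
theorem refl₀_mul_mem_expGroup {U : GLHS b} (hU : (U : (Op H)ˣ) ∈ lorentzSO H)
    (hU' : U ∉ expGroup b) : refl₀ b * U ∈ expGroup b := by
  rcases exists_Exp_or_reflU hU with ⟨X, hX, hXU, -⟩ | ⟨v, hv, X, hX, hXU, -⟩
  · exact absurd ⟨X, hX, hXU⟩ hU'
  · obtain ⟨Y, hY, Z, hZ, h⟩ := reflU_eq (b := b) hv
    rw [hXU, h, mul_assoc, mul_assoc, refl₀, reflU_mul_reflU_mul]
    exact mul_mem (Exp_mem_expGroup hY) (mul_mem (Exp_mem_expGroup hZ) (Exp_mem_expGroup hX))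

/-! ### The Cameron-Martin group and its distance -/

section Paths

open MeasureTheory

/-- A `C¹` piece of a path: it is a curve for the Hilbert-Schmidt norm, whose increments are
bounded by the length, and `γ γ^†` is constant along it. -/
theorem exists_piece {γ : ℝ → (Op H)ˣ} {w : ℝ → LHS b} {a c : ℝ} (hac : a ≤ c)
    (hw : ContinuousOn w (Icc a c)) (hskew : ∀ s ∈ Icc a c, w s ∈ skewHS b)
    (hγ : ∀ s ∈ Icc a c, HasDerivWithinAt (fun r => (γ r : Op H)) ((γ s : Op H) * (w s).op)
      (Icc a c) s) :
    ∃ k : ℝ → LHS b, k a = 0 ∧ Continuous k ∧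
      (∀ s ∈ Icc a c, (γ s : Op H) = (γ a : Op H) + (k s).op) ∧
      (∀ M : ℝ, (∀ s ∈ Icc a c, ‖(γ s : Op H)‖ ≤ M) → ∀ s ∈ Icc a c,
        ‖k s‖ₑ ≤ ENNReal.ofReal M * ∫⁻ r in Ico a s, ‖w r‖ₑ) ∧
      ∀ s ∈ Icc a c, (γ s : Op H) * dag (γ s : Op H) = (γ a : Op H) * dag (γ a : Op H) := by
  rcases hac.eq_or_lt with rfl | hac'
  · refine ⟨fun _ => 0, rfl, continuous_const, fun s hs => ?_, fun M _ s _ => by simp,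
      fun s hs => ?_⟩ <;> obtain rfl : s = a := le_antisymm hs.2 hs.1
    · simp [LHS.op_zero]
    · rfl
  have huniq := uniqueDiffOn_Icc hac'
  have hγc : ContinuousOn (fun r => (γ r : Op H)) (Icc a c) :=
    fun s hs => (hγ s hs).continuousWithinAt
  -- the projection to `[a, c]` extends the integrand continuously to the real line
  let p : ℝ → ℝ := fun r => max a (min c r)
  have hp : Continuous p := by fun_prop
  have hpm : ∀ r, p r ∈ Icc a c := fun r => ⟨le_max_left _ _, max_le hac (min_le_left _ _)⟩
  have hpe : ∀ r ∈ Icc a c, p r = r := fun r hr => by simp [p, hr.1, hr.2]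
  let g : ℝ → LHS b := fun r => LHS.lmul b (γ (p r) : Op H) (w (p r))
  have hg : Continuous g := by
    have h1 : Continuous fun r => (γ (p r) : Op H) :=
      hγc.comp_continuous hp hpm
    have h2 : Continuous fun r => w (p r) := hw.comp_continuous hp hpm
    exact ((LHS.lmul b).continuous.comp h1).clm_apply h2
  let k : ℝ → LHS b := fun s => ∫ r in a..s, g r
  have hk : ∀ s, HasDerivAt k (g s) s := fun s => (hg.integral_hasStrictDerivAt a s).hasDerivAt
  have hk0 : k a = 0 := intervalIntegral.integral_same
  refine ⟨k, hk0, continuous_iff_continuousAt.2 fun s => (hk s).continuousAt, fun s hs => ?_,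
    fun M hM s hs => ?_, fun s hs => ?_⟩
  · have hd : ∀ s ∈ Icc a c, HasDerivWithinAt (fun r => (γ r : Op H) - (k r).op) 0 (Icc a c) s :=
      fun s hs => by
        have h1 : HasDerivAt (fun r => (k r).op) ((g s).op) s :=
          ((LHS.opL b).hasFDerivAt (x := k s)).comp_hasDerivAt s (hk s)
        have h2 := (hγ s hs).sub h1.hasDerivWithinAt
        have h3 : (g s).op = (γ s : Op H) * (w s).op := by
          simp only [g, hpe s hs]
          rfl
        rwa [h3, sub_self] at h2
    have h1 := constant_of_derivWithin_zero (fun s hs => (hd s hs).differentiableWithinAt)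
      (fun s hs => (hd s ⟨hs.1, hs.2.le⟩).derivWithin (huniq s ⟨hs.1, hs.2.le⟩)) s hs
    rw [hk0, LHS.op_zero, sub_zero] at h1
    rw [← h1]; abel
  · change ‖∫ r in a..s, g r‖ₑ ≤ _
    rw [intervalIntegral.integral_of_le hs.1]
    refine (enorm_integral_le_lintegral_enorm _).trans ?_
    rw [← setLIntegral_congr Ico_ae_eq_Ioc, ← lintegral_const_mul' _ _ ENNReal.ofReal_ne_top]
    refine setLIntegral_mono' measurableSet_Ico fun r hr => ?_
    have hr' : r ∈ Icc a c := ⟨hr.1, hr.2.le.trans hs.2⟩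
    have hM0 : 0 ≤ M := (norm_nonneg _).trans (hM r hr')
    have h1 : ‖g r‖ ≤ M * ‖w r‖ := by
      simp only [g, hpe r hr']
      exact (LHS.norm_mulLeft_le _ _).trans
        (mul_le_mul_of_nonneg_right (hM r hr') (norm_nonneg _))
    rw [← ofReal_norm, ← ofReal_norm, ← ENNReal.ofReal_mul hM0]
    exact ENNReal.ofReal_le_ofReal h1
  · have hd : ∀ s ∈ Icc a c, HasDerivWithinAt (fun r => (γ r : Op H) * dag (γ r : Op H)) 0
        (Icc a c) s := fun s hs => by
      have h1 : HasDerivWithinAt (fun r => dag (γ r : Op H)) (dag ((γ s : Op H) * (w s).op))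
          (Icc a c) s := by
        have h0 : HasFDerivAt (𝕜 := ℝ) (E := Op H) (F := Op H) (fun A => dag A) (dagL H)
            (γ s : Op H) := (dagL H).hasFDerivAt
        exact h0.comp_hasDerivWithinAt s (hγ s hs)
      have h2 := (hγ s hs).mul h1
      convert! h2 using 1
      rw [dag_mul, mem_skewHS.1 (hskew s hs)]
      noncomm_ring
    exact constant_of_derivWithin_zero (fun s hs => (hd s hs).differentiableWithinAt)
      (fun s hs => (hd s ⟨hs.1, hs.2.le⟩).derivWithin (huniq s ⟨hs.1, hs.2.le⟩)) s hs

/-- An admissible path is a curve for the Hilbert-Schmidt norm, whose increments are bounded by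
the length, and `γ γ^†` is constant along it. -/
theorem IsCMPath.exists_curve {γ : ℝ → (Op H)ˣ} {v : ℝ → LHS b} (h : IsCMPath b (gInf b) γ v) :
    ∃ k : ℝ → LHS b, ContinuousOn k (Icc 0 1) ∧
      (∀ s ∈ Icc (0 : ℝ) 1, (γ s : Op H) = (γ 0 : Op H) + (k s).op) ∧
      (∀ M : ℝ, (∀ s ∈ Icc (0 : ℝ) 1, ‖(γ s : Op H)‖ ≤ M) → ∀ s ∈ Icc (0 : ℝ) 1,
        ‖k s‖ₑ ≤ ENNReal.ofReal M * ∫⁻ r in Ico 0 s, ‖v r‖ₑ) ∧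
      ∀ s ∈ Icc (0 : ℝ) 1, (γ s : Op H) * dag (γ s : Op H) = (γ 0 : Op H) * dag (γ 0 : Op H) := by
  obtain ⟨N, t, ht0, htN, htlt, hpiece⟩ := h
  have key : ∀ i ≤ N, 0 ≤ t i ∧ ∃ k : ℝ → LHS b, ContinuousOn k (Icc 0 (t i)) ∧
      (∀ s ∈ Icc 0 (t i), (γ s : Op H) = (γ 0 : Op H) + (k s).op) ∧
      (∀ M : ℝ, (∀ s ∈ Icc 0 (t i), ‖(γ s : Op H)‖ ≤ M) → ∀ s ∈ Icc 0 (t i),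
        ‖k s‖ₑ ≤ ENNReal.ofReal M * ∫⁻ r in Ico 0 s, ‖v r‖ₑ) ∧
      ∀ s ∈ Icc 0 (t i), (γ s : Op H) * dag (γ s : Op H) = (γ 0 : Op H) * dag (γ 0 : Op H) := by
    intro i
    induction i with
    | zero =>
      intro _
      rw [ht0]
      refine ⟨le_rfl, fun _ => 0, continuousOn_const, fun s hs => ?_, fun M _ s _ => by simp,
        fun s hs => ?_⟩ <;> obtain rfl : s = 0 := le_antisymm hs.2 hs.1
      · simp [LHS.op_zero]
      · rfl
    | succ i ih =>
      intro hi
      obtain ⟨hti, k, hkc, hkγ, hkM, hkd⟩ := ih (by omega)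
      have hlt := htlt i (by omega)
      obtain ⟨w, hwc, hw⟩ := hpiece i (by omega)
      obtain ⟨κ, hκ0, hκc, hκγ, hκM, hκd⟩ := exists_piece hlt.le hwc
        (fun s hs => by rw [← gInf_eq]; exact (hw s hs).1) (fun s hs => (hw s hs).2.1)
      have hun : Icc 0 (t (i + 1)) = Icc 0 (t i) ∪ Icc (t i) (t (i + 1)) :=
        (Icc_union_Icc_eq_Icc hti hlt.le).symm
      have hmem : t i ∈ Icc 0 (t i) := ⟨hti, le_rfl⟩
      let k' : ℝ → LHS b := fun s => if s ≤ t i then k s else k (t i) + κ s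
      have e1 : EqOn k' k (Icc 0 (t i)) := fun s hs => if_pos hs.2
      have e2 : EqOn k' (fun s => k (t i) + κ s) (Icc (t i) (t (i + 1))) := fun s hs => by
        rcases hs.1.eq_or_lt with rfl | hlt'
        · simp [k', hκ0]
        · exact if_neg (not_le.2 hlt')
      refine ⟨hti.trans hlt.le, k', ?_, fun s hs => ?_, fun M hM s hs => ?_, fun s hs => ?_⟩
      · rw [hun]
        exact (hkc.congr e1).union_of_isClosed
          ((continuous_const.add hκc).continuousOn.congr e2) isClosed_Icc isClosed_Icc
      · rw [hun] at hs
        rcases hs with hs | hs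
        · rw [e1 hs, hkγ s hs]
        · rw [e2 hs, LHS.op_add, hκγ s hs, hkγ _ hmem, add_assoc]
      · rw [hun] at hs hM
        rcases hs with hs | hs
        · rw [e1 hs]
          exact hkM M (fun r hr => hM r (Or.inl hr)) s hs
        · rw [e2 hs]
          refine (enorm_add_le _ _).trans ?_
          have h1 := hkM M (fun r hr => hM r (Or.inl hr)) _ hmem
          have h2 := hκM M (fun r hr => hM r (Or.inr hr)) s hs
          have h3 : ∫⁻ r in Ico (t i) s, ‖w r‖ₑ = ∫⁻ r in Ico (t i) s, ‖v r‖ₑ :=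
            setLIntegral_congr_fun measurableSet_Ico fun r hr => by
              rw [(hw r ⟨hr.1, hr.2.le.trans hs.2⟩).2.2 (hr.2.trans_le hs.2)]
          rw [← Ico_union_Ico_eq_Ico hti hs.1, lintegral_union measurableSet_Ico
            (Ico_disjoint_Ico_same), mul_add]
          rw [h3] at h2
          exact add_le_add h1 h2
      · rw [hun] at hs
        rcases hs with hs | hs
        · exact hkd s hs
        · rw [hκd s hs, hkd _ hmem]
  have := (key N le_rfl).2
  rwa [htN] at this

theorem isCMPath_mul_expU (A : (Op H)ˣ) {X : LHS b} (hX : X ∈ skewHS b) :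
    IsCMPath b (gInf b) (fun s => A * expU (s • X.op)) fun _ => X := by
  refine ⟨1, fun i => i, by simp, by simp, fun i _ => by simp, fun i _ => ⟨fun _ => X,
    continuousOn_const, fun s _ => ⟨by rwa [gInf_eq], ?_, fun _ => rfl⟩⟩⟩
  have h1 := (hasDerivAt_exp_smul_const X.op s).const_mul (A : Op H)
  rw [← mul_assoc] at h1
  exact h1.hasDerivWithinAt

theorem expU_zero : expU (0 : Op H) = 1 := Units.ext (NormedSpace.exp_zero)

theorem cmDist_mul_Exp_le (A : (Op H)ˣ) {X : LHS b} (hX : X ∈ skewHS b) :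
    cmDist b (gInf b) A (A * (Exp b X : (Op H)ˣ)) ≤ ‖X‖ₑ := by
  refine (iInf₂_le_of_le (fun s => A * expU (s • X.op)) (fun _ => X)
    (iInf₂_le_of_le (isCMPath_mul_expU A hX) ⟨by simp [expU_zero], by simp; rfl⟩ le_rfl)).trans ?_
  simp

theorem cmDist_mul_Exp_le' (A : (Op H)ˣ) {X : LHS b} (hX : X ∈ skewHS b) :
    cmDist b (gInf b) (A * (Exp b X : (Op H)ˣ)) A ≤ ‖X‖ₑ := by
  have h := cmDist_mul_Exp_le (A * (Exp b X : (Op H)ˣ)) (neg_mem hX)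
  rwa [Exp_neg, InvMemClass.coe_inv, mul_inv_cancel_right, enorm_neg] at h

theorem exists_path_of_cmDist_lt {A B : (Op H)ˣ} {r : ℝ≥0∞} (h : cmDist b (gInf b) A B < r) :
    ∃ (γ : ℝ → (Op H)ˣ) (v : ℝ → LHS b), IsCMPath b (gInf b) γ v ∧ γ 0 = A ∧ γ 1 = B ∧
      ∫⁻ s in Icc (0 : ℝ) 1, ‖v s‖ₑ < r := by
  simp only [cmDist, iInf_lt_iff] at h
  obtain ⟨γ, v, hγ, ⟨h0, h1⟩, hr⟩ := h
  exact ⟨γ, v, hγ, h0, h1, hr⟩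

/-- The Cameron-Martin group consists of exponentials: an admissible path that ends at the identity
is a connected family of Lorentz operators. -/
theorem mem_cmGroup_iff {A : (Op H)ˣ} :
    A ∈ cmGroup b (gInf b) ↔ ∃ X ∈ skewHS b, (Exp b X : (Op H)ˣ) = A := by
  constructor
  · intro h
    obtain ⟨γ, v, hγ, h0, h1, -⟩ := exists_path_of_cmDist_lt h
    obtain ⟨k, hkc, hkγ, -, hkd⟩ := hγ.exists_curve
    have hone : (1 : ℝ) ∈ Icc (0 : ℝ) 1 := right_mem_Icc.2 zero_le_one
    have hzero : (0 : ℝ) ∈ Icc (0 : ℝ) 1 := left_mem_Icc.2 zero_le_one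
    have hcγ : ∀ s ∈ Icc (0 : ℝ) 1, (γ s : Op H) = 1 + (k s - k 1).op := fun s hs => by
      have e1 := hkγ 1 hone
      rw [h1, Units.val_one] at e1
      rw [LHS.op_sub, hkγ s hs, e1]
      abel
    have hO : ∀ s ∈ Icc (0 : ℝ) 1, γ s ∈ lorentzO H := fun s hs => by
      have e1 : (γ s : Op H) * dag (γ s : Op H) = 1 := by
        rw [hkd s hs, ← hkd 1 hone, h1]; simp
      rw [mem_lorentzO_iff, ← Units.inv_eq_of_mul_eq_one_right e1, Units.inv_mul]
    rw [← h0]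
    exact exists_Exp_of_isPreconnected isPreconnected_Icc (hkc.sub continuousOn_const) hcγ hO
      hone h1 hzero
  · rintro ⟨X, hX, rfl⟩
    have := cmDist_mul_Exp_le' (1 : (Op H)ˣ) hX
    rw [one_mul] at this
    exact this.trans_lt enorm_lt_top

theorem coe_mem_cmGroup_iff {U : GLHS b} : (U : (Op H)ˣ) ∈ cmGroup b (gInf b) ↔ U ∈ expGroup b := by
  rw [mem_cmGroup_iff, mem_expGroup]
  simp only [Subtype.coe_inj]

end Paths

/-! ### The topology and the Lie group structure of the Cameron-Martin group -/

theorem chart_mem_inChart {G : Set (Op H)ˣ} {U : GLHS b} :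
    chart b U ∈ inChart b G ↔ (U : (Op H)ˣ) ∈ G := by
  constructor
  · rintro ⟨V, hV, h⟩
    rwa [← chart_injective h]
  · exact fun h => ⟨U, h, rfl⟩

/-- A short path ends close to its origin for the Hilbert-Schmidt norm. A path of length
`r ≤ 1/4` with maximal operator norm `M` moves by at most `M r`, hence `M ≤ ‖A‖ + 2 M r`, which
gives `M ≤ 2 ‖A‖`. -/
theorem norm_chart_sub_le {A B : GLHS b} {r : ℝ} (hr : r ≤ 1 / 4)
    (h : cmDist b (gInf b) (B : (Op H)ˣ) A < ENNReal.ofReal r) :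
    ‖chart b B - chart b A‖ ≤ 2 * ‖((A : (Op H)ˣ) : Op H)‖ * r := by
  have hr0 : 0 < r := by
    by_contra h0
    rw [ENNReal.ofReal_of_nonpos (not_lt.1 h0)] at h
    exact not_lt_zero h
  obtain ⟨γ, v, hγ, h0, h1, hlen⟩ := exists_path_of_cmDist_lt h
  obtain ⟨k, hkc, hkγ, hkM, -⟩ := hγ.exists_curve
  have hone : (1 : ℝ) ∈ Icc (0 : ℝ) 1 := right_mem_Icc.2 zero_le_one
  have hγc : ContinuousOn (fun s => ‖(γ s : Op H)‖) (Icc 0 1) := by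
    have hc : ContinuousOn (fun s => (γ 0 : Op H) + (k s).op) (Icc 0 1) :=
      continuousOn_const.add ((LHS.opL b).continuous.comp_continuousOn hkc)
    exact (hc.congr fun s hs => hkγ s hs).norm
  obtain ⟨s₀, hs₀, hmax⟩ := isCompact_Icc.exists_isMaxOn ⟨1, hone⟩ hγc
  have hk : ∀ s ∈ Icc (0 : ℝ) 1, ‖k s‖ ≤ ‖(γ s₀ : Op H)‖ * r := fun s hs => by
    have e1 := hkM _ (fun s hs => hmax hs) s hs
    have e2 : ∫⁻ r in Ico 0 s, ‖v r‖ₑ ≤ ENNReal.ofReal r :=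
      (MeasureTheory.lintegral_mono_set
        (Ico_subset_Icc_self.trans (Icc_subset_Icc_right hs.2))).trans hlen.le
    have e3 := e1.trans (mul_le_mul_right e2 _)
    rw [← ENNReal.ofReal_mul (norm_nonneg _), ← ofReal_norm] at e3
    exact (ENNReal.ofReal_le_ofReal_iff (by positivity)).1 e3
  have hA : ((A : (Op H)ˣ) : Op H) = (γ 0 : Op H) + (k 1).op := by rw [← h1, hkγ 1 hone]
  have hM : ‖(γ s₀ : Op H)‖ ≤ 2 * ‖((A : (Op H)ˣ) : Op H)‖ := by
    have e1 : (γ s₀ : Op H) = ((A : (Op H)ˣ) : Op H) - (k 1).op + (k s₀).op := by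
      rw [hA, hkγ s₀ hs₀]; abel
    have e2 : ‖(γ s₀ : Op H)‖ ≤ ‖((A : (Op H)ˣ) : Op H)‖ + ‖(k 1).op‖ + ‖(k s₀).op‖ := by
      conv_lhs => rw [e1]
      exact (norm_add_le _ _).trans (add_le_add_left (norm_sub_le _ _) _)
    have e3 := (LHS.norm_op_le (k 1)).trans (hk 1 hone)
    have e4 := (LHS.norm_op_le (k s₀)).trans (hk s₀ hs₀)
    nlinarith [norm_nonneg (γ s₀ : Op H)]
  have e : chart b B - chart b A = -k 1 := by
    apply LHS.op_injective
    rw [LHS.op_sub, LHS.op_neg, op_chart, op_chart, hA, ← h0]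
    abel
  rw [e, norm_neg]
  exact (hk 1 hone).trans (mul_le_mul_of_nonneg_right hM hr0.le)

/-- Lorentz operators close to the identity have small logarithms. -/
theorem eventually_exists_small_log {ι : Type*} {l : Filter ι} {V : ι → GLHS b}
    (hV : Tendsto (fun k => chart b (V k)) l (𝓝 0)) (hO : ∀ k, (V k : (Op H)ˣ) ∈ lorentzO H)
    {ε : ℝ≥0∞} (hε : 0 < ε) : ∀ᶠ k in l, ∃ X ∈ skewHS b, Exp b X = V k ∧ ‖X‖ₑ < ε := by
  obtain ⟨φ, h0, hφ, -, hlog⟩ := exists_local_log (b := b)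
  have hφ0 : φ 0 = 0 := by rw [hφ, Exp_zero, chart_one]
  have ht : (0 : LHS b) ∈ φ.target := hφ0 ▸ φ.map_source h0
  have hs0 : φ.symm 0 = 0 := by
    conv_lhs => rw [← hφ0]
    exact φ.left_inv h0
  have hc : Tendsto (fun k => ‖φ.symm (chart b (V k))‖ₑ) l (𝓝 0) := by
    have h1 : Tendsto (fun k => φ.symm (chart b (V k))) l (𝓝 (φ.symm 0)) :=
      (φ.continuousAt_symm ht).tendsto.comp hV
    rw [hs0] at h1
    simpa using h1.enorm
  filter_upwards [hV (φ.open_target.mem_nhds ht), hc (Iio_mem_nhds hε)] with k hk1 hk2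
  have e : Exp b (φ.symm (chart b (V k))) = V k := chart_injective (by
    rw [← hφ, φ.right_inv hk1])
  exact ⟨_, hlog _ (φ.map_target hk1) (by rw [e]; exact hO k), e, hk2⟩

theorem mem_lorentzO_of_mem_expGroup {U : GLHS b} (hU : U ∈ expGroup b) :
    (U : (Op H)ˣ) ∈ lorentzO H := (mem_expGroup_iff.1 hU).1.1

theorem tendsto_chart_inv_mul {ι : Type*} {l : Filter ι} (A : GLHS b) {B : ι → GLHS b}
    (h : Tendsto (fun k => chart b (B k)) l (𝓝 (chart b A))) :
    Tendsto (fun k => chart b (A⁻¹ * B k)) l (𝓝 0) := by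
  have h1 := (((continuous_mulLeft (b := b) (((A⁻¹ : GLHS b) : (Op H)ˣ) : Op H)).tendsto _).comp
    h).add_const (chart b A⁻¹)
  rw [← chart_mul, inv_mul_cancel, chart_one] at h1
  exact h1.congr fun k => (chart_mul _ _).symm

theorem eventually_cmDist_lt {ι : Type*} {l : Filter ι} {A : GLHS b} {B : ι → GLHS b}
    (hA : A ∈ expGroup b) (hB : ∀ k, B k ∈ expGroup b)
    (h : Tendsto (fun k => chart b (B k)) l (𝓝 (chart b A))) {ε : ℝ≥0∞} (hε : 0 < ε) :
    ∀ᶠ k in l, cmDist b (gInf b) (A : (Op H)ˣ) (B k) < ε ∧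
      cmDist b (gInf b) (B k : (Op H)ˣ) A < ε := by
  filter_upwards [eventually_exists_small_log (tendsto_chart_inv_mul A h) (fun k =>
    mem_lorentzO_of_mem_expGroup (mul_mem (inv_mem hA) (hB k))) hε] with k ⟨X, hX, he, hlt⟩
  have e : (B k : (Op H)ˣ) = A * (Exp b X : (Op H)ˣ) := by rw [he]; simp
  rw [e]
  exact ⟨(cmDist_mul_Exp_le _ hX).trans_lt hlt, (cmDist_mul_Exp_le' _ hX).trans_lt hlt⟩

theorem tendsto_cmDist_iff {A : GLHS b} {B : ℕ → GLHS b} (hA : (A : (Op H)ˣ) ∈ cmGroup b (gInf b))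
    (hB : ∀ k, (B k : (Op H)ˣ) ∈ cmGroup b (gInf b)) :
    Tendsto (fun k => cmDist b (gInf b) (B k : (Op H)ˣ) A) atTop (𝓝 0) ↔
      Tendsto (fun k => chart b (B k)) atTop (𝓝 (chart b A)) := by
  constructor
  · intro h
    rw [Metric.tendsto_nhds]
    intro ε hε
    have hA0 := norm_nonneg ((A : (Op H)ˣ) : Op H)
    let r : ℝ := min (1 / 4) (ε / (2 * ‖((A : (Op H)ˣ) : Op H)‖ + 1))
    have hr : 0 < r := by positivity
    filter_upwards [h (Iio_mem_nhds (ENNReal.ofReal_pos.2 hr))] with k hk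
    rw [dist_eq_norm]
    refine (norm_chart_sub_le (min_le_left _ _) hk).trans_lt ?_
    have h1 : r * (2 * ‖((A : (Op H)ˣ) : Op H)‖ + 1) ≤ ε :=
      (le_div_iff₀ (by positivity)).1 (min_le_right _ _)
    linarith
  · intro h
    rw [ENNReal.tendsto_nhds_zero]
    intro ε hε
    filter_upwards [eventually_cmDist_lt (coe_mem_cmGroup_iff.1 hA)
      (fun k => coe_mem_cmGroup_iff.1 (hB k)) h hε] with k hk
    exact hk.2.le

theorem cmGroup_le_GLHS {A : (Op H)ˣ} (hA : A ∈ cmGroup b (gInf b)) : A ∈ GLHS b := by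
  obtain ⟨X, -, rfl⟩ := mem_cmGroup_iff.1 hA
  exact (Exp b X).2

/-- Left translation by `A` on the general Hilbert-Schmidt group is affine in the global chart. -/
def translate (A : GLHS b) : LHS b ≃ₜ LHS b where
  toFun Y := LHS.mulLeft ((A : (Op H)ˣ) : Op H) Y + chart b A
  invFun Y := LHS.mulLeft (((A⁻¹ : GLHS b) : (Op H)ˣ) : Op H) Y + chart b A⁻¹
  left_inv Y := by
    apply LHS.op_injective
    simp only [LHS.op_add, LHS.op_mulLeft, op_chart, mul_add, mul_sub, InvMemClass.coe_inv,
      Units.inv_mul_cancel_left, Units.inv_mul, mul_one]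
    abel
  right_inv Y := by
    apply LHS.op_injective
    simp only [LHS.op_add, LHS.op_mulLeft, op_chart, mul_add, mul_sub, InvMemClass.coe_inv,
      Units.mul_inv_cancel_left, Units.mul_inv, mul_one]
    abel
  continuous_toFun := (continuous_mulLeft _).add continuous_const
  continuous_invFun := (continuous_mulLeft _).add continuous_const

theorem translate_chart (A U : GLHS b) : translate A (chart b U) = chart b (A * U) :=
  (chart_mul A U).symm

theorem translate_symm (A : GLHS b) (Y : LHS b) : (translate A).symm Y = translate A⁻¹ Y := rfl

theorem contDiff_translate (A : GLHS b) : ContDiff ℝ ∞ (translate A) :=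
  (LHS.lmul b ((A : (Op H)ˣ) : Op H)).contDiff.add contDiff_const

/-- Around `A` the group is straightened by `Y ↦ log (A⁻¹ Y)`. -/
theorem isLieSubgroup_cmGroup : IsLieSubgroup b (cmGroup b (gInf b)) (gInf b) := by
  refine ⟨⟨(expGroup b).map (GLHS b).subtype, ?_, Subgroup.map_subtype_le _⟩, isClosed_gInf, ?_⟩
  · ext A
    constructor
    · rintro ⟨U, hU, rfl⟩
      exact coe_mem_cmGroup_iff.2 hU
    · exact fun hA => ⟨⟨A, cmGroup_le_GLHS hA⟩, coe_mem_cmGroup_iff.1 hA, rfl⟩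
  · rintro _ ⟨A, hA, rfl⟩
    obtain ⟨φ, h0, hφ, hsm, hlog⟩ := exists_local_log (b := b)
    have hA' : A ∈ expGroup b := coe_mem_cmGroup_iff.1 hA
    have hφ0 : φ 0 = 0 := by rw [hφ, Exp_zero, chart_one]
    let θ := translate (A⁻¹ : GLHS b)
    have hθ : ∀ Y, θ.symm Y = translate A Y := fun Y => by
      simp only [θ, translate_symm, inv_inv]
    refine ⟨θ.toOpenPartialHomeomorph.trans φ.symm, ?_, ?_, ?_, ?_⟩
    · have : θ (chart b A) = 0 := by
        simp only [θ, translate_chart, inv_mul_cancel, chart_one]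
      simp [this, hφ0 ▸ φ.map_source h0]
    · refine hsm.comp (contDiff_translate A⁻¹).contDiffOn fun Y hY => ?_
      simpa using hY
    · have h1 : ContDiff ℝ ∞ fun Y => translate A (φ Y) := by
        simp only [hφ]
        exact (contDiff_translate A).comp contDiff_chart_Exp
      refine h1.contDiffOn.congr fun Y _ => ?_
      exact hθ _
    · intro Y hY
      have hY' : θ Y ∈ φ.target := by simpa using hY
      change _ ↔ φ.symm (θ Y) ∈ gInf b
      have e : Y = chart b (A * Exp b (φ.symm (θ Y))) := by
        rw [← translate_chart, ← hφ, φ.right_inv hY', ← hθ, Homeomorph.symm_apply_apply]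
      conv_lhs => rw [e]
      rw [chart_mem_inChart, coe_mem_cmGroup_iff, Subgroup.mul_mem_cancel_left _ hA', gInf_eq]
      exact ⟨fun h => hlog _ (φ.map_target hY') (mem_lorentzO_of_mem_expGroup h),
        Exp_mem_expGroup⟩

/-- A tangent vector is skew, as one sees by differentiating `γ^† γ = 1`; conversely a skew
operator is the velocity of its one parameter group. -/
theorem lieAlg_cmGroup : lieAlg b (cmGroup b (gInf b)) = gInf b := by
  rw [gInf_eq]
  ext X
  constructor
  · rintro ⟨c, -, hcG, hc0, hcX⟩
    have hO : ∀ r, dag (1 + (c r).op) * (1 + (c r).op) = 1 := fun r => by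
      obtain ⟨U, hU, hUc⟩ := hcG r
      rw [← hUc, ← coe_eq_one_add, ← mem_lorentzO_iff]
      rw [← gInf_eq] at hU
      exact mem_lorentzO_of_mem_expGroup (coe_mem_cmGroup_iff.1 hU)
    have h1 : HasDerivAt (fun r => 1 + (c r).op) X.op 0 :=
      (((LHS.opL b).hasFDerivAt (x := c 0)).comp_hasDerivAt 0 hcX).const_add 1
    have h2 : HasDerivAt (fun r => dag (1 + (c r).op)) (dag X.op) 0 := by
      have hh : HasFDerivAt (𝕜 := ℝ) (E := Op H) (F := Op H) (fun A => dag A) (dagL H)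
        (1 + (c 0).op) := (dagL H).hasFDerivAt
      exact hh.comp_hasDerivAt 0 h1
    have h3 := h2.mul h1
    have h4 : HasDerivAt (fun r => dag (1 + (c r).op) * (1 + (c r).op)) 0 0 := by
      simp only [hO]
      exact hasDerivAt_const _ _
    have h5 := h3.unique h4
    rw [hc0, LHS.op_zero, add_zero, dag_one, one_mul, mul_one] at h5
    exact eq_neg_of_add_eq_zero_left h5
  · intro hX
    refine ⟨fun r => chart b (Exp b (r • X)), ?_, fun r => ?_, ?_, ?_⟩
    · exact contDiff_chart_Exp.comp (contDiff_id.smul contDiff_const)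
    · rw [chart_mem_inChart, ← gInf_eq, coe_mem_cmGroup_iff]
      exact Exp_mem_expGroup (Submodule.smul_mem _ _ hX)
    · simp [Exp_zero, chart_one]
    · have h1 : HasDerivAt (fun r : ℝ => r • X) X 0 := by
        simpa using (hasDerivAt_id (0 : ℝ)).smul_const X
      have h2 : HasFDerivAt (𝕜 := ℝ) (E := LHS b) (F := LHS b) (fun X : LHS b => chart b (Exp b X))
          (ContinuousLinearMap.id ℝ (LHS b)) ((0 : ℝ) • X) := by
        rw [zero_smul]; exact hasFDerivAt_chart_Exp_zero
      exact h2.comp_hasDerivAt 0 h1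

theorem isLocalDiffeoAtZero_Exp :
    IsLocalDiffeoAtZero b (gInf b) (cmGroup b (gInf b)) (fun X => Exp b X) := by
  obtain ⟨φ, h0, hφ, hsm, hlog⟩ := exists_local_log (b := b)
  have : CompleteSpace (gInf b) := isClosed_gInf.completeSpace_coe
  have hmem : ∀ {X : LHS b}, X ∈ skewHS b → X ∈ gInf b := fun h => gInf_eq (b := b) ▸ h
  -- the orthogonal projection turns the local logarithm into a map with values in `g_∞`
  refine ⟨{X | (X : LHS b) ∈ φ.source}, φ.target,
    fun Y => (gInf b).orthogonalProjectionOnto (φ.symm Y),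
    φ.open_source.preimage continuous_subtype_val, φ.open_target, h0, ?_, ?_, ?_, ?_⟩
  · exact (contDiff_chart_Exp.comp (gInf b).subtypeL.contDiff).contDiffOn
  · exact ((gInf b).orthogonalProjectionOnto).contDiff.comp_contDiffOn hsm
  · ext Y
    constructor
    · rintro ⟨X, hX, rfl⟩
      refine ⟨chart_mem_inChart.2 (mem_cmGroup_iff.2 ⟨X, gInf_eq (b := b) ▸ X.2, rfl⟩), ?_⟩
      change chart b (Exp b X) ∈ _
      rw [← hφ]
      exact φ.map_source hX
    · rintro ⟨⟨U, hU, rfl⟩, hY⟩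
      have e : Exp b (φ.symm (chart b U)) = U := chart_injective (by rw [← hφ, φ.right_inv hY])
      have hs := hlog _ (φ.map_target hY) (by
        rw [e]; exact mem_lorentzO_of_mem_expGroup (coe_mem_cmGroup_iff.1 hU))
      exact ⟨⟨_, hmem hs⟩, φ.map_target hY, congrArg (chart b) e⟩
  · intro X hX
    change (gInf b).orthogonalProjectionOnto (φ.symm (chart b (Exp b X))) = X
    rw [← hφ, φ.left_inv hX, Submodule.orthogonalProjectionOnto_mem_subspace_eq_self]

/-! ### The finite dimensional groups -/

theorem e_mem_Hn_orthogonal {n j : ℕ} (h : n < j) : e b j ∈ (Hn b n)ᗮ := by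
  rw [Submodule.mem_orthogonal]
  intro u hu
  induction hu using Submodule.span_induction with
  | mem x hx =>
    obtain ⟨i, hi, rfl⟩ := hx
    rw [inner_e, if_neg]
    rintro rfl
    exact absurd h (not_lt.2 hi)
  | zero => exact inner_zero_left _
  | add x y _ _ hx hy => rw [inner_add_left, hx, hy, add_zero]
  | smul c x _ hx => rw [inner_smul_left, hx, mul_zero]

theorem isClosed_Hn (n : ℕ) : IsClosed (Hn b n : Set (Sp H)) := by
  have : FiniteDimensional ℝ (Hn b n) :=
    FiniteDimensional.span_of_finite ℝ ((Set.finite_le_nat n).image _)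
  exact Submodule.closed_of_finiteDimensional _

variable (b) in
/-- The orthogonal projection onto the span of `e 0, …, e n`. -/
def headProj (n : ℕ) : LHS b := ∑ i ∈ Finset.range (n + 1), rankOneHS b (e b i) (e b i)

theorem headProj_apply_e (n j : ℕ) :
    (headProj b n).op (e b j) = if j ≤ n then e b j else 0 := by
  have : (headProj b n).op = ∑ i ∈ Finset.range (n + 1), (rankOneHS b (e b i) (e b i)).op :=
    map_sum (LHS.opL b) _ _
  rw [this, sum_apply]
  simp only [op_rankOneHS, inner_e, ite_smul, one_smul, zero_smul]
  simp

theorem one_mem_On (n : ℕ) : (1 : (Op H)ˣ) ∈ On b n :=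
  ⟨(lorentzOGroup H).one_mem, fun _ _ => rfl, fun _ h => h⟩

/-- The topologies of the operator norm and of the Hilbert-Schmidt norm agree on `O(n,1)`, so that
`SO_0(n,1)` is connected for the latter. -/
theorem SO0_subset_cmGroup (n : ℕ) : SO0 b n ⊆ cmGroup b (gInf b) := by
  intro A hA
  have hsub : SO0 b n ⊆ On b n := connectedComponentIn_subset _ _
  -- on `O(n,1)` the operator `A - 1` is its own composition with a fixed projection
  let c : (Op H)ˣ → LHS b := fun A => LHS.lmul b ((A : Op H) - 1) (headProj b n)
  have hc : Continuous c :=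
    ((LHS.lmul b).continuous.comp (Units.continuous_val.sub continuous_const)).clm_apply
      continuous_const
  have hcγ : ∀ A ∈ SO0 b n, (A : Op H) = 1 + (c A).op := fun A hA => by
    rw [← sub_eq_iff_eq_add']
    refine ext_e (b := b) fun j => ?_
    change _ = ((A : Op H) - 1) ((headProj b n).op (e b j))
    rw [headProj_apply_e]
    split_ifs with hj
    · rfl
    · have := (hsub hA).2.1 _ (e_mem_Hn_orthogonal (not_le.1 hj))
      rw [map_zero, sub_apply, this]
      exact sub_self _
  rw [mem_cmGroup_iff]
  exact exists_Exp_of_isPreconnected isPreconnected_connectedComponentIn (γ := id) hc.continuousOn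
    hcγ (fun A hA => (hsub hA).1) (mem_connectedComponentIn (one_mem_On n)) rfl hA

/-- The exponential of `A` moves `w` along any closed subspace that is invariant under `A` and
contains `A w`. -/
theorem exp_apply_sub_mem {A : Op H} {p : Submodule ℝ (Sp H)} (hp : IsClosed (p : Set (Sp H)))
    (hA : ∀ w ∈ p, A w ∈ p) {w : Sp H} (hw : A w ∈ p) : NormedSpace.exp A w - w ∈ p := by
  have h1 : HasSum (fun n : ℕ => ((n.factorial : ℝ)⁻¹) • A ^ n) (NormedSpace.exp A) :=
    NormedSpace.exp_series_hasSum_exp' (𝕂 := ℝ) A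
  have h2 : HasSum (fun n : ℕ => ((n.factorial : ℝ)⁻¹) • (A ^ n) w) (NormedSpace.exp A w) :=
    h1.mapL (ContinuousLinearMap.apply ℝ (Sp H) w)
  have h3 := (hasSum_nat_add_iff' 1).2 h2
  have hpow : ∀ n : ℕ, (A ^ (n + 1)) w ∈ p := fun n => by
    induction n with
    | zero => simpa using hw
    | succ n ih =>
      rw [pow_succ' A (n + 1)]
      exact hA _ ih
  have h4 := hp.mem_of_tendsto h3 (Eventually.of_forall fun s =>
    p.sum_mem fun n _ => p.smul_mem _ (hpow n))
  simpa using h4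

theorem Exp_mem_On {n : ℕ} {X : LHS b} (hX : X ∈ so b n) : (Exp b X : (Op H)ˣ) ∈ On b n := by
  obtain ⟨h1, h2, h3⟩ := mem_so_iff.1 hX
  refine ⟨Exp_mem_lorentzO h1, fun w hw => ?_, fun w hw => ?_⟩
  · have := exp_apply_sub_mem (p := ⊥) (A := X.op) isClosed_singleton
      (fun w hw => by simp [(Submodule.mem_bot ℝ).1 hw]) ((Submodule.mem_bot ℝ).2 (h2 w hw))
    exact sub_eq_zero.1 ((Submodule.mem_bot ℝ).1 this)
  · have := exp_apply_sub_mem (A := X.op) (isClosed_Hn n) (fun w _ => h3 w) (h3 w)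
    exact (Submodule.sub_mem_iff_left _ hw).1 this

/-- The one parameter group of `X` connects its exponential to the identity in `O(n,1)`. -/
theorem Exp_mem_SO0 {n : ℕ} {X : LHS b} (hX : X ∈ so b n) : (Exp b X : (Op H)ˣ) ∈ SO0 b n := by
  have hc : Continuous fun t : ℝ => (Exp b (t • X) : (Op H)ˣ) := by
    have h : Continuous fun t : ℝ => (t • X).op := (LHS.opL b).continuous.comp
      (continuous_id.smul continuous_const)
    have he : Continuous (NormedSpace.exp : Op H → Op H) := by
      let _ : NormedAlgebra ℚ (Op H) := NormedAlgebra.restrictScalars ℚ ℝ (Op H)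
      exact NormedSpace.exp_continuous
    exact Units.continuous_iff.2 ⟨he.comp h, he.comp h.neg⟩
  have hs := (isPreconnected_range hc).subset_connectedComponentIn (x := 1) (F := On b n)
    ⟨0, by simp [Exp_zero]⟩ (by
      rintro _ ⟨t, rfl⟩
      exact Exp_mem_On ((soSub b n).smul_mem t hX))
  exact hs ⟨1, by simp⟩

theorem exists_SO0_cmDist_lt {A : (Op H)ˣ} (hA : A ∈ cmGroup b (gInf b)) {ε : ℝ≥0∞}
    (hε : 0 < ε) : ∃ n : ℕ, ∃ B ∈ SO0 b n, cmDist b (gInf b) A B < ε := by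
  obtain ⟨X, hX, rfl⟩ := mem_cmGroup_iff.1 hA
  have hX' : X ∈ closure (⋃ n : ℕ, so b n) := by
    rw [closure_iUnion_so, gInf_eq]; exact hX
  obtain ⟨x, hx, hlim⟩ := mem_closure_iff_seq_limit.1 hX'
  have hmem : ∀ k, ∃ n, x k ∈ so b n := fun k => mem_iUnion.1 (hx k)
  have hsk : ∀ k, x k ∈ skewHS b := fun k => (mem_so_iff.1 (hmem k).choose_spec).1
  obtain ⟨k, hk⟩ := (eventually_cmDist_lt (Exp_mem_expGroup hX)
    (fun k => Exp_mem_expGroup (hsk k)) ((continuous_chart_Exp.tendsto X).comp hlim) hε).exists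
  obtain ⟨n, hn⟩ := hmem k
  exact ⟨n, _, Exp_mem_SO0 hn, hk.1⟩

/-! ### Determinants of orthogonal Hilbert-Schmidt perturbations of the identity -/

theorem one_sub_sum_le_prod {ι : Type*} (s : Finset ι) {l : ι → ℝ} (h0 : ∀ i ∈ s, 0 ≤ l i)
    (h1 : ∀ i ∈ s, l i ≤ 1) : 1 - ∑ i ∈ s, (1 - l i) ≤ ∏ i ∈ s, l i := by
  classical
  induction s using Finset.induction_on with
  | empty => simp
  | insert a s ha ih =>
    rw [Finset.sum_insert ha, Finset.prod_insert ha]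
    have e1 := ih (fun i hi => h0 i (Finset.mem_insert_of_mem hi))
      (fun i hi => h1 i (Finset.mem_insert_of_mem hi))
    have e2 : ∏ i ∈ s, l i ≤ 1 := Finset.prod_le_one
      (fun i hi => h0 i (Finset.mem_insert_of_mem hi))
      (fun i hi => h1 i (Finset.mem_insert_of_mem hi))
    nlinarith [h1 a (Finset.mem_insert_self a s)]

open Matrix in
/-- The determinant of a matrix whose transpose is a contraction is close to `±1` as soon as its
rows almost have length `1`. -/
theorem det_sq_bounds {n : ℕ} (M : Matrix (Fin n) (Fin n) ℝ)
    (hM : ∀ x, (Mᵀ *ᵥ x) ⬝ᵥ (Mᵀ *ᵥ x) ≤ x ⬝ᵥ x) :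
    1 - ∑ i, (1 - ∑ j, M i j ^ 2) ≤ M.det ^ 2 ∧ M.det ^ 2 ≤ 1 := by
  have hB : (M * Mᵀ).PosSemidef := by
    simpa [conjTranspose_eq_transpose_of_trivial] using posSemidef_self_mul_conjTranspose M
  have h0 : ∀ i, 0 ≤ hB.1.eigenvalues i := fun i => hB.eigenvalues_nonneg i
  have h1 : ∀ i, hB.1.eigenvalues i ≤ 1 := fun i => by
    have e1 := hB.1.eigenvalues_eq i
    have e2 : (hB.1.eigenvectorBasis i).ofLp ⬝ᵥ (hB.1.eigenvectorBasis i).ofLp = 1 := by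
      have := real_inner_self_eq_norm_sq (hB.1.eigenvectorBasis i)
      rw [hB.1.eigenvectorBasis.orthonormal.1 i, one_pow] at this
      exact this
    rw [e1, ← e2]
    refine le_trans (le_of_eq ?_) (hM _)
    rw [← mulVec_mulVec, dotProduct_mulVec, ← mulVec_transpose]
    rfl
  have hdet : M.det ^ 2 = ∏ i, hB.1.eigenvalues i := by
    have := hB.1.det_eq_prod_eigenvalues
    rw [det_mul, det_transpose] at this
    rw [sq, this]
    rfl
  have htr : ∑ i, hB.1.eigenvalues i = ∑ i, ∑ j, M i j ^ 2 := by
    have := hB.1.trace_eq_sum_eigenvalues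
    have e : (M * Mᵀ).trace = ∑ i, ∑ j, M i j ^ 2 := by
      simp [trace, mul_apply, sq]
    rw [← e, this]
    rfl
  rw [hdet]
  refine ⟨?_, Finset.prod_le_one (fun i _ => h0 i) fun i _ => h1 i⟩
  have := one_sub_sum_le_prod Finset.univ (fun i _ => h0 i) fun i _ => h1 i
  rwa [Finset.sum_sub_distrib, htr, ← Finset.sum_sub_distrib] at this

/-- For an operator `1 + K` with isometric adjoint, the truncated determinants are close to `±1`. -/
theorem truncDet_sq_bounds {P : Op H} {K : LHS b} (hPK : P = 1 + K.op)
    (hP : ∀ y, ‖ContinuousLinearMap.adjoint P y‖ = ‖y‖) (n : ℕ) :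
    1 - tailSq n K ≤ truncDet b n P ^ 2 ∧ truncDet b n P ^ 2 ≤ 1 := by
  have hadj : ∀ x j, (inner ℝ (e b j) (ContinuousLinearMap.adjoint P x) : ℝ)
      = inner ℝ x (P (e b j)) := fun x j => by
    rw [ContinuousLinearMap.adjoint_inner_right, real_inner_comm]
  have h := det_sq_bounds (Matrix.of fun i j : Fin n => (inner ℝ (e b i) (P (e b j)) : ℝ))
    fun x => by
      let y : Sp H := ∑ i : Fin n, x i • e b i
      have e1 : ∀ j : Fin n, (Matrix.mulVec (Matrix.of fun i j : Fin n =>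
          (inner ℝ (e b i) (P (e b j)) : ℝ)).transpose x) j
          = inner ℝ (e b j) (ContinuousLinearMap.adjoint P y) := fun j => by
        rw [hadj, sum_inner]
        simp [Matrix.mulVec, dotProduct, real_inner_smul_left, mul_comm]
      have e2 : ‖y‖ ^ 2 = dotProduct x x := by
        rw [← real_inner_self_eq_norm_sq, sum_inner]
        refine Finset.sum_congr rfl fun i _ => ?_
        rw [inner_sum, Finset.sum_eq_single i]
        · rw [real_inner_smul_left, real_inner_smul_right, inner_e, if_pos rfl, mul_one]
        · intro j _ hj
          rw [real_inner_smul_left, real_inner_smul_right, inner_e,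
            if_neg (fun h => hj (Fin.ext h.symm))]
          ring
        · simp
      rw [← e2, ← hP y]
      calc _ = ∑ j : Fin n, (inner ℝ (e b j) (ContinuousLinearMap.adjoint P y) : ℝ) ^ 2 :=
            Finset.sum_congr rfl fun j _ => by rw [e1, sq]
        _ ≤ _ := by
            rw [Fin.sum_univ_eq_sum_range
              (fun j => (inner ℝ (e b j) (ContinuousLinearMap.adjoint P y) : ℝ) ^ 2)]
            exact sum_inner_sq_le _ _
  refine ⟨le_trans ?_ h.1, h.2⟩
  -- a row of `P` has length `1`, so its defect is the part of the row beyond `n`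
  have hrow : ∀ i : Fin n, HasSum (fun j => (inner ℝ (e b i) (K.op (e b (j + n))) : ℝ) ^ 2)
      (1 - ∑ j : Fin n, (inner ℝ (e b i) (P (e b j)) : ℝ) ^ 2) := fun i => by
    have e1 := hasSum_inner_sq (b := b) (ContinuousLinearMap.adjoint P (e b i))
    simp only [hadj] at e1
    rw [hP, (orthonormal_e b).1, one_pow] at e1
    have e2 := (hasSum_nat_add_iff' n).2 e1
    rw [← Fin.sum_univ_eq_sum_range (fun j => (inner ℝ (e b i) (P (e b j)) : ℝ) ^ 2)] at e2
    refine e2.congr_fun fun j => ?_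
    rw [hPK, add_apply, inner_add_right, one_apply_eq_self, inner_e, if_neg (by omega), zero_add]
  have hsum := hasSum_sum (s := Finset.univ) fun i _ => hrow i
  have hle := hasSum_le (fun j => ?_) hsum (summable_tail n K).hasSum
  · simp only [Matrix.of_apply]
    unfold tailSq
    linarith
  · rw [Fin.sum_univ_eq_sum_range
      (fun i => (inner ℝ (e b i) (K.op (e b (j + n))) : ℝ) ^ 2)]
    exact sum_inner_sq_le _ _

/-- The truncated determinants of an orthogonal operator that is a Hilbert-Schmidt perturbation of
the identity converge to `1` if they are positive. -/
theorem tendsto_truncDet {P : Op H} {K : LHS b} (hPK : P = 1 + K.op)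
    (hP : ∀ y, ‖ContinuousLinearMap.adjoint P y‖ = ‖y‖) (hpos : PosDet K) :
    Tendsto (fun n => truncDet b n P) atTop (𝓝 1) := by
  have h1 : Tendsto (fun n => truncDet b n P ^ 2) atTop (𝓝 1) := by
    have := (tendsto_tailSq K).const_sub 1
    rw [sub_zero] at this
    exact tendsto_of_tendsto_of_tendsto_of_le_of_le this tendsto_const_nhds
      (fun n => (truncDet_sq_bounds hPK hP n).1) fun n => (truncDet_sq_bounds hPK hP n).2
  have h2 := (Real.continuous_sqrt.tendsto 1).comp h1
  rw [Real.sqrt_one] at h2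
  refine h2.congr' ?_
  filter_upwards [hpos] with n hn
  rw [← hPK] at hn
  exact Real.sqrt_sq hn.le

theorem truncDet_succ_blockOp (Q : H →L[ℝ] H) (n : ℕ) : truncDet b (n + 1) (blockOp 1 0 0 Q)
    = (Matrix.of fun i j : Fin n => (inner ℝ (b i) (Q (b j)) : ℝ)).det := by
  rw [truncDet, Matrix.det_succ_row_zero, Fin.sum_univ_succ, Finset.sum_eq_zero, add_zero]
  · have h : ∀ i j : Fin n, (inner ℝ (e b (i + 1)) (blockOp 1 0 0 Q (e b (j + 1))) : ℝ)
        = inner ℝ (b i) (Q (b j)) := fun i j => by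
      simp [e, blockOp_vec, inner_vec]
    have h0 : (inner ℝ (e b 0) (blockOp 1 0 0 Q (e b 0)) : ℝ) = 1 := by
      rw [e, blockOp_vec, inner_vec]
      simp
    simp only [Fin.val_zero, pow_zero, one_mul, Matrix.of_apply, h0]
    congr 1
    ext i j
    simpa using h i j
  · intro j _
    have : (inner ℝ (e b 0) (blockOp 1 0 0 Q (e b (j + 1))) : ℝ) = 0 := by
      simp [e, blockOp_vec, inner_vec]
    simp [this]

/-! ### Rotations and boosts -/

/-- The infinitesimal rotation in the timelike plane of `(0, u)` and `(1, 0)` is an infinitesimal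
boost. -/
theorem boostGen_apply (u : H) (s : ℝ) (x : H) :
    (rotGen b (vec 0 u) (vec 1 0)).op (vec s x) = vec (inner ℝ u x) (s • u) := by
  rw [op_rotGen]
  apply Sp.ext <;> simp [lorentz]

/-- The exponentials of the boost generators. -/
theorem exp_boostGen_apply {u : H} (hu : ‖u‖ = 1) (α s : ℝ) (x : H) :
    NormedSpace.exp (α • (rotGen b (vec 0 u) (vec 1 0)).op) (vec s x)
      = vec (Real.cosh α * s + Real.sinh α * inner ℝ u x)
        ((Real.sinh α * s + (Real.cosh α - 1) * inner ℝ u x) • u + x) := by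
  have huu : (inner ℝ u u : ℝ) = 1 := by rw [real_inner_self_eq_norm_sq, hu, one_pow]
  have hcube : (rotGen b (vec 0 u) (vec 1 0)).op * (rotGen b (vec 0 u) (vec 1 0)).op
      * (rotGen b (vec 0 u) (vec 1 0)).op = (rotGen b (vec 0 u) (vec 1 0)).op := by
    ext1 w
    rw [← vec_fst_snd w]
    simp only [mul_apply_eq_comp, boostGen_apply, inner_smul_right, huu, mul_one]
  rw [exp_smul_of_cube_eq hcube]
  simp only [add_apply, smul_apply, one_apply_eq_self, mul_apply_eq_comp, boostGen_apply,
    inner_smul_right, huu, mul_one]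
  apply Sp.ext
  · simp; ring
  · simp only [Sp.snd_add, Sp.snd_smul, snd_vec]
    module

/-- A future directed unit timelike vector is mapped to `(1, 0)` by a boost. -/
theorem exists_boost {w : Sp H} (hw : lorentz w w = -1) (hw0 : 0 < w.fst)
    (b : HilbertBasis ℕ ℝ H) :
    ∃ X ∈ skewHS b, IsBoost (NormedSpace.exp X.op) ∧ NormedSpace.exp X.op w = vec 1 0 := by
  let α := Real.arsinh ‖w.snd‖
  have hsinh : Real.sinh α = ‖w.snd‖ := Real.sinh_arsinh _
  have hα : 0 ≤ α := Real.arsinh_nonneg_iff.2 (norm_nonneg _)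
  have hcosh : Real.cosh α = w.fst := by
    have h1 := Real.cosh_sq α
    rw [hsinh, norm_snd_sq, hw] at h1
    have h2 : Real.cosh α ^ 2 = w.fst ^ 2 := by rw [h1]; ring
    exact (sq_eq_sq₀ (Real.cosh_pos α).le hw0.le).1 h2
  obtain ⟨u, hu, hwu⟩ : ∃ u : H, ‖u‖ = 1 ∧ w.snd = -(‖w.snd‖ • u) := by
    by_cases h : w.snd = 0
    · exact ⟨b 0, b.orthonormal.1 0, by simp [h]⟩
    · have h' : ‖w.snd‖ ≠ 0 := norm_ne_zero_iff.2 h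
      refine ⟨-(‖w.snd‖⁻¹ • w.snd), ?_, ?_⟩
      · rw [norm_neg, norm_smul, norm_inv, norm_norm, inv_mul_cancel₀ h']
      · rw [smul_neg, neg_neg, smul_inv_smul₀ h']
  have huu : (inner ℝ u u : ℝ) = 1 := by rw [real_inner_self_eq_norm_sq, hu, one_pow]
  refine ⟨α • rotGen b (vec 0 u) (vec 1 0), Submodule.smul_mem _ _ (rotGen_mem_skewHS _ _),
    ⟨u, α, hu, hα, ?_, ?_, fun x hx => ?_⟩, ?_⟩
  · rw [LHS.op_smul, exp_boostGen_apply hu]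
    simp
  · rw [LHS.op_smul, exp_boostGen_apply hu, huu]
    congr 1 <;> [ring; module]
  · rw [LHS.op_smul, exp_boostGen_apply hu, hx]
    simp
  · rw [LHS.op_smul, ← vec_fst_snd w, exp_boostGen_apply hu]
    have hin : (inner ℝ u w.snd : ℝ) = -Real.sinh α := by
      rw [hwu, inner_neg_right, inner_smul_right, huu, hsinh]; simp
    have h1 := Real.cosh_sq α
    have hws : w.snd = -(Real.sinh α • u) := by rw [hsinh]; exact hwu
    rw [hin, hws, ← hcosh]
    congr 1
    · nlinarith
    · module

/-- A Lorentz operator that fixes `(1, 0)` is block diagonal with an orthogonal block. -/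
theorem eq_blockOp_of_fix {P : (Op H)ˣ} (hP : P ∈ lorentzO H)
    (hfix : (P : Op H) (vec 1 0) = vec 1 0) :
    (P : Op H) = blockOp 1 0 0 (lowerRight (P : Op H)) := by
  refine eq_blockOp hfix fun x => ?_
  have := hP (vec 1 0) (vec 0 x)
  rw [hfix] at this
  simpa [lorentz] using this

theorem adjoint_mul_lowerRight {P : (Op H)ˣ} (hP : P ∈ lorentzO H)
    (hfix : (P : Op H) (vec 1 0) = vec 1 0) :
    ContinuousLinearMap.adjoint (lowerRight (P : Op H)) * lowerRight (P : Op H) = 1 := by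
  have hb := eq_blockOp_of_fix hP hfix
  ext1 x
  refine ext_inner_left ℝ fun y => ?_
  have h := hP (vec 0 y) (vec 0 x)
  rw [hb, blockOp_vec, blockOp_vec] at h
  rw [mul_apply_eq_comp, ContinuousLinearMap.adjoint_inner_right, one_apply_eq_self]
  simpa [lorentz] using h

theorem lowerRight_mul_adjoint {P : (Op H)ˣ} (hP : P ∈ lorentzO H)
    (hfix : (P : Op H) (vec 1 0) = vec 1 0) :
    lowerRight (P : Op H) * ContinuousLinearMap.adjoint (lowerRight (P : Op H)) = 1 := by
  have hfix' : ((P⁻¹ : (Op H)ˣ) : Op H) (vec 1 0) = vec 1 0 := by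
    conv_lhs => rw [← hfix]
    exact inv_apply P _
  have hb := eq_blockOp_of_fix hP hfix
  have hb' := eq_blockOp_of_fix (inv_mem_lorentzO hP) hfix'
  have h1 : lowerRight (P : Op H) * lowerRight ((P⁻¹ : (Op H)ˣ) : Op H) = 1 := by
    ext1 x
    have h := apply_inv P (vec 0 x)
    rw [hb', blockOp_vec, hb, blockOp_vec] at h
    simpa using congrArg Sp.snd h
  have h2 := adjoint_mul_lowerRight hP hfix
  rwa [← left_inv_eq_right_inv h2 h1] at h1

/-- The boost is the one that maps `A⁻¹ (1, 0)` to `(1, 0)`. -/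
theorem exists_rotation_boost {A : (Op H)ˣ} (hA : A ∈ cmGroup b (gInf b)) :
    ∃ (Q : H →L[ℝ] H) (T : Op H),
      ContinuousLinearMap.adjoint Q * Q = 1 ∧ Q * ContinuousLinearMap.adjoint Q = 1 ∧
      HasDet b Q 1 ∧ IsBoost T ∧ (A : Op H) = blockOp 1 0 0 Q * T := by
  lift A to GLHS b using cmGroup_le_GLHS hA
  have hA' : A ∈ expGroup b := coe_mem_cmGroup_iff.1 hA
  have hSO := (mem_expGroup_iff.1 hA').1
  let w : Sp H := (((A : (Op H)ˣ)⁻¹ : (Op H)ˣ) : Op H) (vec 1 0)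
  have hl : lorentz (vec 1 0 : Sp H) (vec 1 0) = -1 := by simp [lorentz]
  have hw : lorentz w w = -1 := by rw [← hl]; exact (inv_mem_lorentzO hSO.1) _ _
  have hw0 : 0 < w.fst :=
    fst_pos_of_causal b (inv_mem_lorentzSO hSO) (by rw [hl]; norm_num) (by simp)
  obtain ⟨X, hX, hT, hXw⟩ := exists_boost hw hw0 b
  let P : GLHS b := A * (Exp b X)⁻¹
  have hPG : P ∈ expGroup b := mul_mem hA' (inv_mem (Exp_mem_expGroup hX))
  have hPT : P * Exp b X = A := inv_mul_cancel_right _ _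
  have hPO := mem_lorentzO_of_mem_expGroup hPG
  have hfix : ((P : (Op H)ˣ) : Op H) (vec 1 0) = vec 1 0 := by
    have h1 : ((A : (Op H)ˣ) : Op H) w = vec 1 0 := apply_inv _ _
    rw [← hPT, coe_mul_apply, coe_Exp, hXw] at h1
    exact h1
  obtain ⟨Q, hb, hQ1, hQ2⟩ : ∃ Q : H →L[ℝ] H, ((P : (Op H)ˣ) : Op H) = blockOp 1 0 0 Q ∧
      ContinuousLinearMap.adjoint Q * Q = 1 ∧ Q * ContinuousLinearMap.adjoint Q = 1 :=
    ⟨_, eq_blockOp_of_fix hPO hfix, adjoint_mul_lowerRight hPO hfix,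
      lowerRight_mul_adjoint hPO hfix⟩
  refine ⟨Q, NormedSpace.exp X.op, hQ1, hQ2, ?_, hT, ?_⟩
  · have hadj : ContinuousLinearMap.adjoint ((P : (Op H)ˣ) : Op H)
        = blockOp 1 0 0 (ContinuousLinearMap.adjoint Q) := by
      symm
      rw [ContinuousLinearMap.eq_adjoint_iff]
      intro x y
      conv_rhs => rw [hb]
      rw [inner_eq, inner_eq]
      simp [ContinuousLinearMap.adjoint_inner_left]
    have hnorm : ∀ y, ‖ContinuousLinearMap.adjoint ((P : (Op H)ˣ) : Op H) y‖ = ‖y‖ := fun y => by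
      have h : ((P : (Op H)ˣ) : Op H) * ContinuousLinearMap.adjoint ((P : (Op H)ˣ) : Op H) = 1 := by
        rw [hadj, hb]
        ext1 z
        rw [← vec_fst_snd z, mul_apply_eq_comp, blockOp_vec, blockOp_vec, one_apply_eq_self]
        have := DFunLike.congr_fun hQ2 z.snd
        simp only [mul_apply_eq_comp, one_apply_eq_self] at this
        simp [this]
      have h2 : ‖ContinuousLinearMap.adjoint ((P : (Op H)ˣ) : Op H) y‖ ^ 2 = ‖y‖ ^ 2 := by
        rw [← real_inner_self_eq_norm_sq, ContinuousLinearMap.adjoint_inner_left,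
          ← mul_apply_eq_comp, h, one_apply_eq_self, real_inner_self_eq_norm_sq]
      exact (sq_eq_sq₀ (norm_nonneg _) (norm_nonneg _)).1 h2
    have := (tendsto_truncDet (coe_eq_one_add P) hnorm (mem_expGroup_iff.1 hPG).2).comp
      (tendsto_add_atTop_nat 1)
    refine this.congr fun n => ?_
    rw [← truncDet_succ_blockOp, ← hb]
    rfl
  · rw [← hb, ← hPT]
    rfl

/-! ### Connected components -/

theorem inChart_cmGroup : inChart b (cmGroup b (gInf b))
    = {K | K ∈ inChart b (lorentzSO H) ∧ PosDet K} := by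
  ext K
  constructor
  · rintro ⟨U, hU, rfl⟩
    have := mem_expGroup_iff.1 (coe_mem_cmGroup_iff.1 hU)
    exact ⟨chart_mem_inChart.2 this.1, this.2⟩
  · rintro ⟨⟨U, hU, rfl⟩, hK⟩
    exact chart_mem_inChart.2 (coe_mem_cmGroup_iff.2 (mem_expGroup_iff.2 ⟨hU, hK⟩))

theorem isPreconnected_inChart_cmGroup : IsPreconnected (inChart b (cmGroup b (gInf b))) := by
  have h : inChart b (cmGroup b (gInf b))
      = (fun X : LHS b => chart b (Exp b X)) '' (skewHS b : Set (LHS b)) := by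
    ext K
    constructor
    · rintro ⟨U, hU, rfl⟩
      obtain ⟨X, hX, rfl⟩ := coe_mem_cmGroup_iff.1 hU
      exact ⟨X, hX, rfl⟩
    · rintro ⟨X, hX, rfl⟩
      exact chart_mem_inChart.2 (coe_mem_cmGroup_iff.2 (Exp_mem_expGroup hX))
  rw [h]
  exact (skewHS b).convex.isPreconnected.image _ continuous_chart_Exp.continuousOn

theorem zero_mem_inChart_cmGroup : (0 : LHS b) ∈ inChart b (cmGroup b (gInf b)) := by
  rw [← chart_one, chart_mem_inChart, coe_mem_cmGroup_iff]
  exact one_mem _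

theorem isUnit_of_mem_inChart {G : Set (Op H)ˣ} {K : LHS b} (hK : K ∈ inChart b G) :
    IsUnit (1 + K.op) := by
  obtain ⟨U, -, rfl⟩ := hK
  exact isUnit_one_add_chart U

theorem inChart_cmGroup_eq_connectedComponentIn : inChart b (cmGroup b (gInf b))
    = connectedComponentIn (inChart b (lorentzSO H)) 0 := by
  have h0 := zero_mem_inChart_cmGroup (b := b)
  have hsub : inChart b (cmGroup b (gInf b)) ⊆ inChart b (lorentzSO H) := by
    rw [inChart_cmGroup]; exact fun K hK => hK.1
  refine (isPreconnected_inChart_cmGroup.subset_connectedComponentIn h0 hsub).antisymm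
    fun K hK => ?_
  rw [inChart_cmGroup]
  have hK' := connectedComponentIn_subset _ _ hK
  exact ⟨hK', posDet_of_isPreconnected isPreconnected_connectedComponentIn
    (fun L hL => isUnit_of_mem_inChart (connectedComponentIn_subset _ _ hL))
    (mem_connectedComponentIn (hsub h0)) hK posDet_zero⟩

/-- Two points of a connected subset of `S` are in the same connected component of `S`. -/
theorem connectedComponents_mk_eq {X : Type*} [TopologicalSpace X] {S C : Set X} (hCS : C ⊆ S)
    (hC : IsPreconnected C) {x y : S} (hx : (x : X) ∈ C) (hy : (y : X) ∈ C) :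
    (x : ConnectedComponents S) = y := by
  have h1 : IsPreconnected (Subtype.val ⁻¹' C : Set S) := by
    rw [← Topology.IsInducing.subtypeVal.isPreconnected_image, Subtype.image_preimage_coe,
      inter_eq_self_of_subset_right hCS]
    exact hC
  rw [ConnectedComponents.coe_eq_coe']
  exact h1.subset_connectedComponent hy hx

/-- The two components are the Cameron-Martin group and its translate by a reflection. -/
theorem card_connectedComponents_inChart_lorentzSO :
    Nat.card (ConnectedComponents (inChart b (lorentzSO H))) = 2 := by
  have hG : inChart b (cmGroup b (gInf b)) ⊆ inChart b (lorentzSO H) := by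
    rw [inChart_cmGroup]; exact fun K hK => hK.1
  have h0 := zero_mem_inChart_cmGroup (b := b)
  have hr₀ : (refl₀ b : (Op H)ˣ) ∈ lorentzSO H := reflU_mem_lorentzSO lorentz_e_one
  have hinv : ∀ U : GLHS b, refl₀ b * (refl₀ b * U) = U := reflU_mul_reflU_mul lorentz_e_one
  let R : Set (LHS b) := translate (refl₀ b) '' inChart b (cmGroup b (gInf b))
  have hR : IsPreconnected R :=
    isPreconnected_inChart_cmGroup.image _ (translate (refl₀ b)).continuous.continuousOn
  have hRS : R ⊆ inChart b (lorentzSO H) := by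
    rintro _ ⟨_, ⟨U, hU, rfl⟩, rfl⟩
    rw [translate_chart]
    exact chart_mem_inChart.2
      (mul_mem_lorentzSO hr₀ (mem_expGroup_iff.1 (coe_mem_cmGroup_iff.1 hU)).1)
  have h1R : chart b (refl₀ b) ∈ R := ⟨0, h0, by rw [← chart_one, translate_chart, mul_one]⟩
  rw [Nat.card_eq_two_iff]
  refine ⟨((⟨0, hG h0⟩ : inChart b (lorentzSO H)) : ConnectedComponents _),
    ((⟨chart b (refl₀ b), hRS h1R⟩ : inChart b (lorentzSO H)) : ConnectedComponents _), ?_, ?_⟩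
  · intro h
    rw [ConnectedComponents.coe_eq_coe] at h
    have hm : (⟨chart b (refl₀ b), hRS h1R⟩ : inChart b (lorentzSO H))
        ∈ connectedComponent (⟨0, hG h0⟩ : inChart b (lorentzSO H)) := by
      rw [h]; exact mem_connectedComponent
    refine not_posDet_refl₀ (b := b) (posDet_of_isPreconnected
      (isPreconnected_connectedComponent.image Subtype.val continuous_subtype_val.continuousOn)
      ?_ ⟨_, mem_connectedComponent, rfl⟩ ⟨_, hm, rfl⟩ posDet_zero)
    rintro _ ⟨K, -, rfl⟩
    exact isUnit_of_mem_inChart K.2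
  · rw [eq_univ_iff_forall]
    intro x
    obtain ⟨⟨_, ⟨U, hU, rfl⟩⟩, rfl⟩ := ConnectedComponents.surjective_coe x
    by_cases hUG : U ∈ expGroup b
    · left
      exact connectedComponents_mk_eq hG isPreconnected_inChart_cmGroup
        (chart_mem_inChart.2 (coe_mem_cmGroup_iff.2 hUG)) h0
    · right
      refine connectedComponents_mk_eq hRS hR ⟨chart b (refl₀ b * U), ?_, ?_⟩ h1R
      · exact chart_mem_inChart.2 (coe_mem_cmGroup_iff.2 (refl₀_mul_mem_expGroup hU hUG))
      · rw [translate_chart, hinv]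

end HSLorentz

end

open HSLorentz in
theorem mainTheorem4 {H : Type*} [NormedAddCommGroup H] [InnerProductSpace ℝ H] [CompleteSpace H]
    (b : HilbertBasis ℕ ℝ H) :
    -- the Lie algebra
    (hInf b ⟂ sInf b ∧ (gInf b : Set (LHS b)) = closure (⋃ n : ℕ, so b n) ∧
      CompletionAssumption b (⋃ n : ℕ, so b n) (gInf b)) ∧
    -- the Cameron-Martin group, with the topology of its distance, is a Lie subgroup
    (IsLieSubgroup b (cmGroup b (gInf b)) (gInf b) ∧
      (∀ (A : GLHS b) (B : ℕ → GLHS b), (A : (Op H)ˣ) ∈ cmGroup b (gInf b) →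
        (∀ k, (B k : (Op H)ˣ) ∈ cmGroup b (gInf b)) →
        (Tendsto (fun k => cmDist b (gInf b) (B k) A) atTop (𝓝 0) ↔
          Tendsto (fun k => chart b (B k)) atTop (𝓝 (chart b A)))) ∧
      (⋃ n : ℕ, SO0 b n) ⊆ cmGroup b (gInf b) ∧
      (∀ A ∈ cmGroup b (gInf b), ∀ ε : ℝ≥0∞, 0 < ε →
        ∃ n : ℕ, ∃ B ∈ SO0 b n, cmDist b (gInf b) A B < ε) ∧
      lieAlg b (cmGroup b (gInf b)) = gInf b) ∧
    -- rotations, boosts and components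
    ((∀ A ∈ cmGroup b (gInf b), ∃ (Q : H →L[ℝ] H) (T : Op H),
        ContinuousLinearMap.adjoint Q * Q = 1 ∧ Q * ContinuousLinearMap.adjoint Q = 1 ∧
        HasDet b Q 1 ∧ IsBoost T ∧ (A : Op H) = blockOp 1 0 0 Q * T) ∧
      Nat.card (ConnectedComponents (inChart b (lorentzSO H))) = 2 ∧
      inChart b (cmGroup b (gInf b)) = connectedComponentIn (inChart b (lorentzSO H)) 0) ∧
    -- the exponential map
    ((∀ X ∈ gInf b, (Exp b X : (Op H)ˣ) ∈ cmGroup b (gInf b)) ∧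
      (∀ A ∈ cmGroup b (gInf b), ∃ X ∈ gInf b, (Exp b X : (Op H)ˣ) = A) ∧
      IsLocalDiffeoAtZero b (gInf b) (cmGroup b (gInf b)) (fun X => Exp b X)) := by
  refine ⟨⟨isOrtho_hInf_sInf, closure_iUnion_so.symm, completionAssumption_gInf b⟩,
    ⟨isLieSubgroup_cmGroup, fun A B hA hB => tendsto_cmDist_iff hA hB,
      iUnion_subset SO0_subset_cmGroup, fun A hA ε hε => exists_SO0_cmDist_lt hA hε,
      lieAlg_cmGroup⟩,
    ⟨fun A hA => exists_rotation_boost hA, card_connectedComponents_inChart_lorentzSO,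
      inChart_cmGroup_eq_connectedComponentIn⟩,
    fun X hX => ?_, fun A hA => ?_, isLocalDiffeoAtZero_Exp⟩
  · rw [gInf_eq] at hX
    exact mem_cmGroup_iff.2 ⟨X, hX, rfl⟩
  · obtain ⟨X, hX, h⟩ := mem_cmGroup_iff.1 hA
    exact ⟨X, by rwa [gInf_eq], h⟩
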